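/- Conventions. Smooth manifolds are finite dimensional, Hausdorff and second countable, and functions are complex valued. A smooth étale groupoid $\mathcal G=(\mathcal G_1\rightrightarrows\mathcal G_0)$ has smooth manifolds of objects and arrows, and all its structure maps are local diffeomorphisms; $gg'$ is defined when $s(g)=t(g')$. It is proper if $(s,t):\mathcal G_1\to\mathcal G_0\times\mathcal G_0$ is a proper map. A $\mathcal G$-$\mathcal H$ Morita equivalence bibundle is a smooth manifold $P$ with surjective submersions $\varepsilon:P\to\mathcal G_0$ and $\pi:P\to\mathcal H_0$ and commuting smooth actions $\mathcal G_1\times_{s,\varepsilon}P\to P$ and $P\times_{\pi,t}\mathcal H_1\to P$, such that $\pi$ is $\mathcal G$-invariant, $\varepsilon$ is $\mathcal H$-invariant, and the maps $\mathcal G_1\times_{s,\varepsilon}P\to P\times_\pi P$, $(g,p)\mapsto(gp,p)$, and $P\times_{\pi,t}\mathcal H_1\to P\times_\varepsilon P$, $(p,h)\mapsto(p,ph)$, are diffeomorphisms. For a manifold $M$, $C_c^\infty(M)$ carries the precompact bornology: a set is bounded if for some compact $K\subseteq M$ it is a precompact subset of the Fréchet space of smooth functions with support in $K$. Bornological vector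 spaces are complete (every bounded set lies in a bounded disc whose linear span is a Banach space for the gauge), $\otimes$ is the complete tensor product, and $M\otimes_AN$ is the quotient of $M\otimes N$ by the closure of the span of the elements $ma\otimes n-m\otimes an$. Algebras have bounded associative multiplication, modules have bounded actions. An algebra $A$ with unitalization $A^+$ is quasi-unital if for every bounded $S\subseteq A$ there is a sequence $(\mu_n)$ in $A$ such that $\mu_nx\to x$ and $x\mu_n\to x$ uniformly for $x\in S$ (in the Banach space spanned by a bounded completant disc), and if the multiplication maps $A^+\otimes A\to A$ and $A\otimes A^+\to A$ have bounded left, respectively right, $A^+$-linear sections. A module is essential if the action induces a bornological isomorphism $A\otimes_AM\cong M$ (respectively $M\otimes_AA\cong M$); it is projective if its functor of bounded $A$-linear maps (with the equibounded bornology) preserves short exact sequences with bounded linear splitting; a bimodule is called essential or projective if it is so on both sides. An essential $(A$-$B)$-bimodule $X$ over quasi-unital algebras $A,B$ is a Morita equivalence bimodule if there is an essential projective $(B$-$A)$-bimodule $Y$ with bornological bimodule isomorphisms $A\cong X\otimes_BY$ and $B\cong Y\otimes_AX$. Theorem. Let $\mathcal G$ and $\mathcal H$ be proper smooth étale groupoids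 and let $P$ be a $\mathcal G$-$\mathcal H$ Morita equivalence bibundle. The convolution products $(a*b)(\gamma)=\sum_{\eta\tau=\gamma}a(\eta)b(\tau)$ make $C_c^\infty(\mathcal G):=C_c^\infty(\mathcal G_1)$ and $C_c^\infty(\mathcal H):=C_c^\infty(\mathcal H_1)$ into complete bornological algebras; the formulas $$(a\cdot\xi)(p)=\sum_{t(g)=\varepsilon(p)}a(g)\,\xi(g^{-1}p),\qquad(\xi\cdot b)(p)=\sum_{t(h)=\pi(p)}\xi(ph)\,b(h^{-1})$$ make $C_c^\infty(P)$ into a complete bornological $C_c^\infty(\mathcal G)$-$C_c^\infty(\mathcal H)$-bimodule; and the formulas for the opposite bibundle, $$(b\cdot\xi)(p)=\sum_{t(h)=\pi(p)}b(h)\,\xi(ph),\qquad(\xi\cdot a)(p)=\sum_{s(g)=\varepsilon(p)}\xi(gp)\,a(g),$$ make $C_c^\infty(P)$ into a complete bornological $C_c^\infty(\mathcal H)$-$C_c^\infty(\mathcal G)$-bimodule. The pairing $$\langle\xi,\eta\rangle_{\mathcal H}(h)=\sum_{\pi(p)=t(h)}\xi(p)\,\eta(ph)$$ induces an isomorphism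 of bornological vector spaces $$C_c^\infty(P)\otimes_{C_c^\infty(\mathcal G)}C_c^\infty(P)\;\cong\;C_c^\infty(\mathcal H),$$ where the left-hand factor $C_c^\infty(P)$ is the opposite bimodule. Moreover $C_c^\infty(P)$, as a $C_c^\infty(\mathcal G)$-$C_c^\infty(\mathcal H)$-bimodule, is a Morita equivalence bimodule between quasi-unital bornological algebras. -/

import Mathlib

open scoped Manifold ContDiff
open Set

universe u

noncomputable section

namespace ConvMorita

/-! ### Complete bornological vector spaces over `ℂ`

A bornology is Mathlib's `Bornology`: a family of bounded sets which contains the singletons and is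
closed under subsets and finite unions. -/

section Bornological

variable {V W X Z : Type*} [AddCommGroup V] [Module ℂ V] [AddCommGroup W] [Module ℂ W]
  [AddCommGroup X] [Module ℂ X] [AddCommGroup Z] [Module ℂ Z]

/-- A disc: a convex circled set. -/
def IsDisc (S : Set V) : Prop :=
  Balanced ℂ S ∧ ∀ x ∈ S, ∀ y ∈ S, ∀ a b : ℝ, 0 ≤ a → 0 ≤ b → a + b = 1 →
    (a : ℂ) • x + (b : ℂ) • y ∈ S

/-- The sequence `x` converges to `l` for the gauge of `S`. -/
def GaugeTendsto (S : Set V) (x : ℕ → V) (l : V) : Prop :=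
  ∀ ε : ℝ, 0 < ε → ∃ N : ℕ, ∀ n ≥ N, ∃ s ∈ S, x n - l = (ε : ℂ) • s

/-- The sequence `x` is Cauchy for the gauge of `S`. -/
def GaugeCauchy (S : Set V) (x : ℕ → V) : Prop :=
  ∀ ε : ℝ, 0 < ε → ∃ N : ℕ, ∀ m ≥ N, ∀ n ≥ N, ∃ s ∈ S, x m - x n = (ε : ℂ) • s

/-- A completant disc: the gauge of `S` is a norm on the linear span of `S`, and this span is a
Banach space for it. -/
def IsCompletantDisc (S : Set V) : Prop :=
  IsDisc S ∧
  (∀ x : V, (∀ ε : ℝ, 0 < ε → ∃ s ∈ S, x = (ε : ℂ) • s) → x = 0) ∧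
  ∀ x : ℕ → V, (∀ n, x n ∈ Submodule.span ℂ S) → GaugeCauchy S x →
    ∃ l ∈ Submodule.span ℂ S, GaugeTendsto S x l

variable (V) in
/-- A complete bornological vector space. -/
structure IsCompleteBVS [Bornology V] : Prop where
  smul : ∀ (c : ℂ) (S : Set V), Bornology.IsBounded S → Bornology.IsBounded ((c • ·) '' S)
  add : ∀ S T : Set V, Bornology.IsBounded S → Bornology.IsBounded T →
    Bornology.IsBounded (image2 (· + ·) S T)
  complete : ∀ S : Set V, Bornology.IsBounded S →
    ∃ D : Set V, Bornology.IsBounded D ∧ IsCompletantDisc D ∧ S ⊆ D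

/-- A map is bounded if it sends bounded sets to bounded sets. -/
def IsBoundedMap {V W : Type*} [Bornology V] [Bornology W] (f : V → W) : Prop :=
  ∀ S : Set V, Bornology.IsBounded S → Bornology.IsBounded (f '' S)

/-- A map of two variables is bounded if it sends products of bounded sets to bounded sets. -/
def IsBoundedMap₂ {V W X : Type*} [Bornology V] [Bornology W] [Bornology X] (f : V → W → X) :
    Prop :=
  ∀ (S : Set V) (T : Set W), Bornology.IsBounded S → Bornology.IsBounded T →
    Bornology.IsBounded (image2 f S T)

/-- The equibounded bornology: a set of linear maps is bounded if it sends each bounded set to a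
bounded set. -/
def IsEquibounded [Bornology V] [Bornology W] (𝓕 : Set (V →ₗ[ℂ] W)) : Prop :=
  ∀ S : Set V, Bornology.IsBounded S → Bornology.IsBounded (image2 (fun f v => f v) 𝓕 S)

variable (V W) in
/-- An isomorphism of bornological vector spaces. -/
structure BornEquiv [Bornology V] [Bornology W] where
  toLinearEquiv : V ≃ₗ[ℂ] W
  bounded : IsBoundedMap toLinearEquiv
  bounded_symm : IsBoundedMap toLinearEquiv.symm

/-- Bornological convergence of a sequence: convergence for the gauge of some bounded set. -/
def BorTendsto [Bornology V] (x : ℕ → V) (l : V) : Prop :=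
  ∃ S : Set V, Bornology.IsBounded S ∧ GaugeTendsto S x l

/-- A subspace is closed if it is closed under limits of convergent sequences. -/
def IsBorClosed [Bornology V] (C : Submodule ℂ V) : Prop :=
  ∀ (x : ℕ → V) (l : V), (∀ n, x n ∈ C) → BorTendsto x l → l ∈ C

/-- The closure of a subspace: the smallest closed subspace containing it. -/
def borClosure [Bornology V] (R : Submodule ℂ V) : Submodule ℂ V :=
  sInf {C | R ≤ C ∧ IsBorClosed C}

/-- The quotient of a bornological vector space by the closure of a subspace. -/
def BorQuot [Bornology V] (R : Submodule ℂ V) : Type _ := V ⧸ borClosure R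

namespace BorQuot

variable [Bornology V] (R : Submodule ℂ V)

instance : AddCommGroup (BorQuot R) := inferInstanceAs (AddCommGroup (V ⧸ borClosure R))
instance : Module ℂ (BorQuot R) := inferInstanceAs (Module ℂ (V ⧸ borClosure R))

/-- The quotient map. -/
def mk : V →ₗ[ℂ] BorQuot R := (borClosure R).mkQ

theorem mk_surjective : Function.Surjective (mk R) := (borClosure R).mkQ_surjective

/-- The quotient bornology: the bounded sets are those contained in the image of a bounded set. -/
instance : Bornology (BorQuot R) :=
  Bornology.ofBounded {S | ∃ T : Set V, Bornology.IsBounded T ∧ S ⊆ mk R '' T}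
    ⟨∅, Bornology.isBounded_empty, empty_subset _⟩
    (fun _ ⟨T, hT, h⟩ _ h' => ⟨T, hT, h'.trans h⟩)
    (fun _ ⟨T, hT, h⟩ _ ⟨T', hT', h'⟩ => ⟨T ∪ T', hT.union hT', by
      rw [image_union]; exact union_subset_union h h'⟩)
    (fun x => by
      obtain ⟨v, rfl⟩ := mk_surjective R x
      exact ⟨{v}, Bornology.isBounded_singleton, by simp⟩)

end BorQuot

/-! ### The complete tensor product

For a set `Y` with a bornology, `FreeBVS Y` is the inductive limit of the Banach spaces `ℓ¹(B)` for
`B ⊆ Y` bounded.  It is the free complete bornological vector space on `Y`: every map from `Y` to a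
complete bornological vector space which preserves bounded sets extends uniquely to a bounded linear
map on `FreeBVS Y`.  The complete tensor product of `V` and `W` is the quotient of `FreeBVS (V × W)`
by the closure of the span of the bilinearity relations, so that bounded bilinear maps on `V × W`
into complete spaces correspond to bounded linear maps on it. -/

/-- The underlying subspace of the free complete bornological vector space on `Y`. -/
def freeSubmodule (Y : Type*) [Bornology Y] : Submodule ℂ (Y → ℂ) where
  carrier := {c | Summable (fun y => ‖c y‖) ∧ Bornology.IsBounded (Function.support c)}
  zero_mem' := by simp [summable_zero]
  add_mem' := by
    rintro c d ⟨hc, hc'⟩ ⟨hd, hd'⟩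
    refine ⟨Summable.of_nonneg_of_le (fun _ => norm_nonneg _) (fun y => norm_add_le _ _)
      (hc.add hd), (hc'.union hd').subset (Function.support_add c d)⟩
  smul_mem' := by
    rintro a c ⟨hc, hc'⟩
    refine ⟨?_, hc'.subset (Function.support_const_smul_subset a c)⟩
    simpa [norm_smul] using hc.mul_left ‖a‖

/-- The free complete bornological vector space on `Y`. -/
def FreeBVS (Y : Type*) [Bornology Y] : Type _ := freeSubmodule Y

namespace FreeBVS

variable {Y : Type*} [Bornology Y]

instance : AddCommGroup (FreeBVS Y) := inferInstanceAs (AddCommGroup (freeSubmodule Y))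
instance : Module ℂ (FreeBVS Y) := inferInstanceAs (Module ℂ (freeSubmodule Y))

/-- The coefficients of an element. -/
def coeff : FreeBVS Y →ₗ[ℂ] (Y → ℂ) := (freeSubmodule Y).subtype

/-- The generator attached to a point. -/
def of (y : Y) : FreeBVS Y :=
  ⟨fun z => by classical exact if z = y then 1 else 0, by
    classical
    refine ⟨summable_of_ne_finset_zero (s := {y}) (by simp), ?_⟩
    refine (Bornology.isBounded_singleton (x := y)).subset fun z hz => ?_
    by_contra h
    simp_all⟩

/-- A set is bounded if it is contained and norm bounded in some `ℓ¹(B)` with `B` bounded. -/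
instance : Bornology (FreeBVS Y) :=
  Bornology.ofBounded {S | ∃ (B : Set Y) (R : ℝ), Bornology.IsBounded B ∧
      ∀ c ∈ S, Function.support (coeff c) ⊆ B ∧ ∑' y, ‖coeff c y‖ ≤ R}
    ⟨∅, 0, Bornology.isBounded_empty, by simp⟩
    (fun _ ⟨B, R, hB, h⟩ _ h' => ⟨B, R, hB, fun c hc => h c (h' hc)⟩)
    (fun _ ⟨B, R, hB, h⟩ _ ⟨B', R', hB', h'⟩ => ⟨B ∪ B', max R R', hB.union hB', by
      rintro c (hc | hc)
      · exact ⟨(h c hc).1.trans subset_union_left, (h c hc).2.trans (le_max_left _ _)⟩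
      · exact ⟨(h' c hc).1.trans subset_union_right, (h' c hc).2.trans (le_max_right _ _)⟩⟩)
    (fun c => ⟨Function.support (coeff c), ∑' y, ‖coeff c y‖, c.2.2, by simp⟩)

end FreeBVS

variable (V W) in
/-- The span of the bilinearity relations. -/
def bilinRel [Bornology V] [Bornology W] : Submodule ℂ (FreeBVS (V × W)) :=
  Submodule.span ℂ
    ({z | ∃ (v v' : V) (w : W),
        z = FreeBVS.of (v + v', w) - FreeBVS.of (v, w) - FreeBVS.of (v', w)} ∪
     {z | ∃ (v : V) (w w' : W),
        z = FreeBVS.of (v, w + w') - FreeBVS.of (v, w) - FreeBVS.of (v, w')} ∪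
     {z | ∃ (a : ℂ) (v : V) (w : W), z = FreeBVS.of (a • v, w) - a • FreeBVS.of (v, w)} ∪
     {z | ∃ (a : ℂ) (v : V) (w : W), z = FreeBVS.of (v, a • w) - a • FreeBVS.of (v, w)})

variable (V W) in
/-- The complete tensor product. -/
abbrev CTensor [Bornology V] [Bornology W] : Type _ := BorQuot (bilinRel V W)

/-- An elementary tensor. -/
def ctmul [Bornology V] [Bornology W] (v : V) (w : W) : CTensor V W :=
  BorQuot.mk (bilinRel V W) (FreeBVS.of (v, w))

end Bornological

/-! ### Bornological algebras and modules (all complete) -/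

section Algebra

/-- A complete bornological algebra structure on `A`: a bounded associative multiplication. -/
structure BornAlg (A : Type*) [AddCommGroup A] [Module ℂ A] [Bornology A] where
  complete : IsCompleteBVS A
  mul : A →ₗ[ℂ] A →ₗ[ℂ] A
  mul_assoc : ∀ a b c, mul (mul a b) c = mul a (mul b c)
  bounded : IsBoundedMap₂ (fun a b => mul a b)

variable {A B : Type*} [AddCommGroup A] [Module ℂ A] [Bornology A]
  [AddCommGroup B] [Module ℂ B] [Bornology B]

/-- A complete bornological left module. -/
structure LeftMod (𝔸 : BornAlg A) (M : Type*) [AddCommGroup M] [Module ℂ M] [Bornology M] where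
  complete : IsCompleteBVS M
  act : A →ₗ[ℂ] M →ₗ[ℂ] M
  act_mul : ∀ a b m, act (𝔸.mul a b) m = act a (act b m)
  bounded : IsBoundedMap₂ (fun a m => act a m)

/-- A complete bornological right module. -/
structure RightMod (𝔸 : BornAlg A) (M : Type*) [AddCommGroup M] [Module ℂ M] [Bornology M] where
  complete : IsCompleteBVS M
  act : M →ₗ[ℂ] A →ₗ[ℂ] M
  act_mul : ∀ m a b, act m (𝔸.mul a b) = act (act m a) b
  bounded : IsBoundedMap₂ (fun m a => act m a)

/-- A complete bornological bimodule. -/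
structure Bimod (𝔸 : BornAlg A) (𝔹 : BornAlg B) (X : Type*) [AddCommGroup X] [Module ℂ X]
    [Bornology X] where
  left : LeftMod 𝔸 X
  right : RightMod 𝔹 X
  comm : ∀ a x b, right.act (left.act a x) b = left.act a (right.act x b)

/-- The algebra as a left module over itself. -/
def BornAlg.leftSelf (𝔸 : BornAlg A) : LeftMod 𝔸 A :=
  ⟨𝔸.complete, 𝔸.mul, 𝔸.mul_assoc, 𝔸.bounded⟩

/-- The algebra as a right module over itself. -/
def BornAlg.rightSelf (𝔸 : BornAlg A) : RightMod 𝔸 A :=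
  ⟨𝔸.complete, 𝔸.mul, fun m a b => (𝔸.mul_assoc m a b).symm, 𝔸.bounded⟩

section Balanced

variable {M N Z : Type*} [AddCommGroup M] [Module ℂ M] [Bornology M]
  [AddCommGroup N] [Module ℂ N] [Bornology N] [AddCommGroup Z] [Module ℂ Z] [Bornology Z]

/-- The balanced tensor product `M ⊗_A N`: the quotient of the complete tensor product of `M` and
`N` by the closure of the span of the elements `m a ⊗ n - m ⊗ a n`. -/
abbrev BalTensor {𝔸 : BornAlg A} (r : RightMod 𝔸 M) (l : LeftMod 𝔸 N) : Type _ :=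
  BorQuot (Submodule.span ℂ
    {z : CTensor M N | ∃ m a n, z = ctmul (r.act m a) n - ctmul m (l.act a n)})

/-- The class of `m ⊗ n` in `M ⊗_A N`. -/
def baltmul {𝔸 : BornAlg A} (r : RightMod 𝔸 M) (l : LeftMod 𝔸 N) (m : M) (n : N) :
    BalTensor r l :=
  BorQuot.mk _ (ctmul m n)

/-- The map `m ⊗ n ↦ β m n` is well defined on `M ⊗_A N` and is an isomorphism of bornological
vector spaces onto `Z`. -/
def InducesIso {𝔸 : BornAlg A} (r : RightMod 𝔸 M) (l : LeftMod 𝔸 N) (β : M → N → Z) : Prop :=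
  ∃ Φ : BornEquiv (BalTensor r l) Z, ∀ m n, Φ.toLinearEquiv (baltmul r l m n) = β m n

/-- A left module is essential if the action induces an isomorphism `A ⊗_A M ≃ M`. -/
def LeftMod.IsEssential {𝔸 : BornAlg A} (l : LeftMod 𝔸 M) : Prop :=
  InducesIso 𝔸.rightSelf l (fun a m => l.act a m)

/-- A right module is essential if the action induces an isomorphism `M ⊗_A A ≃ M`. -/
def RightMod.IsEssential {𝔸 : BornAlg A} (r : RightMod 𝔸 M) : Prop :=
  InducesIso r 𝔸.leftSelf (fun m a => r.act m a)

/-- The space of bounded `A`-linear maps between left modules. -/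
def LeftMod.hom {𝔸 : BornAlg A} (l : LeftMod 𝔸 M) (l' : LeftMod 𝔸 N) :
    Submodule ℂ (M →ₗ[ℂ] N) where
  carrier := {f | IsBoundedMap f ∧ ∀ a m, f (l.act a m) = l'.act a (f m)}
  zero_mem' := ⟨fun S _ => (Bornology.isBounded_singleton (x := (0 : N))).subset (by
    rintro _ ⟨x, _, rfl⟩; simp), by simp⟩
  add_mem' := by
    rintro f g ⟨hf, hf'⟩ ⟨hg, hg'⟩
    refine ⟨fun S hS => (l'.complete.add _ _ (hf S hS) (hg S hS)).subset ?_, fun a m => ?_⟩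
    · rintro _ ⟨x, hx, rfl⟩
      exact ⟨f x, ⟨x, hx, rfl⟩, g x, ⟨x, hx, rfl⟩, rfl⟩
    · simp [hf', hg']
  smul_mem' := by
    rintro c f ⟨hf, hf'⟩
    refine ⟨fun S hS => (l'.complete.smul c _ (hf S hS)).subset ?_, fun a m => ?_⟩
    · rintro _ ⟨x, hx, rfl⟩
      exact ⟨f x, ⟨x, hx, rfl⟩, rfl⟩
    · simp [hf']

/-- The space of bounded `A`-linear maps between right modules. -/
def RightMod.hom {𝔸 : BornAlg A} (r : RightMod 𝔸 M) (r' : RightMod 𝔸 N) :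
    Submodule ℂ (M →ₗ[ℂ] N) where
  carrier := {f | IsBoundedMap f ∧ ∀ m a, f (r.act m a) = r'.act (f m) a}
  zero_mem' := ⟨fun S _ => (Bornology.isBounded_singleton (x := (0 : N))).subset (by
    rintro _ ⟨x, _, rfl⟩; simp), by simp⟩
  add_mem' := by
    rintro f g ⟨hf, hf'⟩ ⟨hg, hg'⟩
    refine ⟨fun S hS => (r'.complete.add _ _ (hf S hS) (hg S hS)).subset ?_, fun m a => ?_⟩
    · rintro _ ⟨x, hx, rfl⟩
      exact ⟨f x, ⟨x, hx, rfl⟩, g x, ⟨x, hx, rfl⟩, rfl⟩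
    · simp [hf', hg']
  smul_mem' := by
    rintro c f ⟨hf, hf'⟩
    refine ⟨fun S hS => (r'.complete.smul c _ (hf S hS)).subset ?_, fun m a => ?_⟩
    · rintro _ ⟨x, hx, rfl⟩
      exact ⟨f x, ⟨x, hx, rfl⟩, rfl⟩
    · simp [hf']

end Balanced

/-- A left module `P` is projective if `Hom(P, ·)` (bounded `A`-linear maps, with the equibounded
bornology) sends every extension `0 → ker q → M → N → 0` of modules which has a bounded linear
splitting `s` to an extension of bornological vector spaces which has a bounded linear splitting.
Modules over a nonunital algebra are the same as unital modules over its unitalization. -/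
def LeftMod.IsProjective {A : Type*} [AddCommGroup A] [Module ℂ A] [Bornology A] {𝔸 : BornAlg A}
    {P : Type u} [AddCommGroup P] [Module ℂ P] [Bornology P] (l : LeftMod 𝔸 P) : Prop :=
  ∀ (M N : Type u) [AddCommGroup M] [Module ℂ M] [Bornology M] [AddCommGroup N] [Module ℂ N]
    [Bornology N] (lM : LeftMod 𝔸 M) (lN : LeftMod 𝔸 N) (q : M →ₗ[ℂ] N) (s : N →ₗ[ℂ] M),
    q ∈ lM.hom lN → IsBoundedMap s → (∀ n, q (s n) = n) →
    ∃ σ : l.hom lN →ₗ[ℂ] l.hom lM,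
      (∀ (g : l.hom lN) (x : P), q ((σ g).1 x) = g.1 x) ∧
      ∀ 𝓕 : Set (l.hom lN), IsEquibounded (Subtype.val '' 𝓕) →
        IsEquibounded ((fun g => (σ g).1) '' 𝓕)

/-- Projectivity of right modules. -/
def RightMod.IsProjective {A : Type*} [AddCommGroup A] [Module ℂ A] [Bornology A] {𝔸 : BornAlg A}
    {P : Type u} [AddCommGroup P] [Module ℂ P] [Bornology P] (r : RightMod 𝔸 P) : Prop :=
  ∀ (M N : Type u) [AddCommGroup M] [Module ℂ M] [Bornology M] [AddCommGroup N] [Module ℂ N]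
    [Bornology N] (rM : RightMod 𝔸 M) (rN : RightMod 𝔸 N) (q : M →ₗ[ℂ] N) (s : N →ₗ[ℂ] M),
    q ∈ rM.hom rN → IsBoundedMap s → (∀ n, q (s n) = n) →
    ∃ σ : r.hom rN →ₗ[ℂ] r.hom rM,
      (∀ (g : r.hom rN) (x : P), q ((σ g).1 x) = g.1 x) ∧
      ∀ 𝓕 : Set (r.hom rN), IsEquibounded (Subtype.val '' 𝓕) →
        IsEquibounded ((fun g => (σ g).1) '' 𝓕)

/-- Every bounded set `S` has a sequence `μ` with `μ n x → x` and `x μ n → x` uniformly for `x ∈ S`,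
in the Banach space spanned by some bounded completant disc. -/
def BornAlg.HasApproximateIdentity (𝔸 : BornAlg A) : Prop :=
  ∀ S : Set A, Bornology.IsBounded S → ∃ μ : ℕ → A, ∃ T : Set A,
    Bornology.IsBounded T ∧ IsCompletantDisc T ∧ S ⊆ T ∧
    ∀ ε : ℝ, 0 < ε → ∃ N : ℕ, ∀ n ≥ N, ∀ x ∈ S,
      (∃ t ∈ T, 𝔸.mul (μ n) x - x = (ε : ℂ) • t) ∧ ∃ t ∈ T, 𝔸.mul x (μ n) - x = (ε : ℂ) • t

/-- The multiplication map `A⁺ ⊗ A → A` has a bounded `A⁺`-linear section.  Here `A⁺` is the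
unitalization `ℂ × A`; the map `m` is the multiplication map and `act` is the left action of `A` on
`A⁺ ⊗ A`, both determined by their values on elementary tensors.  (If `A` is unital then such a
section exists for `ℂ × A` exactly if one exists for `A` in place of `ℂ × A`.) -/
def BornAlg.HasLeftSection (𝔸 : BornAlg A) : Prop :=
  ∃ (m : CTensor (ℂ × A) A →ₗ[ℂ] A) (act : A → CTensor (ℂ × A) A →ₗ[ℂ] CTensor (ℂ × A) A)
    (σ : A →ₗ[ℂ] CTensor (ℂ × A) A),
    IsBoundedMap m ∧ (∀ a, IsBoundedMap (act a)) ∧ IsBoundedMap σ ∧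
    (∀ z x y, m (ctmul (z, x) y) = z • y + 𝔸.mul x y) ∧
    (∀ a z x y, act a (ctmul (z, x) y) = ctmul (0, z • a + 𝔸.mul a x) y) ∧
    (∀ a b, σ (𝔸.mul a b) = act a (σ b)) ∧
    ∀ a, m (σ a) = a

/-- The multiplication map `A ⊗ A⁺ → A` has a bounded right `A⁺`-linear section. -/
def BornAlg.HasRightSection (𝔸 : BornAlg A) : Prop :=
  ∃ (m : CTensor A (ℂ × A) →ₗ[ℂ] A) (act : A → CTensor A (ℂ × A) →ₗ[ℂ] CTensor A (ℂ × A))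
    (σ : A →ₗ[ℂ] CTensor A (ℂ × A)),
    IsBoundedMap m ∧ (∀ a, IsBoundedMap (act a)) ∧ IsBoundedMap σ ∧
    (∀ y z x, m (ctmul y (z, x)) = z • y + 𝔸.mul y x) ∧
    (∀ a y z x, act a (ctmul y (z, x)) = ctmul y (0, z • a + 𝔸.mul x a)) ∧
    (∀ b a, σ (𝔸.mul b a) = act a (σ b)) ∧
    ∀ a, m (σ a) = a

/-- Quasi-unital bornological algebras. -/
structure BornAlg.IsQuasiUnital (𝔸 : BornAlg A) : Prop where
  approximateIdentity : 𝔸.HasApproximateIdentity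
  leftSection : 𝔸.HasLeftSection
  rightSection : 𝔸.HasRightSection

/-- An essential bimodule is essential on both sides. -/
def Bimod.IsEssential {𝔸 : BornAlg A} {𝔹 : BornAlg B} {X : Type*} [AddCommGroup X] [Module ℂ X]
    [Bornology X] (𝓧 : Bimod 𝔸 𝔹 X) : Prop :=
  𝓧.left.IsEssential ∧ 𝓧.right.IsEssential

/-- `X ⊗_B Y ≃ A` as bornological `A`-bimodules; the `A`-actions on `X ⊗_B Y` are those with
`a (x ⊗ y) = a x ⊗ y` and `(x ⊗ y) a = x ⊗ y a`, and it is enough to compare them with those on `A`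
on elementary tensors. -/
def TensorIsoAlg {𝔸 : BornAlg A} {𝔹 : BornAlg B} {X Y : Type*} [AddCommGroup X] [Module ℂ X]
    [Bornology X] [AddCommGroup Y] [Module ℂ Y] [Bornology Y] (𝓧 : Bimod 𝔸 𝔹 X)
    (𝓨 : Bimod 𝔹 𝔸 Y) : Prop :=
  ∃ β : X → Y → A, InducesIso 𝓧.right 𝓨.left β ∧
    (∀ a x y, β (𝓧.left.act a x) y = 𝔸.mul a (β x y)) ∧
    ∀ x y a, β x (𝓨.right.act y a) = 𝔸.mul (β x y) a

/-- The bimodule `Y` is a dual Morita equivalence bimodule of `X`. -/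
structure IsMoritaDual {A B X Y : Type u} [AddCommGroup A] [Module ℂ A] [Bornology A]
    [AddCommGroup B] [Module ℂ B] [Bornology B] [AddCommGroup X] [Module ℂ X] [Bornology X]
    [AddCommGroup Y] [Module ℂ Y] [Bornology Y] {𝔸 : BornAlg A} {𝔹 : BornAlg B}
    (𝓧 : Bimod 𝔸 𝔹 X) (𝓨 : Bimod 𝔹 𝔸 Y) : Prop where
  essential : 𝓨.IsEssential
  projective_left : 𝓨.left.IsProjective
  projective_right : 𝓨.right.IsProjective
  iso_left : TensorIsoAlg 𝓧 𝓨
  iso_right : TensorIsoAlg 𝓨 𝓧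

/-- Morita equivalence bimodules between quasi-unital bornological algebras. -/
structure IsMoritaEquivalenceBimodule {A B X : Type u} [AddCommGroup A] [Module ℂ A] [Bornology A]
    [AddCommGroup B] [Module ℂ B] [Bornology B] [AddCommGroup X] [Module ℂ X] [Bornology X]
    {𝔸 : BornAlg A} {𝔹 : BornAlg B} (𝓧 : Bimod 𝔸 𝔹 X) : Prop where
  quasiUnital_left : 𝔸.IsQuasiUnital
  quasiUnital_right : 𝔹.IsQuasiUnital
  essential : 𝓧.IsEssential
  exists_dual : ∃ (Y : Type u) (_ : AddCommGroup Y) (_ : Module ℂ Y) (_ : Bornology Y)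
    (𝓨 : Bimod 𝔹 𝔸 Y), IsMoritaDual 𝓧 𝓨

end Algebra

/-! ### Smooth compactly supported functions -/

section Functions

variable (E : Type*) [NormedAddCommGroup E] [NormedSpace ℝ E]
  (M : Type*) [TopologicalSpace M] [ChartedSpace E M]

/-- The space of smooth compactly supported complex valued functions, as a subspace. -/
def ccSubmodule : Submodule ℂ (M → ℂ) where
  carrier := {f | ContMDiff 𝓘(ℝ, E) 𝓘(ℝ, ℂ) ∞ f ∧ HasCompactSupport f}
  zero_mem' := ⟨contMDiff_const, HasCompactSupport.zero⟩
  add_mem' := fun ⟨hf, hf'⟩ ⟨hg, hg'⟩ => ⟨hf.add hg, hf'.add hg'⟩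
  smul_mem' := fun c _ ⟨hf, hf'⟩ => ⟨(contDiff_const_smul c).contMDiff.comp hf,
    hf'.smul_left (f := fun _ => c)⟩

/-- The space `C_c^∞(M)`. -/
def Cc : Type _ := ccSubmodule E M

namespace Cc

instance : AddCommGroup (Cc E M) := inferInstanceAs (AddCommGroup (ccSubmodule E M))
instance : Module ℂ (Cc E M) := inferInstanceAs (Module ℂ (ccSubmodule E M))
instance : CoeFun (Cc E M) (fun _ => M → ℂ) := ⟨fun f => f.1⟩

variable {E M}

/-- The basic neighbourhoods of `0` for the topology of uniform convergence of all derivatives on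
compact sets: `F` is a set of pairs of a chart and a compact subset of its target. -/
def basicNhd (F : Set (OpenPartialHomeomorph M E × Set E)) (n : ℕ) (ε : ℝ) : Set (Cc E M) :=
  {f | ∀ q ∈ F, ∀ k ≤ n, ∀ y ∈ q.2, ‖iteratedFDeriv ℝ k (fun z => f (q.1.symm z)) y‖ ≤ ε}

/-- The set `S` is a precompact subset of the Fréchet space of smooth functions with support in
`K`: it is covered by finitely many translates of any neighbourhood of `0`. -/
def IsPrecompactIn (K : Set M) (S : Set (Cc E M)) : Prop :=
  (∀ f ∈ S, tsupport f ⊆ K) ∧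
  ∀ F : Set (OpenPartialHomeomorph M E × Set E), F.Finite →
    (∀ q ∈ F, q.1 ∈ IsManifold.maximalAtlas 𝓘(ℝ, E) ∞ M ∧ IsCompact q.2 ∧ q.2 ⊆ q.1.target) →
    ∀ (n : ℕ) (ε : ℝ), 0 < ε → ∃ T : Set (Cc E M), T.Finite ∧ (∀ g ∈ T, tsupport g ⊆ K) ∧
      ∀ f ∈ S, ∃ g ∈ T, f - g ∈ basicNhd F n ε

/-- The precompact bornology of the inductive limit over the compact sets `K ⊆ M` of the Fréchet
spaces of smooth functions with support in `K`. -/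
instance : Bornology (Cc E M) :=
  Bornology.ofBounded {S | ∃ K : Set M, IsCompact K ∧ IsPrecompactIn K S}
    ⟨∅, isCompact_empty, by simp, fun _ _ _ _ _ _ => ⟨∅, finite_empty, by simp, by simp⟩⟩
    (fun _ ⟨K, hK, h, h'⟩ _ hS => ⟨K, hK, fun f hf => h f (hS hf), fun F hF hF' n ε hε => by
      obtain ⟨T, hT, hTK, h''⟩ := h' F hF hF' n ε hε
      exact ⟨T, hT, hTK, fun f hf => h'' f (hS hf)⟩⟩)
    (fun _ ⟨K, hK, h, h'⟩ _ ⟨L, hL, g, g'⟩ => ⟨K ∪ L, hK.union hL, by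
        rintro f (hf | hf)
        · exact (h f hf).trans subset_union_left
        · exact (g f hf).trans subset_union_right,
      fun F hF hF' n ε hε => by
        obtain ⟨T, hT, hTK, h''⟩ := h' F hF hF' n ε hε
        obtain ⟨U, hU, hUL, g''⟩ := g' F hF hF' n ε hε
        refine ⟨T ∪ U, hT.union hU, ?_, ?_⟩
        · rintro f (hf | hf)
          · exact (hTK f hf).trans subset_union_left
          · exact (hUL f hf).trans subset_union_right
        · rintro f (hf | hf)
          · obtain ⟨t, ht, ht'⟩ := h'' f hf
            exact ⟨t, Or.inl ht, ht'⟩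
          · obtain ⟨t, ht, ht'⟩ := g'' f hf
            exact ⟨t, Or.inr ht, ht'⟩⟩)
    (fun f => ⟨tsupport f, f.2.2, by simp, fun F _ _ n ε hε =>
      ⟨{f}, finite_singleton f, by simp, by
        intro g hg
        refine ⟨f, rfl, ?_⟩
        rw [show g = f from hg, sub_self]
        intro q _ k _ y _
        have : (fun z => (0 : Cc E M) (q.1.symm z)) = fun _ => (0 : ℂ) := rfl
        rw [this, iteratedFDeriv_fun_zero]
        simpa using hε.le⟩⟩)

end Cc

end Functions

/-! ### Étale groupoids, Morita equivalence bibundles, convolution -/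

section Groupoids

/-- A smooth étale groupoid with objects `G₀` and arrows `G₁`.  The product `mul g g'` is meaningful
if `s g = t g'`.  Multiplication is required to be smooth on the (embedded) manifold of composable
pairs; it is then a local diffeomorphism since `s` is one. -/
structure EtaleGroupoid (E : Type*) [NormedAddCommGroup E] [NormedSpace ℝ E]
    (G₀ : Type*) [TopologicalSpace G₀] [ChartedSpace E G₀]
    (G₁ : Type*) [TopologicalSpace G₁] [ChartedSpace E G₁] where
  s : G₁ → G₀
  t : G₁ → G₀
  unit : G₀ → G₁
  inv : G₁ → G₁
  mul : G₁ → G₁ → G₁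
  s_unit : ∀ x, s (unit x) = x
  t_unit : ∀ x, t (unit x) = x
  s_inv : ∀ g, s (inv g) = t g
  t_inv : ∀ g, t (inv g) = s g
  s_mul : ∀ g g', s g = t g' → s (mul g g') = s g'
  t_mul : ∀ g g', s g = t g' → t (mul g g') = t g
  mul_assoc : ∀ g g' g'', s g = t g' → s g' = t g'' →
    mul (mul g g') g'' = mul g (mul g' g'')
  unit_mul : ∀ g, mul (unit (t g)) g = g
  mul_unit : ∀ g, mul g (unit (s g)) = g
  inv_mul : ∀ g, mul (inv g) g = unit (s g)
  mul_inv : ∀ g, mul g (inv g) = unit (t g)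
  etale_s : IsLocalDiffeomorph 𝓘(ℝ, E) 𝓘(ℝ, E) ∞ s
  etale_t : IsLocalDiffeomorph 𝓘(ℝ, E) 𝓘(ℝ, E) ∞ t
  etale_unit : IsLocalDiffeomorph 𝓘(ℝ, E) 𝓘(ℝ, E) ∞ unit
  etale_inv : IsLocalDiffeomorph 𝓘(ℝ, E) 𝓘(ℝ, E) ∞ inv
  smooth_mul : ContMDiffOn (𝓘(ℝ, E).prod 𝓘(ℝ, E)) 𝓘(ℝ, E) ∞
    (fun q : G₁ × G₁ => mul q.1 q.2) {q | s q.1 = t q.2}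

variable {E : Type*} [NormedAddCommGroup E] [NormedSpace ℝ E]
  {G₀ : Type*} [TopologicalSpace G₀] [ChartedSpace E G₀]
  {G₁ : Type*} [TopologicalSpace G₁] [ChartedSpace E G₁]
  {E' : Type*} [NormedAddCommGroup E'] [NormedSpace ℝ E']
  {H₀ : Type*} [TopologicalSpace H₀] [ChartedSpace E' H₀]
  {H₁ : Type*} [TopologicalSpace H₁] [ChartedSpace E' H₁]

/-- A groupoid is proper if `(s, t) : G₁ → G₀ × G₀` is a proper map. -/
def EtaleGroupoid.IsProper (𝓖 : EtaleGroupoid E G₀ G₁) : Prop :=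
  IsProperMap (fun g => (𝓖.s g, 𝓖.t g))

/-- The convolution product `(a * b)(γ) = ∑_{η τ = γ} a(η) b(τ)`. -/
def EtaleGroupoid.conv (𝓖 : EtaleGroupoid E G₀ G₁) (a b : G₁ → ℂ) (γ : G₁) : ℂ :=
  ∑ᶠ q ∈ {q : G₁ × G₁ | 𝓖.s q.1 = 𝓖.t q.2 ∧ 𝓖.mul q.1 q.2 = γ}, a q.1 * b q.2

/-- A `G`-`H` Morita equivalence bibundle `P`: a principal left `G`-bundle over `H₀` with base map
`π` and, for a commuting action, a principal right `H`-bundle over `G₀` with base map `ε`.  The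
action `g p` is meaningful if `s g = ε p`, the action `p h` if `π p = t h`.  Principality is
expressed by a smooth map `d` for which `(p', p) ↦ (d (p', p), p)`, respectively
`(p, p') ↦ (p, d (p, p'))`, is the inverse of `(g, p) ↦ (g p, p)`, respectively
`(p, h) ↦ (p, p h)`. -/
structure MoritaBibundle (𝓖 : EtaleGroupoid E G₀ G₁) (𝓗 : EtaleGroupoid E' H₀ H₁)
    (F : Type*) [NormedAddCommGroup F] [NormedSpace ℝ F]
    (P : Type*) [TopologicalSpace P] [ChartedSpace F P] where
  ε : P → G₀
  π : P → H₀
  actL : G₁ → P → P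
  actR : P → H₁ → P
  submersion_ε : Manifold.IsSubmersion 𝓘(ℝ, F) 𝓘(ℝ, E) ∞ ε
  surjective_ε : Function.Surjective ε
  submersion_π : Manifold.IsSubmersion 𝓘(ℝ, F) 𝓘(ℝ, E') ∞ π
  surjective_π : Function.Surjective π
  ε_actL : ∀ g p, 𝓖.s g = ε p → ε (actL g p) = 𝓖.t g
  π_actL : ∀ g p, 𝓖.s g = ε p → π (actL g p) = π p
  actL_unit : ∀ p, actL (𝓖.unit (ε p)) p = p
  actL_mul : ∀ g g' p, 𝓖.s g = 𝓖.t g' → 𝓖.s g' = ε p →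
    actL (𝓖.mul g g') p = actL g (actL g' p)
  smooth_actL : ContMDiffOn (𝓘(ℝ, E).prod 𝓘(ℝ, F)) 𝓘(ℝ, F) ∞
    (fun q : G₁ × P => actL q.1 q.2) {q | 𝓖.s q.1 = ε q.2}
  π_actR : ∀ p h, π p = 𝓗.t h → π (actR p h) = 𝓗.s h
  ε_actR : ∀ p h, π p = 𝓗.t h → ε (actR p h) = ε p
  actR_unit : ∀ p, actR p (𝓗.unit (π p)) = p
  actR_mul : ∀ p h h', π p = 𝓗.t h → 𝓗.s h = 𝓗.t h' →
    actR p (𝓗.mul h h') = actR (actR p h) h'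
  smooth_actR : ContMDiffOn (𝓘(ℝ, F).prod 𝓘(ℝ, E')) 𝓘(ℝ, F) ∞
    (fun q : P × H₁ => actR q.1 q.2) {q | π q.1 = 𝓗.t q.2}
  act_comm : ∀ g p h, 𝓖.s g = ε p → π p = 𝓗.t h →
    actR (actL g p) h = actL g (actR p h)
  principal_left : ∃ d : P × P → G₁,
    ContMDiffOn (𝓘(ℝ, F).prod 𝓘(ℝ, F)) 𝓘(ℝ, E) ∞ d {q | π q.1 = π q.2} ∧
    (∀ p' p, π p' = π p → 𝓖.s (d (p', p)) = ε p ∧ actL (d (p', p)) p = p') ∧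
    ∀ g p, 𝓖.s g = ε p → d (actL g p, p) = g
  principal_right : ∃ d : P × P → H₁,
    ContMDiffOn (𝓘(ℝ, F).prod 𝓘(ℝ, F)) 𝓘(ℝ, E') ∞ d {q | ε q.1 = ε q.2} ∧
    (∀ p p', ε p = ε p' → π p = 𝓗.t (d (p, p')) ∧ actR p (d (p, p')) = p') ∧
    ∀ p h, π p = 𝓗.t h → d (p, actR p h) = h

namespace MoritaBibundle

variable {𝓖 : EtaleGroupoid E G₀ G₁} {𝓗 : EtaleGroupoid E' H₀ H₁}
  {F : Type*} [NormedAddCommGroup F] [NormedSpace ℝ F]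
  {P : Type*} [TopologicalSpace P] [ChartedSpace F P]

/-- `(a · ξ)(p) = ∑_g a(g) ξ(g⁻¹ p)`. -/
def leftAct (𝓟 : MoritaBibundle 𝓖 𝓗 F P) (a : G₁ → ℂ) (ξ : P → ℂ) (p : P) : ℂ :=
  ∑ᶠ g ∈ {g | 𝓖.t g = 𝓟.ε p}, a g * ξ (𝓟.actL (𝓖.inv g) p)

/-- `(ξ · b)(p) = ∑_h ξ(p h) b(h⁻¹)`. -/
def rightAct (𝓟 : MoritaBibundle 𝓖 𝓗 F P) (ξ : P → ℂ) (b : H₁ → ℂ) (p : P) : ℂ :=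
  ∑ᶠ h ∈ {h | 𝓗.t h = 𝓟.π p}, ξ (𝓟.actR p h) * b (𝓗.inv h)

/-- The left action of functions on `H` for the opposite bibundle, `h · p = p h⁻¹`:
`(b · ξ)(p) = ∑_h b(h) ξ(p h)`. -/
def opLeftAct (𝓟 : MoritaBibundle 𝓖 𝓗 F P) (b : H₁ → ℂ) (ξ : P → ℂ) (p : P) : ℂ :=
  ∑ᶠ h ∈ {h | 𝓗.t h = 𝓟.π p}, b h * ξ (𝓟.actR p h)

/-- The right action of functions on `G` for the opposite bibundle, `p · g = g⁻¹ p`: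
`(ξ · a)(p) = ∑_g ξ(g p) a(g)`. -/
def opRightAct (𝓟 : MoritaBibundle 𝓖 𝓗 F P) (ξ : P → ℂ) (a : G₁ → ℂ) (p : P) : ℂ :=
  ∑ᶠ g ∈ {g | 𝓖.s g = 𝓟.ε p}, ξ (𝓟.actL g p) * a g

/-- The pairing `⟨ξ, η⟩_H(h) = ∑_{π p = t h} ξ(p) η(p h)`. -/
def pairing (𝓟 : MoritaBibundle 𝓖 𝓗 F P) (ξ η : P → ℂ) (h : H₁) : ℂ :=
  ∑ᶠ p ∈ {p | 𝓟.π p = 𝓗.t h}, ξ p * η (𝓟.actR p h)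

end MoritaBibundle

end Groupoids

end ConvMorita

end

open ConvMorita

noncomputable section

set_option linter.unusedSectionVars false

namespace ConvMorita

/-! ### Vector bornologies, separated bornologies, free extensions -/

section General

variable {V W Z : Type*} [AddCommGroup V] [Module ℂ V] [AddCommGroup W] [Module ℂ W]
  [AddCommGroup Z] [Module ℂ Z] [Bornology V] [Bornology W] [Bornology Z]

/-! The proof works in the linking groupoid, whose objects are `G₀ ⊔ H₀` and whose arrows are `G₁`,
two copies of `P` and `H₁`. Both convolution products, the four module actions and the pairings are
blocks of a single operation, convolution on this groupoid (`GroupoidPieces.conv`). Associativity,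
smoothness and boundedness are therefore proved once, and the formulas of the theorem are recovered
by reindexing sums over fibres.

The algebraic core is a dual basis (`BornAlgebroid.DualBasis`): families `x n : R i j` and `y n : R
j i` such that `∑ x n * y n` acts as a two-sided unit at `i`, and such that on each bounded set all
but finitely many terms vanish. Everything else follows formally. The inverse of the multiplication
map of a balanced tensor product is `z ↦ ∑ x n ⊗ y n z`. A module map `g` is lifted along a linearly
split quotient by `r ↦ ∑ (r x n) s(g(y n))`. The sections of multiplication are `a ↦ ∑ a x n ⊗ y n`
and `a ↦ ∑ x n ⊗ y n a`. Finite partial sums of `∑ x n * y n` are exact units on bounded sets. By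
local finiteness these sums are finite on bounded sets, so no convergence question arises.

Dual bases come from geometry. The maps `π` and `ε` are étale, because principality for an étale
groupoid makes the submersions locally injective (`isEtale_π`, `isEtale_ε`). If `x` and `y` are
supported where the source map is injective, then convolving with `y*` and then with `x` is
multiplication by the function `z ↦ ∑ x(q) y(q)` over the fibre of `t` at `z` (`conv_conv_star`). A
partition of unity on the base, lifted through local sections of `t`, makes these functions add up
to `1` (`exists_local_sections`).

The analysis rests on one description of the precompact bornology: a set of functions is bounded iff
it has a common compact support and is locally the family of components of a smooth map into an
`ℓ^∞` space (`smoothFamily_of_isBounded`, `isBounded_of_smoothFamily`). Sums, products, pullbacks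
and `ℓ¹`-combinations visibly preserve this. The last of these gives the extension property of free
spaces, hence completeness, since images of `ℓ¹` unit balls are completant discs. Sums over fibres
of an étale map are locally finite sums of composites with sections
(`IsEtale.smoothFamilyAt_finsum`), which gives boundedness of convolution. -/

variable (V) in
/-- A vector bornology: sums, scalar multiples and circled hulls of bounded sets are bounded. -/
structure IsVectorBornology : Prop where
  balanced : ∀ S : Set V, Bornology.IsBounded S →
    Bornology.IsBounded {w | ∃ a : ℂ, ‖a‖ ≤ 1 ∧ ∃ v ∈ S, w = a • v}
  smul : ∀ (c : ℂ) (S : Set V), Bornology.IsBounded S → Bornology.IsBounded ((c • ·) '' S)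
  add : ∀ S T : Set V, Bornology.IsBounded S → Bornology.IsBounded T →
    Bornology.IsBounded (image2 (· + ·) S T)

variable (V) in
/-- No nonzero point is absorbed by all multiples of a bounded set. -/
def IsSeparatedBVS : Prop :=
  ∀ S : Set V, Bornology.IsBounded S → ∀ x : V,
    (∀ ε : ℝ, 0 < ε → ∃ s ∈ S, x = (ε : ℂ) • s) → x = 0

variable (V) in
/-- Maps preserving bounded sets extend to bounded linear maps on free complete bornological
vector spaces. -/
def HasFreeExtension : Prop :=
  ∀ (Y : Type u) [Bornology Y] (f : Y → V), IsBoundedMap f →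
    ∃ g : FreeBVS Y →ₗ[ℂ] V, IsBoundedMap g ∧ ∀ y, g (FreeBVS.of y) = f y

theorem IsCompleteBVS.isVectorBornology (h : IsCompleteBVS V) : IsVectorBornology V := by
  refine ⟨fun S hS => ?_, h.smul, h.add⟩
  obtain ⟨D, hD, hD', hSD⟩ := h.complete S hS
  refine hD.subset ?_
  rintro _ ⟨a, ha, v, hv, rfl⟩
  exact hD'.1.1.smul_mem ha (hSD hv)

theorem IsCompleteBVS.isSeparated (h : IsCompleteBVS V) : IsSeparatedBVS V := by
  intro S hS x hx
  obtain ⟨D, -, hD, hSD⟩ := h.complete S hS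
  refine hD.2.1 x fun ε hε => ?_
  obtain ⟨s, hs, rfl⟩ := hx ε hε
  exact ⟨s, hSD hs, rfl⟩

theorem IsBoundedMap.comp {V W Z : Type*} [Bornology V] [Bornology W] [Bornology Z]
    {g : W → Z} {f : V → W} (hg : IsBoundedMap g) (hf : IsBoundedMap f) :
    IsBoundedMap (fun v => g (f v)) := by
  intro S hS
  have := hg _ (hf S hS)
  rwa [image_image] at this

theorem IsBoundedMap₂.left {V W Z : Type*} [Bornology V] [Bornology W] [Bornology Z]
    {β : V → W → Z} (h : IsBoundedMap₂ β) (v : V) : IsBoundedMap (β v) := by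
  intro S hS
  have := h {v} S Bornology.isBounded_singleton hS
  rwa [image2_singleton_left] at this

theorem IsBoundedMap₂.right {V W Z : Type*} [Bornology V] [Bornology W] [Bornology Z]
    {β : V → W → Z} (h : IsBoundedMap₂ β) (w : W) : IsBoundedMap (fun v => β v w) := by
  intro S hS
  have := h S {w} hS Bornology.isBounded_singleton
  rwa [image2_singleton_right] at this

theorem IsVectorBornology.sum {ι : Type*} (hV : IsVectorBornology V) (J : Finset ι)
    (S : ι → Set V) (hS : ∀ j ∈ J, Bornology.IsBounded (S j)) :
    Bornology.IsBounded {v | ∃ w : ι → V, (∀ j ∈ J, w j ∈ S j) ∧ v = ∑ j ∈ J, w j} := by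
  classical
  induction J using Finset.induction_on with
  | empty =>
    refine (Bornology.isBounded_singleton (x := (0 : V))).subset ?_
    rintro v ⟨w, -, rfl⟩
    simp
  | insert a J ha ih =>
    refine (hV.add _ _ (hS a (by simp)) (ih fun j hj => hS j (by simp [hj]))).subset ?_
    rintro v ⟨w, hw, rfl⟩
    refine ⟨w a, hw a (by simp), _, ⟨w, fun j hj => hw j (by simp [hj]), rfl⟩, ?_⟩
    simp [Finset.sum_insert ha]

/-! ### Quotients -/

theorem le_borClosure (R : Submodule ℂ V) : R ≤ borClosure R :=
  le_sInf fun _ h => h.1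

theorem isBorClosed_borClosure (R : Submodule ℂ V) : IsBorClosed (borClosure R) := by
  intro x l hx hl
  rw [borClosure, Submodule.mem_sInf]
  intro C hC
  refine hC.2 x l (fun n => ?_) hl
  exact (Submodule.mem_sInf.1 (hx n)) C hC

/-- If `x N - l = ε s` with `x N` in the kernel, then `-f l = ε f s`. Thus `-f l` is absorbed by all
multiples of the bounded set `f(S)`, and separatedness forces it to vanish. -/
theorem isBorClosed_ker {f : V →ₗ[ℂ] W} (hf : IsBoundedMap f) (hW : IsSeparatedBVS W) :
    IsBorClosed (LinearMap.ker f) := by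
  rintro x l hx ⟨S, hS, h⟩
  rw [LinearMap.mem_ker, ← neg_eq_zero]
  refine hW _ (hf S hS) _ fun ε hε => ?_
  obtain ⟨N, hN⟩ := h ε hε
  obtain ⟨s, hs, hs'⟩ := hN N le_rfl
  refine ⟨f s, ⟨s, hs, rfl⟩, ?_⟩
  rw [← map_smul, ← hs', map_sub, LinearMap.mem_ker.1 (hx N), zero_sub]

theorem borClosure_le_ker {R : Submodule ℂ V} {f : V →ₗ[ℂ] W} (hf : IsBoundedMap f)
    (hW : IsSeparatedBVS W) (h : R ≤ LinearMap.ker f) : borClosure R ≤ LinearMap.ker f :=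
  sInf_le ⟨h, isBorClosed_ker hf hW⟩

namespace BorQuot

theorem isBounded_iff {R : Submodule ℂ V} {S : Set (BorQuot R)} :
    Bornology.IsBounded S ↔ ∃ T : Set V, Bornology.IsBounded T ∧ S ⊆ mk R '' T :=
  Bornology.isBounded_ofBounded_iff _

theorem isBoundedMap_mk (R : Submodule ℂ V) : IsBoundedMap (mk R) :=
  fun S hS => isBounded_iff.2 ⟨S, hS, subset_rfl⟩

theorem mk_eq_zero {R : Submodule ℂ V} {v : V} : mk R v = 0 ↔ v ∈ borClosure R :=
  Submodule.Quotient.mk_eq_zero _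

theorem mk_eq_zero_of_mem {R : Submodule ℂ V} {v : V} (h : v ∈ R) : mk R v = 0 :=
  mk_eq_zero.2 (le_borClosure R h)

theorem isVectorBornology (hV : IsVectorBornology V) (R : Submodule ℂ V) :
    IsVectorBornology (BorQuot R) := by
  refine ⟨fun S hS => ?_, fun c S hS => ?_, fun S T hS hT => ?_⟩
  · obtain ⟨S', hS', h⟩ := isBounded_iff.1 hS
    refine isBounded_iff.2 ⟨_, hV.balanced S' hS', ?_⟩
    rintro _ ⟨a, ha, x, hx, rfl⟩
    obtain ⟨v, hv, rfl⟩ := h hx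
    exact ⟨a • v, ⟨a, ha, v, hv, rfl⟩, map_smul _ _ _⟩
  · obtain ⟨S', hS', h⟩ := isBounded_iff.1 hS
    refine isBounded_iff.2 ⟨_, hV.smul c S' hS', ?_⟩
    rintro _ ⟨x, hx, rfl⟩
    obtain ⟨v, hv, rfl⟩ := h hx
    exact ⟨c • v, ⟨v, hv, rfl⟩, map_smul _ _ _⟩
  · obtain ⟨S', hS', h⟩ := isBounded_iff.1 hS
    obtain ⟨T', hT', h'⟩ := isBounded_iff.1 hT
    refine isBounded_iff.2 ⟨_, hV.add S' T' hS' hT', ?_⟩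
    rintro _ ⟨x, hx, y, hy, rfl⟩
    obtain ⟨v, hv, rfl⟩ := h hx
    obtain ⟨w, hw, rfl⟩ := h' hy
    exact ⟨v + w, ⟨v, hv, w, hw, rfl⟩, map_add _ _ _⟩

/-- An absorbed point lifts to `v` with `v - ε t_ε` in the closure for every `ε`. Along `ε =
1/(n+1)` these elements converge to `v`, and the closure is closed. Nothing is asked of `V` beyond a
vector bornology, so tensor products are separated automatically. -/
theorem isSeparated (hV : IsVectorBornology V) (R : Submodule ℂ V) : IsSeparatedBVS (BorQuot R) := by
  intro S hS x hx
  obtain ⟨T, hT, hST⟩ := isBounded_iff.1 hS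
  obtain ⟨v, rfl⟩ := mk_surjective R x
  have key : ∀ ε : ℝ, 0 < ε → ∃ t ∈ T, v - (ε : ℂ) • t ∈ borClosure R := by
    intro ε hε
    obtain ⟨s, hs, h⟩ := hx ε hε
    obtain ⟨t, ht, rfl⟩ := hST hs
    refine ⟨t, ht, mk_eq_zero.1 ?_⟩
    rw [map_sub, h, map_smul, sub_self]
  refine mk_eq_zero.2 ?_
  choose! t ht h using key
  have hpos : ∀ n : ℕ, (0 : ℝ) < 1 / (n + 1) := fun n => Nat.one_div_pos_of_nat
  refine isBorClosed_borClosure R (fun n : ℕ => v - ((1 / (n + 1) : ℝ) : ℂ) • t (1 / (n + 1))) v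
    -- Convergence is measured by the circled hull of `T`: the coefficient `-(1/(n+1))/ε` has
    -- modulus at most one for large `n`.
    (fun n => h _ (hpos n)) ⟨_, hV.balanced T hT, fun ε hε => ?_⟩
  obtain ⟨N, hN⟩ := exists_nat_one_div_lt hε
  refine ⟨N, fun n hn => ⟨_, ⟨-((1 / (n + 1) : ℝ) / ε : ℝ), ?_, _, ht _ (hpos n), rfl⟩, ?_⟩⟩
  · rw [norm_neg, Complex.norm_real, Real.norm_of_nonneg (div_pos (hpos n) hε).le, div_le_one hε]
    exact (Nat.one_div_le_one_div hn).trans hN.le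
  · rw [smul_smul, sub_sub_cancel_left, ← neg_smul]
    congr 1
    have : (ε : ℂ) ≠ 0 := by exact_mod_cast hε.ne'
    push_cast
    field_simp

/-- A bounded linear map which vanishes on `R` descends to the quotient. -/
theorem exists_lift {R : Submodule ℂ V} {f : V →ₗ[ℂ] W} (hf : IsBoundedMap f)
    (hW : IsSeparatedBVS W) (h : R ≤ LinearMap.ker f) :
    ∃ g : BorQuot R →ₗ[ℂ] W, IsBoundedMap g ∧ ∀ v, g (mk R v) = f v := by
  refine ⟨(borClosure R).liftQ f (borClosure_le_ker hf hW h), fun S hS => ?_, fun v => rfl⟩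
  obtain ⟨T, hT, hST⟩ := isBounded_iff.1 hS
  refine (hf T hT).subset ?_
  rintro _ ⟨x, hx, rfl⟩
  obtain ⟨v, hv, rfl⟩ := hST hx
  exact ⟨v, hv, rfl⟩

end BorQuot

end General

/-! ### Free complete bornological vector spaces -/

section Free

variable {Y Y' : Type*} [Bornology Y] [Bornology Y'] {W : Type*} [AddCommGroup W] [Module ℂ W]
  [Bornology W]

namespace FreeBVS

theorem isBounded_iff {S : Set (FreeBVS Y)} :
    Bornology.IsBounded S ↔ ∃ (B : Set Y) (R : ℝ), Bornology.IsBounded B ∧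
      ∀ c ∈ S, Function.support (coeff c) ⊆ B ∧ ∑' y, ‖coeff c y‖ ≤ R :=
  Bornology.isBounded_ofBounded_iff _

theorem summable_norm (c : FreeBVS Y) : Summable fun y => ‖coeff c y‖ := c.2.1

theorem isBounded_support (c : FreeBVS Y) : Bornology.IsBounded (Function.support (coeff c)) :=
  c.2.2

@[ext] theorem ext {c d : FreeBVS Y} (h : ∀ y, coeff c y = coeff d y) : c = d :=
  Subtype.ext (funext h)

open Classical in
theorem coeff_of (y z : Y) : coeff (of y) z = if z = y then 1 else 0 := rfl

/-- The element with prescribed coefficients. -/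
def mk (c : Y → ℂ) (hc : Summable fun y => ‖c y‖) (hc' : Bornology.IsBounded (Function.support c)) :
    FreeBVS Y := ⟨c, hc, hc'⟩

@[simp] theorem coeff_mk (c : Y → ℂ) (hc : Summable fun y => ‖c y‖)
    (hc' : Bornology.IsBounded (Function.support c)) : coeff (mk c hc hc') = c := rfl

/-- The unit ball of `ℓ¹(B)`. -/
def ball (B : Set Y) : Set (FreeBVS Y) :=
  {c | Function.support (coeff c) ⊆ B ∧ ∑' y, ‖coeff c y‖ ≤ 1}

theorem isBounded_ball {B : Set Y} (hB : Bornology.IsBounded B) : Bornology.IsBounded (ball B) :=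
  isBounded_iff.2 ⟨B, 1, hB, fun _ hc => hc⟩

theorem isBoundedMap_of : IsBoundedMap (of : Y → FreeBVS Y) := by
  classical
  intro S hS
  refine isBounded_iff.2 ⟨S, 1, hS, ?_⟩
  rintro _ ⟨y, hy, rfl⟩
  refine ⟨fun z hz => ?_, ?_⟩
  · by_contra h
    refine hz ?_
    rw [coeff_of, if_neg]
    rintro rfl
    exact h hy
  · rw [tsum_eq_single y]
    · simp [coeff_of]
    · intro z hz
      simp [coeff_of, hz]

variable (Y) in
theorem isVectorBornology : IsVectorBornology (FreeBVS Y) := by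
  refine ⟨fun S hS => ?_, fun c S hS => ?_, fun S T hS hT => ?_⟩
  · obtain ⟨B, R, hB, h⟩ := isBounded_iff.1 hS
    refine isBounded_iff.2 ⟨B, R, hB, ?_⟩
    rintro _ ⟨a, ha, v, hv, rfl⟩
    refine ⟨(Function.support_const_smul_subset a _).trans (h v hv).1, le_trans ?_ (h v hv).2⟩
    refine Summable.tsum_le_tsum (fun y => ?_) (summable_norm _) (summable_norm _)
    rw [map_smul, Pi.smul_apply, norm_smul]
    exact mul_le_of_le_one_left (norm_nonneg _) ha
  · obtain ⟨B, R, hB, h⟩ := isBounded_iff.1 hS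
    refine isBounded_iff.2 ⟨B, ‖c‖ * R, hB, ?_⟩
    rintro _ ⟨v, hv, rfl⟩
    refine ⟨(Function.support_const_smul_subset c _).trans (h v hv).1, ?_⟩
    simp only [map_smul, Pi.smul_apply, norm_smul]
    rw [tsum_mul_left]
    exact mul_le_mul_of_nonneg_left (h v hv).2 (norm_nonneg _)
  · obtain ⟨B, R, hB, h⟩ := isBounded_iff.1 hS
    obtain ⟨B', R', hB', h'⟩ := isBounded_iff.1 hT
    refine isBounded_iff.2 ⟨B ∪ B', R + R', hB.union hB', ?_⟩
    rintro _ ⟨v, hv, w, hw, rfl⟩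
    refine ⟨(Function.support_add _ _).trans (union_subset_union (h v hv).1 (h' w hw).1), ?_⟩
    refine le_trans ?_ (add_le_add (h v hv).2 (h' w hw).2)
    rw [← (summable_norm v).tsum_add (summable_norm w)]
    exact Summable.tsum_le_tsum (fun y => norm_add_le _ _) (summable_norm _)
      ((summable_norm v).add (summable_norm w))

theorem coeff_finset_sum_of (F : Finset Y) (a : Y → ℂ) (z : Y) [Decidable (z ∈ F)] :
    coeff (∑ y ∈ F, a y • of y) z = if z ∈ F then a z else 0 := by
  classical
  rw [map_sum, Finset.sum_apply]
  simp [coeff_of]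

/-- Finite linear combinations of generators approximate every element. -/
theorem exists_approx (c : FreeBVS Y) {ε : ℝ} (hε : 0 < ε) :
    ∃ (F : Finset Y), ∃ d ∈ ball (Function.support (coeff c)),
      c = ∑ y ∈ F, coeff c y • of y + (ε : ℂ) • d := by
  classical
  obtain ⟨F, hF⟩ := ((summable_norm c).hasSum.eventually (Metric.ball_mem_nhds _ hε)).exists
  have hε' : (ε : ℂ) ≠ 0 := by exact_mod_cast hε.ne'
  -- The rescaled tail of `c` outside `F`. It lies in the unit ball because `F` captures the
  -- `ℓ¹`-norm of `c` up to `ε`.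
  set d := (ε : ℂ)⁻¹ • (c - ∑ y ∈ F, coeff c y • of y) with hd
  have hco : ∀ z, coeff d z = if z ∈ F then 0 else (ε : ℂ)⁻¹ * coeff c z := by
    intro z
    rw [hd, map_smul, Pi.smul_apply, map_sub, Pi.sub_apply, coeff_finset_sum_of]
    split_ifs <;> simp
  refine ⟨F, d, ⟨fun z hz hz' => hz ?_, ?_⟩, ?_⟩
  · rw [hco, hz']
    simp
  · have h1 := (summable_norm c).sum_add_tsum_compl (s := F)
    have h2 : ∑' y, ‖coeff d y‖ = ε⁻¹ * ∑' y : ((F : Set Y)ᶜ : Set Y), ‖coeff c y‖ := by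
      rw [← tsum_mul_left, tsum_subtype ((F : Set Y)ᶜ) fun y => ε⁻¹ * ‖coeff c y‖]
      refine tsum_congr fun y => ?_
      rw [hco]
      by_cases hy : y ∈ F
      · simp [hy]
      · simp [hy, abs_of_pos hε]
    rw [h2, inv_mul_le_one₀ hε]
    rw [Real.dist_eq, abs_lt] at hF
    linarith [hF.1]
  · rw [hd, smul_inv_smul₀ hε', add_sub_cancel]

/-- Bounded linear maps into a separated space are determined by their values on generators. -/
theorem hom_ext {f g : FreeBVS Y →ₗ[ℂ] W} (hW : IsSeparatedBVS W)
    (hW' : IsVectorBornology W) (hf : IsBoundedMap f) (hg : IsBoundedMap g)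
    (h : ∀ y, f (of y) = g (of y)) : f = g := by
  refine LinearMap.ext fun c => sub_eq_zero.1 ?_
  have hb := isBounded_ball (isBounded_support c)
  -- The maps agree on finite combinations of generators, so `f c - g c = ε (f d - g d)` with `d` in
  -- a ball that does not depend on `ε`.
  refine hW _ (hW'.add _ _ (hf _ hb) (hW'.smul (-1) _ (hg _ hb))) _ fun ε hε => ?_
  obtain ⟨F, d, hd, hc⟩ := exists_approx c hε
  refine ⟨_, ⟨f d, ⟨d, hd, rfl⟩, _, ⟨_, ⟨d, hd, rfl⟩, rfl⟩, rfl⟩, ?_⟩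
  conv_lhs => rw [hc]
  simp only [map_add, map_sum, map_smul, h]
  module

/-- The map induced by a map of the generators. -/
theorem exists_map (φ : Y → Y') (hφ : IsBoundedMap φ) :
    ∃ g : FreeBVS Y →ₗ[ℂ] FreeBVS Y', IsBoundedMap g ∧ ∀ y, g (of y) = of (φ y) := by
  classical
  -- The image of `c` has the fibre sums of `c` as coefficients. Grouping the absolutely convergent
  -- sum by fibres shows that the `ℓ¹`-norm does not increase.
  have hs : ∀ c : FreeBVS Y, HasSum (fun y' => ∑' y : φ ⁻¹' {y'}, ‖coeff c y‖)
      (∑' y, ‖coeff c y‖) := fun c => by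
    have := (Equiv.sigmaFiberEquiv φ).hasSum_iff.2 (summable_norm c).hasSum
    exact this.sigma fun y' => (((summable_norm c).subtype (φ ⁻¹' {y'}))).hasSum
  have hle : ∀ (c : FreeBVS Y) y', ‖∑' y : φ ⁻¹' {y'}, coeff c y‖ ≤
      ∑' y : φ ⁻¹' {y'}, ‖coeff c y‖ := fun c y' =>
    norm_tsum_le_tsum_norm ((summable_norm c).subtype _)
  have hsum : ∀ c : FreeBVS Y, Summable fun y' => ‖∑' y : φ ⁻¹' {y'}, coeff c y‖ := fun c =>
    Summable.of_nonneg_of_le (fun _ => norm_nonneg _) (hle c) (hs c).summable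
  have hsupp : ∀ c : FreeBVS Y, Function.support (fun y' => ∑' y : φ ⁻¹' {y'}, coeff c y) ⊆
      φ '' Function.support (coeff c) := by
    intro c y' hy'
    by_contra h
    refine hy' ?_
    rw [← tsum_zero (α := ℂ) (β := φ ⁻¹' {y'})]
    refine tsum_congr fun y => ?_
    by_contra hne
    exact h ⟨y, hne, y.2⟩
  refine ⟨⟨⟨fun c => mk _ (hsum c) ((hφ _ (isBounded_support c)).subset (hsupp c)), ?_⟩, ?_⟩,
    ?_, ?_⟩
  · intro c d
    ext y'
    simp only [coeff_mk, map_add, Pi.add_apply]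
    exact Summable.tsum_add ((summable_norm c).of_norm.subtype _)
      ((summable_norm d).of_norm.subtype _)
  · intro a c
    ext y'
    simp only [coeff_mk, map_smul, Pi.smul_apply, smul_eq_mul, RingHom.id_apply]
    exact tsum_mul_left
  · intro S hS
    obtain ⟨B, R, hB, h⟩ := isBounded_iff.1 hS
    refine isBounded_iff.2 ⟨φ '' B, R, hφ B hB, ?_⟩
    rintro _ ⟨c, hc, rfl⟩
    refine ⟨(hsupp c).trans (image_mono (h c hc).1), le_trans ?_ (h c hc).2⟩
    rw [← (hs c).tsum_eq]
    exact Summable.tsum_le_tsum (hle c) (hsum c) (hs c).summable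
  · intro y
    ext y'
    change ∑' z : φ ⁻¹' {y'}, coeff (of y) z = coeff (of (φ y)) y'
    rw [coeff_of]
    split_ifs with h
    · rw [tsum_eq_single ⟨y, h.symm⟩]
      · simp [coeff_of]
      · rintro ⟨z, hz⟩ hne
        rw [coeff_of, if_neg]
        rintro rfl
        exact hne rfl
    · rw [← tsum_zero (α := ℂ) (β := φ ⁻¹' {y'})]
      refine tsum_congr fun z => ?_
      rw [coeff_of, if_neg]
      rintro hz
      exact h (by rw [← hz]; exact z.2.symm)

end FreeBVS

end Free

/-! ### Complete tensor products -/

section Tensor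

variable {V W V' W' Z : Type*} [AddCommGroup V] [Module ℂ V] [AddCommGroup W] [Module ℂ W]
  [AddCommGroup V'] [Module ℂ V'] [AddCommGroup W'] [Module ℂ W']
  [AddCommGroup Z] [Module ℂ Z] [Bornology V] [Bornology W] [Bornology V'] [Bornology W']
  [Bornology Z]

theorem isBounded_prod_iff {V W : Type*} [Bornology V] [Bornology W] {S : Set (V × W)} :
    Bornology.IsBounded S ↔
      Bornology.IsBounded (Prod.fst '' S) ∧ Bornology.IsBounded (Prod.snd '' S) :=
  Bornology.isBounded_image_fst_and_snd.symm

theorem IsBoundedMap₂.uncurry {V W Z : Type*} [Bornology V] [Bornology W] [Bornology Z]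
    {β : V → W → Z} (h : IsBoundedMap₂ β) :
    IsBoundedMap (fun p : V × W => β p.1 p.2) := by
  intro S hS
  obtain ⟨h1, h2⟩ := isBounded_prod_iff.1 hS
  refine (h _ _ h1 h2).subset ?_
  rintro _ ⟨p, hp, rfl⟩
  exact ⟨p.1, ⟨p, hp, rfl⟩, p.2, ⟨p, hp, rfl⟩, rfl⟩

theorem isBoundedMap₂_ctmul : IsBoundedMap₂ (ctmul : V → W → CTensor V W) := by
  intro S T hS hT
  have := BorQuot.isBoundedMap_mk (bilinRel V W) _ (FreeBVS.isBoundedMap_of _ (hS.prod hT))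
  refine this.subset ?_
  rintro _ ⟨v, hv, w, hw, rfl⟩
  exact ⟨_, ⟨(v, w), ⟨hv, hw⟩, rfl⟩, rfl⟩

theorem ctmul_add_left (v v' : V) (w : W) : ctmul (v + v') w = ctmul v w + ctmul v' w := by
  rw [← sub_eq_zero, ← sub_sub]
  simp only [ctmul, ← map_sub]
  exact BorQuot.mk_eq_zero_of_mem
    (Submodule.subset_span (Or.inl (Or.inl (Or.inl ⟨v, v', w, rfl⟩))))

theorem ctmul_add_right (v : V) (w w' : W) : ctmul v (w + w') = ctmul v w + ctmul v w' := by
  rw [← sub_eq_zero, ← sub_sub]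
  simp only [ctmul, ← map_sub]
  exact BorQuot.mk_eq_zero_of_mem (Submodule.subset_span (Or.inl (Or.inl (Or.inr ⟨v, w, w', rfl⟩))))

theorem ctmul_smul_left (a : ℂ) (v : V) (w : W) : ctmul (a • v) w = a • ctmul v w := by
  rw [← sub_eq_zero]
  simp only [ctmul, ← map_sub, ← map_smul]
  exact BorQuot.mk_eq_zero_of_mem (Submodule.subset_span (Or.inl (Or.inr ⟨a, v, w, rfl⟩)))

theorem ctmul_smul_right (a : ℂ) (v : V) (w : W) : ctmul v (a • w) = a • ctmul v w := by
  rw [← sub_eq_zero]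
  simp only [ctmul, ← map_sub, ← map_smul]
  exact BorQuot.mk_eq_zero_of_mem (Submodule.subset_span (Or.inr ⟨a, v, w, rfl⟩))

variable (V W) in
/-- The canonical bilinear map. -/
def ctmulₗ : V →ₗ[ℂ] W →ₗ[ℂ] CTensor V W :=
  LinearMap.mk₂ ℂ ctmul ctmul_add_left ctmul_smul_left ctmul_add_right ctmul_smul_right

@[simp] theorem ctmulₗ_apply (v : V) (w : W) : ctmulₗ V W v w = ctmul v w := rfl

variable (V W) in
theorem CTensor.isVectorBornology : IsVectorBornology (CTensor V W) :=
  BorQuot.isVectorBornology (FreeBVS.isVectorBornology _) _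

variable (V W) in
theorem CTensor.isSeparated : IsSeparatedBVS (CTensor V W) :=
  BorQuot.isSeparated (FreeBVS.isVectorBornology _) _

theorem bilinRel_le_ker {g : FreeBVS (V × W) →ₗ[ℂ] Z} (β : V →ₗ[ℂ] W →ₗ[ℂ] Z)
    (h : ∀ p : V × W, g (FreeBVS.of p) = β p.1 p.2) : bilinRel V W ≤ LinearMap.ker g := by
  refine Submodule.span_le.2 ?_
  rintro _ (((⟨v, v', w, rfl⟩ | ⟨v, w, w', rfl⟩) | ⟨a, v, w, rfl⟩) | ⟨a, v, w, rfl⟩) <;>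
    simp [h]

/-- Bounded bilinear maps extend to complete tensor products. -/
theorem CTensor.exists_lift {V W : Type u} [AddCommGroup V] [Module ℂ V] [AddCommGroup W]
    [Module ℂ W] [Bornology V] [Bornology W] (hZ : IsSeparatedBVS Z)
    (hZ' : HasFreeExtension.{u} Z) (β : V →ₗ[ℂ] W →ₗ[ℂ] Z) (hβ : IsBoundedMap₂ fun v w => β v w) :
    ∃ f : CTensor V W →ₗ[ℂ] Z, IsBoundedMap f ∧ ∀ v w, f (ctmul v w) = β v w := by
  obtain ⟨g, hg, hg'⟩ := hZ' (V × W) _ hβ.uncurry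
  obtain ⟨f, hf, hf'⟩ := BorQuot.exists_lift hg hZ (bilinRel_le_ker β hg')
  exact ⟨f, hf, fun v w => (hf' _).trans (hg' _)⟩

/-- Functoriality of complete tensor products. -/
theorem CTensor.exists_map (φ : V →ₗ[ℂ] V') (ψ : W →ₗ[ℂ] W') (hφ : IsBoundedMap φ)
    (hψ : IsBoundedMap ψ) :
    ∃ f : CTensor V W →ₗ[ℂ] CTensor V' W',
      IsBoundedMap f ∧ ∀ v w, f (ctmul v w) = ctmul (φ v) (ψ w) := by
  -- The map is induced from the generators, so no extension property of the target tensor product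
  -- is required.
  obtain ⟨g, hg, hg'⟩ := FreeBVS.exists_map (fun p : V × W => (φ p.1, ψ p.2)) (by
    intro S hS
    obtain ⟨h1, h2⟩ := isBounded_prod_iff.1 hS
    refine ((hφ _ h1).prod (hψ _ h2)).subset ?_
    rintro _ ⟨p, hp, rfl⟩
    exact ⟨⟨p.1, ⟨p, hp, rfl⟩, rfl⟩, ⟨p.2, ⟨p, hp, rfl⟩, rfl⟩⟩)
  obtain ⟨f, hf, hf'⟩ := BorQuot.exists_lift (R := bilinRel V W)
    (f := (BorQuot.mk (bilinRel V' W')).comp g)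
    ((BorQuot.isBoundedMap_mk (bilinRel V' W')).comp hg) (CTensor.isSeparated V' W')
    (bilinRel_le_ker ((ctmulₗ V' W').compl₁₂ φ ψ) fun p => by
      simp only [LinearMap.comp_apply, hg']
      rfl)
  refine ⟨f, hf, fun v w => (hf' _).trans ?_⟩
  simp only [LinearMap.comp_apply, hg']
  rfl

/-- Bounded linear maps on a quotient are determined by their composites with the quotient map. -/
theorem BorQuot.hom_ext {R : Submodule ℂ V} {f g : BorQuot R →ₗ[ℂ] Z}
    (h : f.comp (BorQuot.mk R) = g.comp (BorQuot.mk R)) : f = g := by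
  refine LinearMap.ext fun x => ?_
  obtain ⟨v, rfl⟩ := BorQuot.mk_surjective R x
  exact LinearMap.congr_fun h v

theorem CTensor.hom_ext (hZ : IsSeparatedBVS Z) (hZ' : IsVectorBornology Z)
    {f g : CTensor V W →ₗ[ℂ] Z} (hf : IsBoundedMap f) (hg : IsBoundedMap g)
    (h : ∀ v w, f (ctmul v w) = g (ctmul v w)) : f = g :=
  BorQuot.hom_ext (FreeBVS.hom_ext hZ hZ' (hf.comp (BorQuot.isBoundedMap_mk _))
    (hg.comp (BorQuot.isBoundedMap_mk _)) fun p => h p.1 p.2)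

end Tensor

/-! ### Locally finite sums of linear maps -/

section LocallyFinite

variable {V W ι : Type*} [AddCommGroup V] [Module ℂ V] [AddCommGroup W] [Module ℂ W]
  [Bornology V] [Bornology W]

/-- On each bounded set only finitely many members of the family are nonzero. -/
def IsLocallyFiniteFamily (T : ι → V →ₗ[ℂ] W) : Prop :=
  ∀ S : Set V, Bornology.IsBounded S → ∃ J : Finset ι, ∀ v ∈ S, ∀ j ∉ J, T j v = 0

namespace IsLocallyFiniteFamily

variable {T : ι → V →ₗ[ℂ] W}

theorem finite_support (hT : IsLocallyFiniteFamily T) (v : V) :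
    (Function.support fun j => T j v).Finite := by
  obtain ⟨J, hJ⟩ := hT {v} Bornology.isBounded_singleton
  refine J.finite_toSet.subset fun j hj => ?_
  by_contra h
  exact hj (hJ v rfl j h)

/-- The sum of a locally finite family. -/
def sum (hT : IsLocallyFiniteFamily T) : V →ₗ[ℂ] W where
  toFun v := ∑ᶠ j, T j v
  map_add' v w := by
    simp only [map_add]
    exact finsum_add_distrib (hT.finite_support v) (hT.finite_support w)
  map_smul' a v := by
    simp only [map_smul, RingHom.id_apply]
    exact (smul_finsum' a (hT.finite_support v)).symm

theorem sum_apply (hT : IsLocallyFiniteFamily T) (v : V) : hT.sum v = ∑ᶠ j, T j v := rfl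

theorem sum_eq (hT : IsLocallyFiniteFamily T) {J : Finset ι} {v : V}
    (h : ∀ j ∉ J, T j v = 0) : hT.sum v = ∑ j ∈ J, T j v := by
  refine finsum_eq_sum_of_support_subset _ fun j hj => ?_
  by_contra h'
  exact hj (h j h')

theorem map_sum (hT : IsLocallyFiniteFamily T) {Z : Type*} [AddCommGroup Z] [Module ℂ Z]
    (f : W →ₗ[ℂ] Z) (v : V) : f (hT.sum v) = ∑ᶠ j, f (T j v) :=
  f.toAddMonoidHom.map_finsum (hT.finite_support v)

/-- On a bounded set one finite index set serves all vectors at once, so the image lies in a finite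
sum of bounded sets. -/
theorem isBoundedMap_sum (hT : IsLocallyFiniteFamily T) (hT' : ∀ j, IsBoundedMap (T j))
    (hW : IsVectorBornology W) : IsBoundedMap hT.sum := by
  intro S hS
  obtain ⟨J, hJ⟩ := hT S hS
  refine (hW.sum J (fun j => T j '' S) fun j _ => hT' j S hS).subset ?_
  rintro _ ⟨v, hv, rfl⟩
  exact ⟨fun j => T j v, fun j _ => ⟨v, hv, rfl⟩, hT.sum_eq (hJ v hv)⟩

end IsLocallyFiniteFamily

end LocallyFinite

/-! ### Balanced tensor products -/

section Balanced

variable {A M N Z : Type u} [AddCommGroup A] [Module ℂ A] [Bornology A]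
  [AddCommGroup M] [Module ℂ M] [Bornology M]
  [AddCommGroup N] [Module ℂ N] [Bornology N] [AddCommGroup Z] [Module ℂ Z] [Bornology Z]
  {𝔸 : BornAlg A} (r : RightMod 𝔸 M) (l : LeftMod 𝔸 N)

theorem baltmul_act (m : M) (a : A) (n : N) :
    baltmul r l (r.act m a) n = baltmul r l m (l.act a n) := by
  rw [← sub_eq_zero]
  simp only [baltmul, ← map_sub]
  exact BorQuot.mk_eq_zero_of_mem (Submodule.subset_span ⟨m, a, n, rfl⟩)

/-- The canonical balanced bilinear map. -/
def baltmulₗ : M →ₗ[ℂ] N →ₗ[ℂ] BalTensor r l :=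
  (ctmulₗ M N).compr₂ (BorQuot.mk _)

theorem baltmulₗ_apply (m : M) (n : N) : baltmulₗ r l m n = baltmul r l m n := rfl

theorem isBoundedMap₂_baltmul : IsBoundedMap₂ (baltmul r l) := by
  intro S T hS hT
  refine (BorQuot.isBoundedMap_mk _ _ (isBoundedMap₂_ctmul S T hS hT)).subset ?_
  rintro _ ⟨m, hm, n, hn, rfl⟩
  exact ⟨_, ⟨m, hm, n, hn, rfl⟩, rfl⟩

theorem BalTensor.isVectorBornology : IsVectorBornology (BalTensor r l) :=
  BorQuot.isVectorBornology (CTensor.isVectorBornology _ _) _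

theorem BalTensor.isSeparated : IsSeparatedBVS (BalTensor r l) :=
  BorQuot.isSeparated (CTensor.isVectorBornology _ _) _

variable {r l} in
theorem BalTensor.hom_ext (hZ : IsSeparatedBVS Z) (hZ' : IsVectorBornology Z)
    {f g : BalTensor r l →ₗ[ℂ] Z} (hf : IsBoundedMap f) (hg : IsBoundedMap g)
    (h : ∀ m n, f (baltmul r l m n) = g (baltmul r l m n)) : f = g :=
  BorQuot.hom_ext (CTensor.hom_ext hZ hZ' (hf.comp (BorQuot.isBoundedMap_mk _))
    (hg.comp (BorQuot.isBoundedMap_mk _)) h)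

theorem BalTensor.exists_lift (hZ : IsSeparatedBVS Z) (hZ' : HasFreeExtension.{u} Z)
    (β : M →ₗ[ℂ] N →ₗ[ℂ] Z) (hβ : IsBoundedMap₂ fun m n => β m n)
    (hbal : ∀ m a n, β (r.act m a) n = β m (l.act a n)) :
    ∃ f : BalTensor r l →ₗ[ℂ] Z, IsBoundedMap f ∧ ∀ m n, f (baltmul r l m n) = β m n := by
  obtain ⟨g, hg, hg'⟩ := CTensor.exists_lift hZ hZ' β hβ
  obtain ⟨f, hf, hf'⟩ := BorQuot.exists_lift (R := Submodule.span ℂ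
    {z : CTensor M N | ∃ m a n, z = ctmul (r.act m a) n - ctmul m (l.act a n)}) hg hZ (by
      refine Submodule.span_le.2 ?_
      rintro _ ⟨m, a, n, rfl⟩
      simp [hg', hbal])
  exact ⟨f, hf, fun m n => (hf' _).trans (hg' _ _)⟩

/-- A criterion for a balanced bilinear map to identify the balanced tensor product: an inverse is
given by `z ↦ ∑ j, x j ⊗ T j z`. -/
theorem inducesIso_of_locallyFinite (hZ : IsCompleteBVS Z) (hZ' : HasFreeExtension.{u} Z)
    (β : M →ₗ[ℂ] N →ₗ[ℂ] Z) (hβ : IsBoundedMap₂ fun m n => β m n)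
    (hbal : ∀ m a n, β (r.act m a) n = β m (l.act a n))
    {ι : Type*} (x : ι → M) (T : ι → Z →ₗ[ℂ] N) (hT : IsLocallyFiniteFamily T)
    (hT' : ∀ j, IsBoundedMap (T j)) (hβT : ∀ z, ∑ᶠ j, β (x j) (T j z) = z)
    (τ : ι → M → A) (hτ : ∀ j m n, T j (β m n) = l.act (τ j m) n)
    (hfin : ∀ m, (Function.support fun j => τ j m).Finite)
    (hsum : ∀ m, ∑ᶠ j, r.act (x j) (τ j m) = m) :
    InducesIso r l (fun m n => β m n) := by
  obtain ⟨Φ, hΦ, hΦ'⟩ := BalTensor.exists_lift r l hZ.isSeparated hZ' β hβ hbal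
  have hlf : IsLocallyFiniteFamily fun j => (baltmulₗ r l (x j)).comp (T j) := by
    intro S hS
    obtain ⟨J, hJ⟩ := hT S hS
    exact ⟨J, fun v hv j hj => by simp [hJ v hv j hj]⟩
  have hb : IsBoundedMap hlf.sum := hlf.isBoundedMap_sum
    (fun j => ((isBoundedMap₂_baltmul r l).left (x j)).comp (hT' j))
    (BalTensor.isVectorBornology r l)
  have h1 : ∀ z, Φ (hlf.sum z) = z := by
    intro z
    rw [hlf.map_sum]
    refine Eq.trans (finsum_congr fun j => ?_) (hβT z)
    exact hΦ' _ _
  -- On elementary tensors, `x j ⊗ T j (β m n) = x j ⊗ τ j m · n = x j · τ j m ⊗ n` by balancedness,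
  -- and these sum to `m ⊗ n`. Bounded maps that agree on elementary tensors are equal.
  have h2 : hlf.sum.comp Φ = LinearMap.id := by
    refine BalTensor.hom_ext (BalTensor.isSeparated r l) (BalTensor.isVectorBornology r l)
      (hb.comp hΦ) (fun S hS => by simpa using hS) fun m n => ?_
    rw [LinearMap.comp_apply, hΦ', LinearMap.id_apply, hlf.sum_apply]
    have : ∀ j, ((baltmulₗ r l (x j)).comp (T j)) (β m n) =
        (baltmulₗ r l).flip n (r.act (x j) (τ j m)) := by
      intro j
      rw [LinearMap.comp_apply, hτ, LinearMap.flip_apply, baltmulₗ_apply, baltmulₗ_apply,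
        baltmul_act]
    rw [finsum_congr this]
    have hfin' : (Function.support fun j => r.act (x j) (τ j m)).Finite :=
      (hfin m).subset fun j hj h0 => hj (by simp only [h0, map_zero])
    have := ((baltmulₗ r l).flip n).toAddMonoidHom.map_finsum hfin'
    refine this.symm.trans ?_
    rw [hsum]
    rfl
  refine ⟨⟨LinearEquiv.ofLinearMap Φ hlf.sum (LinearMap.ext h1) h2, hΦ, hb⟩, hΦ'⟩

end Balanced

/-! ### Completant discs -/

section Completant

variable {V : Type*} [AddCommGroup V] [Module ℂ V] [Bornology V]

/-- The image of the unit ball of a Banach space under a linear map into a separated bornological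
vector space is a completant disc, provided that it is bounded. -/
theorem isCompletantDisc_image_closedBall {B : Type*} [NormedAddCommGroup B] [NormedSpace ℂ B]
    [CompleteSpace B] (T : B →ₗ[ℂ] V) (hV : IsSeparatedBVS V)
    (hT : Bornology.IsBounded (T '' Metric.closedBall 0 1)) :
    IsCompletantDisc (T '' Metric.closedBall 0 1) := by
  have hsep := hV _ hT
  set D := T '' Metric.closedBall 0 1 with hD
  -- This replaces continuity of `T`: if `b` is within `ε` of the kernel for every `ε`, then `T b`
  -- lies in every multiple of `D` and vanishes by separatedness.
  have hclosed : IsClosed (LinearMap.ker T : Set B) := by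
    refine isClosed_of_closure_subset fun b hb => ?_
    refine hsep (T b) fun ε hε => ?_
    obtain ⟨k, hk, hbk⟩ := Metric.mem_closure_iff.1 hb ε hε
    have hε' : (ε : ℂ) ≠ 0 := by exact_mod_cast hε.ne'
    refine ⟨_, ⟨(ε : ℂ)⁻¹ • (b - k), ?_, rfl⟩, ?_⟩
    · rw [mem_closedBall_zero_iff, norm_smul, norm_inv, Complex.norm_real,
        Real.norm_of_nonneg hε.le, inv_mul_le_one₀ hε, ← dist_eq_norm]
      exact hbk.le
    · rw [map_smul, smul_inv_smul₀ hε', map_sub, LinearMap.mem_ker.1 hk, sub_zero]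
  have hspan : ∀ b, T b ∈ Submodule.span ℂ D := by
    intro b
    rcases eq_or_ne b 0 with rfl | hb
    · simp
    · have hb' : (‖b‖ : ℂ) ≠ 0 := by exact_mod_cast norm_ne_zero_iff.2 hb
      rw [← smul_inv_smul₀ hb' b, map_smul]
      refine Submodule.smul_mem _ _ (Submodule.subset_span ⟨_, ?_, rfl⟩)
      rw [mem_closedBall_zero_iff, norm_smul, norm_inv, Complex.norm_real, norm_norm,
        inv_mul_cancel₀ (norm_ne_zero_iff.2 hb)]
  have hrange : Submodule.span ℂ D ≤ LinearMap.range T :=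
    Submodule.span_le.2 (by rintro _ ⟨b, -, rfl⟩; exact ⟨b, rfl⟩)
  refine ⟨⟨?_, ?_⟩, hsep, ?_⟩
  · intro a ha
    rintro _ ⟨_, ⟨b, hb, rfl⟩, rfl⟩
    refine ⟨a • b, ?_, map_smul _ _ _⟩
    rw [mem_closedBall_zero_iff] at hb ⊢
    rw [norm_smul]
    exact mul_le_one₀ ha (norm_nonneg _) hb
  · rintro _ ⟨b, hb, rfl⟩ _ ⟨c, hc, rfl⟩ s t hs ht hst
    refine ⟨(s : ℂ) • b + (t : ℂ) • c, ?_, by simp⟩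
    rw [mem_closedBall_zero_iff] at hb hc ⊢
    refine (norm_add_le _ _).trans ?_
    rw [norm_smul, norm_smul, Complex.norm_real, Complex.norm_real, Real.norm_of_nonneg hs,
      Real.norm_of_nonneg ht, ← hst]
    exact add_le_add (mul_le_of_le_one_right hs hb) (mul_le_of_le_one_right ht hc)
  · intro x hx hcau
    choose b hb using fun n => hrange (hx n)
    let : IsClosed ((LinearMap.ker T).toAddSubgroup : Set B) := hclosed
    let : IsClosed (LinearMap.ker T : Set B) := hclosed
    -- Completeness is inherited from the Banach quotient `B / ker T`: preimages of a gauge Cauchy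
    -- sequence are Cauchy there. Using `ε / 2` yields the strict inequality.
    have hq : CauchySeq fun n => (LinearMap.ker T).mkQ (b n) := by
      refine Metric.cauchySeq_iff.2 fun ε hε => ?_
      obtain ⟨N, hN⟩ := hcau (ε / 2) (half_pos hε)
      refine ⟨N, fun m hm n hn => ?_⟩
      obtain ⟨_, ⟨c, hc, rfl⟩, h⟩ := hN m hm n hn
      rw [dist_eq_norm, ← map_sub]
      have : (LinearMap.ker T).mkQ (b m - b n) =
          (LinearMap.ker T).mkQ (((ε / 2 : ℝ) : ℂ) • c) := by
        refine (Submodule.Quotient.eq _).2 ?_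
        rw [LinearMap.mem_ker, map_sub, map_sub, map_smul, hb, hb, h, sub_self]
      rw [this]
      refine lt_of_le_of_lt (Submodule.Quotient.norm_mk_le _ _) ?_
      rw [mem_closedBall_zero_iff] at hc
      rw [norm_smul, Complex.norm_real, Real.norm_of_nonneg (half_pos hε).le]
      exact lt_of_le_of_lt (mul_le_of_le_one_right (half_pos hε).le hc) (half_lt_self hε)
    obtain ⟨y, hy⟩ := cauchySeq_tendsto_of_complete hq
    obtain ⟨l, rfl⟩ := (LinearMap.ker T).mkQ_surjective y
    refine ⟨T l, hspan l, fun ε hε => ?_⟩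
    obtain ⟨N, hN⟩ := Metric.tendsto_atTop.1 hy ε hε
    refine ⟨N, fun n hn => ?_⟩
    have h := hN n hn
    rw [dist_eq_norm, ← map_sub] at h
    -- A representative of `b n - l` modulo the kernel with norm below `ε`, so that `ε⁻¹ c` lies in
    -- the unit ball.
    obtain ⟨c, hc, hc'⟩ :=
      Submodule.Quotient.norm_mk_lt ((LinearMap.ker T).mkQ (b n - l)) (sub_pos.2 h)
    have hε' : (ε : ℂ) ≠ 0 := by exact_mod_cast hε.ne'
    refine ⟨_, ⟨(ε : ℂ)⁻¹ • c, ?_, rfl⟩, ?_⟩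
    · rw [mem_closedBall_zero_iff, norm_smul, norm_inv, Complex.norm_real,
        Real.norm_of_nonneg hε.le, inv_mul_le_one₀ hε]
      linarith
    · rw [map_smul, smul_inv_smul₀ hε', ← hb, ← map_sub]
      have := (Submodule.Quotient.eq _).1 hc
      rw [LinearMap.mem_ker, map_sub, sub_eq_zero] at this
      exact this.symm

/-- Extension by zero of the elements of `ℓ¹(S)`. -/
def FreeBVS.ofLp {Y : Type*} [Bornology Y] {S : Set Y} (hS : Bornology.IsBounded S) :
    lp (fun _ : S => ℂ) 1 →ₗ[ℂ] FreeBVS Y where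
  toFun c := FreeBVS.mk (Function.extend Subtype.val c 0)
    (by
      have h : (fun y => ‖Function.extend ((↑) : S → Y) c 0 y‖) =
          Function.extend ((↑) : S → Y) (fun s => ‖c s‖) 0 := by
        funext y
        by_cases hy : ∃ s : S, (s : Y) = y
        · obtain ⟨s, rfl⟩ := hy
          simp only [Subtype.val_injective.extend_apply]
        · simp only [Function.extend_apply' _ _ _ hy, Pi.zero_apply, norm_zero]
      rw [h]
      have := (lp.hasSum_norm (p := 1) (by simp) c).summable
      simp only [ENNReal.toReal_one, Real.rpow_one] at this
      exact ((hasSum_extend_zero Subtype.val_injective).2 this.hasSum).summable)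
    (hS.subset fun y hy => by
      by_contra h
      exact hy (Function.extend_apply' _ _ _ (by rintro ⟨s, rfl⟩; exact h s.2)))
  map_add' c d := by
    ext y
    simp only [FreeBVS.coeff_mk, map_add, Pi.add_apply]
    by_cases hy : ∃ s : S, (s : Y) = y
    · obtain ⟨s, rfl⟩ := hy
      simp only [Subtype.val_injective.extend_apply, lp.coeFn_add, Pi.add_apply]
    · simp only [Function.extend_apply' _ _ _ hy, Pi.zero_apply, add_zero]
  map_smul' a c := by
    ext y
    simp only [FreeBVS.coeff_mk, map_smul, Pi.smul_apply, RingHom.id_apply]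
    by_cases hy : ∃ s : S, (s : Y) = y
    · obtain ⟨s, rfl⟩ := hy
      simp only [Subtype.val_injective.extend_apply, lp.coeFn_smul, Pi.smul_apply]
    · simp only [Function.extend_apply' _ _ _ hy, Pi.zero_apply, smul_zero]

theorem FreeBVS.coeff_ofLp {Y : Type*} [Bornology Y] {S : Set Y} (hS : Bornology.IsBounded S)
    (c : lp (fun _ : S => ℂ) 1) : coeff (ofLp hS c) = Function.extend Subtype.val c 0 := rfl

theorem FreeBVS.ofLp_mem_ball {Y : Type*} [Bornology Y] {S : Set Y} (hS : Bornology.IsBounded S)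
    {c : lp (fun _ : S => ℂ) 1} (hc : ‖c‖ ≤ 1) : ofLp hS c ∈ ball S := by
  refine ⟨fun y hy => ?_, ?_⟩
  · by_contra h
    exact hy (Function.extend_apply' _ _ _ (by rintro ⟨s, rfl⟩; exact h s.2))
  · have h : (fun y => ‖Function.extend ((↑) : S → Y) c 0 y‖) =
        Function.extend ((↑) : S → Y) (fun s => ‖c s‖) 0 := by
      funext y
      by_cases hy : ∃ s : S, (s : Y) = y
      · obtain ⟨s, rfl⟩ := hy
        simp only [Subtype.val_injective.extend_apply]
      · simp only [Function.extend_apply' _ _ _ hy, Pi.zero_apply, norm_zero]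
    have := lp.hasSum_norm (p := 1) (by simp) c
    simp only [ENNReal.toReal_one, Real.rpow_one] at this
    rw [coeff_ofLp, h, ((hasSum_extend_zero Subtype.val_injective).2 this).tsum_eq]
    exact hc

/-- A separated vector bornology for which all `ℓ¹`-combinations of bounded families exist is
complete. -/
theorem isCompleteBVS_of_hasFreeExtension {V : Type u} [AddCommGroup V] [Module ℂ V] [Bornology V]
    (hV : IsVectorBornology V) (hs : IsSeparatedBVS V) (h : HasFreeExtension.{u} V) :
    IsCompleteBVS V := by
  classical
  refine ⟨hV.smul, hV.add, fun S hS => ?_⟩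
  -- The points of `V` serve as generators and the identity is extended. On `ℓ¹(S)` the extension
  -- forms `ℓ¹`-combinations of elements of `S`, and the image of the unit ball is the required
  -- disc; it contains `S` through the basis vectors.
  obtain ⟨g, hg, hg'⟩ := h V id fun S hS => by simpa using hS
  have hb : Bornology.IsBounded ((g.comp (FreeBVS.ofLp hS)) '' Metric.closedBall 0 1) := by
    refine (hg _ (FreeBVS.isBounded_ball hS)).subset ?_
    rintro _ ⟨c, hc, rfl⟩
    exact ⟨_, FreeBVS.ofLp_mem_ball hS (mem_closedBall_zero_iff.1 hc), rfl⟩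
  refine ⟨_, hb, isCompletantDisc_image_closedBall _ hs hb, fun v hv => ?_⟩
  refine ⟨lp.single 1 ⟨v, hv⟩ 1, ?_, ?_⟩
  · rw [mem_closedBall_zero_iff, lp.norm_single (by simp)]
    simp
  · rw [LinearMap.comp_apply]
    refine Eq.trans (congrArg g ?_) (hg' v)
    ext y
    rw [FreeBVS.coeff_ofLp, FreeBVS.coeff_of]
    by_cases hy : ∃ s : S, (s : V) = y
    · obtain ⟨s, rfl⟩ := hy
      rw [Subtype.val_injective.extend_apply, lp.single_apply, Pi.single_apply]
      simp only [Subtype.ext_iff]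
    · rw [Function.extend_apply' _ _ _ hy, if_neg]
      · rfl
      · rintro rfl
        exact hy ⟨⟨y, hv⟩, rfl⟩

end Completant

end ConvMorita

namespace ConvMorita

/-! ### Bounded maps on unitalizations -/

theorem isBoundedMap_inr {V W : Type*} [Zero V] [Bornology V] [Bornology W] :
    IsBoundedMap (fun w : W => ((0 : V), w)) := by
  intro S hS
  refine ((Bornology.isBounded_singleton (x := (0 : V))).prod hS).subset ?_
  rintro _ ⟨w, hw, rfl⟩
  exact ⟨rfl, hw⟩

theorem IsVectorBornology.isBoundedMap₂_smul {V : Type*} [AddCommGroup V] [Module ℂ V]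
    [Bornology V] (hV : IsVectorBornology V) : IsBoundedMap₂ fun (z : ℂ) (v : V) => z • v := by
  intro S T hS hT
  obtain ⟨C, hC0, hC⟩ := hS.exists_pos_norm_le
  refine (hV.smul C _ (hV.balanced T hT)).subset ?_
  rintro _ ⟨z, hz, v, hv, rfl⟩
  have hC' : (C : ℂ) ≠ 0 := by exact_mod_cast hC0.ne'
  refine ⟨((C : ℂ)⁻¹ * z) • v, ⟨_, ?_, v, hv, rfl⟩, ?_⟩
  · rw [norm_mul, norm_inv, Complex.norm_real, Real.norm_of_nonneg hC0.le, inv_mul_le_one₀ hC0]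
    exact hC _ hz
  · simp only [smul_smul]
    rw [mul_inv_cancel_left₀ hC']

theorem isBoundedMap₂_unitalization {A V W : Type*} [AddCommGroup V] [Module ℂ V]
    [Bornology V] [Bornology A] [Bornology W] (hV : IsVectorBornology V) {f : W → V} {g : A → W → V}
    (hf : IsBoundedMap f) (hg : IsBoundedMap₂ g) :
    IsBoundedMap₂ fun (p : ℂ × A) (w : W) => p.1 • f w + g p.2 w := by
  intro S T hS hT
  obtain ⟨h1, h2⟩ := isBounded_prod_iff.1 hS
  refine (hV.add _ _ (hV.isBoundedMap₂_smul _ _ h1 (hf _ hT)) (hg _ _ h2 hT)).subset ?_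
  rintro _ ⟨p, hp, w, hw, rfl⟩
  exact ⟨_, ⟨p.1, ⟨p, hp, rfl⟩, f w, ⟨w, hw, rfl⟩, rfl⟩, _, ⟨p.2, ⟨p, hp, rfl⟩, w, hw, rfl⟩, rfl⟩

theorem IsBoundedMap₂.swap {V W Z : Type*} [Bornology V] [Bornology W] [Bornology Z]
    {β : V → W → Z} (h : IsBoundedMap₂ β) : IsBoundedMap₂ fun w v => β v w := by
  intro S T hS hT
  rw [image2_swap]
  exact h T S hT hS

/-! ### Bornological algebroids with dual bases -/

section Algebroid

variable {I : Type*} (R : I → I → Type u) [∀ i j, AddCommGroup (R i j)] [∀ i j, Module ℂ (R i j)]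
  [∀ i j, Bornology (R i j)]

/-- A family of complete bornological vector spaces with associative bounded products
`R i j × R j k → R i k`. -/
structure BornAlgebroid where
  complete : ∀ i j, IsCompleteBVS (R i j)
  freeExtension : ∀ i j, HasFreeExtension.{u} (R i j)
  mul : ∀ i j k, R i j →ₗ[ℂ] R j k →ₗ[ℂ] R i k
  mul_assoc : ∀ {i j k l} (a : R i j) (b : R j k) (c : R k l),
    mul i k l (mul i j k a b) c = mul i j l a (mul j k l b c)
  bounded : ∀ i j k, IsBoundedMap₂ fun a b => mul i j k a b

namespace BornAlgebroid

variable {R} (𝓒 : BornAlgebroid R)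

/-- The algebra at an object. -/
def alg (i : I) : BornAlg (R i i) :=
  ⟨𝓒.complete i i, 𝓒.mul i i i, 𝓒.mul_assoc, 𝓒.bounded i i i⟩

/-- The bimodule attached to two objects. -/
def bimod (i j : I) : Bimod (𝓒.alg i) (𝓒.alg j) (R i j) where
  left := ⟨𝓒.complete i j, 𝓒.mul i i j, 𝓒.mul_assoc, 𝓒.bounded i i j⟩
  right := ⟨𝓒.complete i j, 𝓒.mul i j j, fun m a b => (𝓒.mul_assoc m a b).symm, 𝓒.bounded i j j⟩
  comm := fun a x b => 𝓒.mul_assoc a x b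

/-- Locally finite families `x n : R i j`, `y n : R j i` such that `∑ x n * y n` is a two-sided
unit at the object `i`. -/
structure DualBasis (i j : I) where
  ι : Type u
  x : ι → R i j
  y : ι → R j i
  finite_left : ∀ (k : I) (S : Set (R i k)), Bornology.IsBounded S →
    ∃ J : Finset ι, ∀ r ∈ S, ∀ n ∉ J, 𝓒.mul j i k (y n) r = 0
  finite_right : ∀ (k : I) (S : Set (R k i)), Bornology.IsBounded S →
    ∃ J : Finset ι, ∀ r ∈ S, ∀ n ∉ J, 𝓒.mul k i j r (x n) = 0
  sum_left : ∀ (k : I) (r : R i k), ∑ᶠ n, 𝓒.mul i j k (x n) (𝓒.mul j i k (y n) r) = r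
  sum_right : ∀ (k : I) (r : R k i), ∑ᶠ n, 𝓒.mul k j i (𝓒.mul k i j r (x n)) (y n) = r

variable {𝓒} {i j k : I}

namespace DualBasis

theorem locallyFinite_left (D : 𝓒.DualBasis i j) (k : I) :
    IsLocallyFiniteFamily fun n => 𝓒.mul j i k (D.y n) := D.finite_left k

theorem locallyFinite_right (D : 𝓒.DualBasis i j) (k : I) :
    IsLocallyFiniteFamily fun n => (𝓒.mul k i j).flip (D.x n) := D.finite_right k

/-- A dual basis identifies balanced tensor products. -/
theorem inducesIso (D : 𝓒.DualBasis i j) (k : I) : InducesIso (𝓒.bimod i j).right (𝓒.bimod j k).left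
    (fun m n => 𝓒.mul i j k m n) :=
  -- The criterion is applied with `T n = y n * ·` and `τ n m = y n * m`; associativity gives `y n
  -- (m r) = (y n m) r`.
  inducesIso_of_locallyFinite _ _ (𝓒.complete i k) (𝓒.freeExtension i k) (𝓒.mul i j k)
    (𝓒.bounded i j k) (fun m a n => 𝓒.mul_assoc m a n) D.x (fun n => 𝓒.mul j i k (D.y n))
    (D.locallyFinite_left k) (fun n => (𝓒.bounded j i k).left (D.y n)) (D.sum_left k)
    (fun n m => 𝓒.mul j i j (D.y n) m) (fun n m r => (𝓒.mul_assoc (D.y n) m r).symm)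
    ((D.locallyFinite_left j).finite_support) (D.sum_left j)

/-- From `r = ∑ (r x n) y n` it follows that `g r = ∑ (r x n) g(y n)`. Applying the linear splitting
`s` only to the vectors `g(y n)` gives the lift `r ↦ ∑ (r x n) s(g(y n))`, which is module linear
although `s` need not be. -/
theorem isProjective_left (D : 𝓒.DualBasis i j) : (𝓒.bimod j i).left.IsProjective := by
  intro M N _ _ _ _ _ _ lM lN q s hq hs hqs
  let T : (R j i →ₗ[ℂ] N) → D.ι → R j i →ₗ[ℂ] M := fun g n =>
    (lM.act.flip (s (g (D.y n)))).comp ((𝓒.mul j i j).flip (D.x n))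
  have hT : ∀ g n r, T g n r = lM.act (𝓒.mul j i j r (D.x n)) (s (g (D.y n))) :=
    fun _ _ _ => rfl
  have hfin : ∀ g, IsLocallyFiniteFamily (T g) := by
    intro g S hS
    obtain ⟨J, hJ⟩ := D.finite_right j S hS
    exact ⟨J, fun r hr n hn => by rw [hT, hJ r hr n hn]; simp⟩
  -- The finite set of contributing indices depends on `S` and not on `g`, so the estimate is
  -- uniform over an equibounded family.
  have hbound : ∀ 𝓕 : Set (R j i →ₗ[ℂ] N), IsEquibounded 𝓕 →
      IsEquibounded ((fun g => (hfin g).sum) '' 𝓕) := by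
    intro 𝓕 h𝓕 S hS
    obtain ⟨J, hJ⟩ := D.finite_right j S hS
    refine (lM.complete.isVectorBornology.sum J
      (fun n => image2 (fun a m => lM.act a m) ((fun r => 𝓒.mul j i j r (D.x n)) '' S)
        (s '' (image2 (fun g v => g v) 𝓕 {D.y n}))) fun n _ => lM.bounded _ _
        ((𝓒.bounded j i j).right _ S hS)
        (hs _ (h𝓕 _ Bornology.isBounded_singleton))).subset ?_
    rintro _ ⟨_, ⟨g, hg, rfl⟩, r, hr, rfl⟩
    refine ⟨fun n => T g n r, fun n _ => ⟨_, ⟨r, hr, rfl⟩, _, ⟨_, ⟨g, hg, _, rfl, rfl⟩, rfl⟩, rfl⟩,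
      (hfin g).sum_eq fun n hn => ?_⟩
    rw [hT, hJ r hr n hn]
    simp
  have hmem : ∀ g ∈ (𝓒.bimod j i).left.hom lN, (hfin g).sum ∈ (𝓒.bimod j i).left.hom lM := by
    intro g hg
    refine ⟨fun S hS => ?_, fun a r => ?_⟩
    · refine (hbound {g} ?_ S hS).subset ?_
      · intro S' hS'
        rw [image2_singleton_left]
        exact hg.1 S' hS'
      · rintro _ ⟨r, hr, rfl⟩
        exact ⟨_, ⟨g, rfl, rfl⟩, r, hr, rfl⟩
    · rw [(hfin g).map_sum, (hfin g).sum_apply]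
      refine finsum_congr fun n => ?_
      rw [hT, hT, ← lM.act_mul]
      congr 2
      exact 𝓒.mul_assoc a r (D.x n)
  refine ⟨⟨⟨fun g => ⟨(hfin g.1).sum, hmem g.1 g.2⟩, fun g g' => ?_⟩, fun a g => ?_⟩, ?_, ?_⟩
  · refine Subtype.ext (LinearMap.ext fun r => ?_)
    refine Eq.trans ?_ (finsum_add_distrib ((hfin g.1).finite_support r)
      ((hfin g'.1).finite_support r))
    refine finsum_congr fun n => ?_
    simp [hT]
  · refine Subtype.ext (LinearMap.ext fun r => ?_)
    refine Eq.trans ?_ (smul_finsum' a ((hfin g.1).finite_support r)).symm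
    refine finsum_congr fun n => ?_
    simp [hT]
  · intro g r
    change q ((hfin g.1).sum r) = g.1 r
    rw [(hfin g.1).map_sum]
    conv_rhs => rw [← D.sum_right j r]
    have hf : (Function.support fun n =>
        𝓒.mul j j i (𝓒.mul j i j r (D.x n)) (D.y n)).Finite :=
      ((D.locallyFinite_right j).finite_support r).subset fun n hn h0 => hn (by
        simp only [LinearMap.flip_apply] at h0
        simp only [h0, map_zero, LinearMap.zero_apply])
    refine Eq.trans ?_ (g.1.toAddMonoidHom.map_finsum hf).symm
    refine finsum_congr fun n => ?_
    rw [hT, hq.2, hqs]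
    exact (g.2.2 _ _).symm
  · intro 𝓕 h𝓕
    have := hbound _ h𝓕
    rwa [image_image] at this

/-- The mirror image: `g r = ∑ g(x n) (y n r)` is lifted to `∑ s(g(x n)) (y n r)`. -/
theorem isProjective_right (D : 𝓒.DualBasis i j) : (𝓒.bimod i j).right.IsProjective := by
  intro M N _ _ _ _ _ _ rM rN q s hq hs hqs
  let T : (R i j →ₗ[ℂ] N) → D.ι → R i j →ₗ[ℂ] M := fun g n =>
    (rM.act (s (g (D.x n)))).comp (𝓒.mul j i j (D.y n))
  have hT : ∀ g n r, T g n r = rM.act (s (g (D.x n))) (𝓒.mul j i j (D.y n) r) :=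
    fun _ _ _ => rfl
  have hfin : ∀ g, IsLocallyFiniteFamily (T g) := by
    intro g S hS
    obtain ⟨J, hJ⟩ := D.finite_left j S hS
    exact ⟨J, fun r hr n hn => by rw [hT, hJ r hr n hn]; simp⟩
  have hbound : ∀ 𝓕 : Set (R i j →ₗ[ℂ] N), IsEquibounded 𝓕 →
      IsEquibounded ((fun g => (hfin g).sum) '' 𝓕) := by
    intro 𝓕 h𝓕 S hS
    obtain ⟨J, hJ⟩ := D.finite_left j S hS
    refine (rM.complete.isVectorBornology.sum J
      (fun n => image2 (fun m a => rM.act m a) (s '' (image2 (fun g v => g v) 𝓕 {D.x n}))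
        ((fun r => 𝓒.mul j i j (D.y n) r) '' S)) fun n _ => rM.bounded _ _
        (hs _ (h𝓕 _ Bornology.isBounded_singleton))
        ((𝓒.bounded j i j).left _ S hS)).subset ?_
    rintro _ ⟨_, ⟨g, hg, rfl⟩, r, hr, rfl⟩
    refine ⟨fun n => T g n r, fun n _ => ⟨_, ⟨_, ⟨g, hg, _, rfl, rfl⟩, rfl⟩, _, ⟨r, hr, rfl⟩, rfl⟩,
      (hfin g).sum_eq fun n hn => ?_⟩
    rw [hT, hJ r hr n hn]
    simp
  have hmem : ∀ g ∈ (𝓒.bimod i j).right.hom rN, (hfin g).sum ∈ (𝓒.bimod i j).right.hom rM := by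
    intro g hg
    refine ⟨fun S hS => ?_, fun r a => ?_⟩
    · refine (hbound {g} ?_ S hS).subset ?_
      · intro S' hS'
        rw [image2_singleton_left]
        exact hg.1 S' hS'
      · rintro _ ⟨r, hr, rfl⟩
        exact ⟨_, ⟨g, rfl, rfl⟩, r, hr, rfl⟩
    · refine Eq.trans ?_ ((hfin g).map_sum (rM.act.flip a) r).symm
      rw [(hfin g).sum_apply]
      refine finsum_congr fun n => ?_
      rw [LinearMap.flip_apply, hT, hT, ← rM.act_mul]
      congr 1
      exact (𝓒.mul_assoc (D.y n) r a).symm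
  refine ⟨⟨⟨fun g => ⟨(hfin g.1).sum, hmem g.1 g.2⟩, fun g g' => ?_⟩, fun a g => ?_⟩, ?_, ?_⟩
  · refine Subtype.ext (LinearMap.ext fun r => ?_)
    refine Eq.trans ?_ (finsum_add_distrib ((hfin g.1).finite_support r)
      ((hfin g'.1).finite_support r))
    refine finsum_congr fun n => ?_
    simp [hT]
  · refine Subtype.ext (LinearMap.ext fun r => ?_)
    refine Eq.trans ?_ (smul_finsum' a ((hfin g.1).finite_support r)).symm
    refine finsum_congr fun n => ?_
    simp [hT]
  · intro g r
    change q ((hfin g.1).sum r) = g.1 r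
    rw [(hfin g.1).map_sum]
    conv_rhs => rw [← D.sum_left j r]
    have hf : (Function.support fun n =>
        𝓒.mul i j j (D.x n) (𝓒.mul j i j (D.y n) r)).Finite :=
      ((D.locallyFinite_left j).finite_support r).subset fun n hn h0 => hn (by
        simp only [h0, map_zero])
    refine Eq.trans ?_ (g.1.toAddMonoidHom.map_finsum hf).symm
    refine finsum_congr fun n => ?_
    rw [hT, hq.2, hqs]
    exact (g.2.2 _ _).symm
  · intro 𝓕 h𝓕
    have := hbound _ h𝓕
    rwa [image_image] at this

end DualBasis

/-- On a bounded set only finitely many terms of the two unit expansions survive, so a finite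
partial sum of `∑ x n * y n` is an exact two-sided unit there. A constant sequence suffices. -/
theorem hasApproximateIdentity (D : 𝓒.DualBasis i i) : (𝓒.alg i).HasApproximateIdentity := by
  classical
  intro S hS
  obtain ⟨J, hJ⟩ := D.finite_left i S hS
  obtain ⟨J', hJ'⟩ := D.finite_right i S hS
  -- The point `0` is adjoined so that the vanishing error can be written as `ε • 0` with `0 ∈ T`.
  obtain ⟨T, hT, hT', hST⟩ := (𝓒.complete i i).complete (S ∪ {0})
    (hS.union Bornology.isBounded_singleton)
  have h0 : (0 : R i i) ∈ T := hST (Or.inr rfl)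
  refine ⟨fun _ => ∑ n ∈ J ∪ J', 𝓒.mul i i i (D.x n) (D.y n), T, hT, hT',
    subset_union_left.trans hST, fun ε hε => ⟨0, fun n _ r hr => ⟨⟨0, h0, ?_⟩, ⟨0, h0, ?_⟩⟩⟩⟩
  · rw [smul_zero, sub_eq_zero]
    refine Eq.trans ?_ (D.sum_left i r)
    rw [finsum_eq_sum_of_support_subset (s := J ∪ J')]
    · rw [map_sum, LinearMap.sum_apply]
      exact Finset.sum_congr rfl fun n _ => 𝓒.mul_assoc _ _ _
    · intro n hn
      by_contra h
      refine hn ?_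
      simp only [Finset.coe_union, mem_union, Finset.mem_coe, not_or] at h
      simp only [hJ r hr n h.1, map_zero]
  · rw [smul_zero, sub_eq_zero]
    refine Eq.trans ?_ (D.sum_right i r)
    rw [finsum_eq_sum_of_support_subset (s := J ∪ J')]
    · rw [map_sum]
      exact Finset.sum_congr rfl fun n _ => (𝓒.mul_assoc _ _ _).symm
    · intro n hn
      by_contra h
      refine hn ?_
      simp only [Finset.coe_union, mem_union, Finset.mem_coe, not_or] at h
      simp only [hJ' r hr n h.2, map_zero, LinearMap.zero_apply]

/-- The linear map `(z, x) ↦ (0, z a + f x)` on the unitalization. -/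
def unitalizationMap {A : Type*} [AddCommGroup A] [Module ℂ A] (f : A →ₗ[ℂ] A) (a : A) :
    ℂ × A →ₗ[ℂ] ℂ × A :=
  (LinearMap.inr ℂ ℂ A).comp ((LinearMap.toSpanSingleton ℂ A a).coprod f)

theorem unitalizationMap_apply {A : Type*} [AddCommGroup A] [Module ℂ A] (f : A →ₗ[ℂ] A) (a : A)
    (p : ℂ × A) : unitalizationMap f a p = (0, p.1 • a + f p.2) := rfl

theorem isBoundedMap_unitalizationMap {A : Type*} [AddCommGroup A] [Module ℂ A] [Bornology A]
    (hA : IsVectorBornology A) {f : A →ₗ[ℂ] A} (hf : IsBoundedMap f) (a : A) :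
    IsBoundedMap (unitalizationMap f a) := by
  refine isBoundedMap_inr.comp (f := fun p : ℂ × A => p.1 • a + f p.2) ?_
  refine (isBoundedMap₂_unitalization hA (W := Unit) (f := fun _ => a) (g := fun x _ => f x)
    (fun S _ => ?_) fun S T hS _ => ?_).right ()
  · exact (Bornology.isBounded_singleton (x := a)).subset (by rintro _ ⟨_, _, rfl⟩; rfl)
  · exact (hf S hS).subset (by rintro _ ⟨x, hx, _, _, rfl⟩; exact ⟨x, hx, rfl⟩)

/-- The section is `a ↦ ∑ (0, a x n) ⊗ y n`. It is left linear because `a` enters only as a left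
factor, and multiplication returns `∑ (a x n) y n = a`. -/
theorem hasLeftSection (D : 𝓒.DualBasis i i) : (𝓒.alg i).HasLeftSection := by
  have hc := 𝓒.complete i i
  have hid : ∀ {V : Type u} [Bornology V], IsBoundedMap (id : V → V) := fun S hS => by simpa using hS
  obtain ⟨m, hm, hm'⟩ := CTensor.exists_lift (V := ℂ × R i i) (W := R i i) hc.isSeparated
    (𝓒.freeExtension i i)
    (LinearMap.coprod (LinearMap.lsmul ℂ (R i i)) (𝓒.mul i i i))
    (isBoundedMap₂_unitalization hc.isVectorBornology hid (𝓒.bounded i i i))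
  have hact : ∀ a, ∃ f : CTensor (ℂ × R i i) (R i i) →ₗ[ℂ] CTensor (ℂ × R i i) (R i i),
      IsBoundedMap f ∧ ∀ v w, f (ctmul v w) = ctmul (unitalizationMap (𝓒.mul i i i a) a v) w :=
    fun a => CTensor.exists_map _ LinearMap.id (isBoundedMap_unitalizationMap hc.isVectorBornology
      ((𝓒.bounded i i i).left a) a) hid
  choose act hact hact' using hact
  let T : D.ι → R i i →ₗ[ℂ] CTensor (ℂ × R i i) (R i i) := fun n =>
    ((ctmulₗ _ _).flip (D.y n)).comp ((LinearMap.inr ℂ ℂ (R i i)).comp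
      ((𝓒.mul i i i).flip (D.x n)))
  have hT : ∀ n r, T n r = ctmul ((0 : ℂ), 𝓒.mul i i i r (D.x n)) (D.y n) := fun _ _ => rfl
  have hlf : IsLocallyFiniteFamily T := by
    intro S hS
    obtain ⟨J, hJ⟩ := D.finite_right i S hS
    refine ⟨J, fun r hr n hn => ?_⟩
    simp only [T, LinearMap.comp_apply, LinearMap.flip_apply, hJ r hr n hn, map_zero]
  refine ⟨m, act, hlf.sum, hm, hact, hlf.isBoundedMap_sum (fun n => ?_)
    (CTensor.isVectorBornology _ _), fun z x y => hm' _ _, fun a z x y => hact' _ _ _,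
    fun a b => ?_, fun a => ?_⟩
  · exact (isBoundedMap₂_ctmul.right (D.y n)).comp
      (isBoundedMap_inr.comp ((𝓒.bounded i i i).right (D.x n)))
  · rw [hlf.map_sum, hlf.sum_apply]
    refine finsum_congr fun n => ?_
    rw [hT, hT, hact', unitalizationMap_apply, zero_smul, zero_add]
    exact congrArg (fun z => ctmul ((0 : ℂ), z) (D.y n)) (𝓒.mul_assoc a b (D.x n))
  · rw [hlf.map_sum]
    refine Eq.trans (finsum_congr fun n => ?_) (D.sum_right i a)
    rw [hT, hm']
    simp

/-- Here the section is `a ↦ ∑ x n ⊗ (0, y n a)`. -/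
theorem hasRightSection (D : 𝓒.DualBasis i i) : (𝓒.alg i).HasRightSection := by
  have hc := 𝓒.complete i i
  have hid : ∀ {V : Type u} [Bornology V], IsBoundedMap (id : V → V) := fun S hS => by simpa using hS
  obtain ⟨m, hm, hm'⟩ := CTensor.exists_lift (V := R i i) (W := ℂ × R i i) hc.isSeparated
    (𝓒.freeExtension i i)
    (LinearMap.coprod (LinearMap.lsmul ℂ (R i i)) (𝓒.mul i i i).flip).flip
    (isBoundedMap₂_unitalization hc.isVectorBornology hid (𝓒.bounded i i i).swap).swap
  have hact : ∀ a, ∃ f : CTensor (R i i) (ℂ × R i i) →ₗ[ℂ] CTensor (R i i) (ℂ × R i i),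
      IsBoundedMap f ∧
        ∀ v w, f (ctmul v w) = ctmul v (unitalizationMap ((𝓒.mul i i i).flip a) a w) :=
    fun a => CTensor.exists_map LinearMap.id _ hid
      (isBoundedMap_unitalizationMap hc.isVectorBornology ((𝓒.bounded i i i).right a) a)
  choose act hact hact' using hact
  let T : D.ι → R i i →ₗ[ℂ] CTensor (R i i) (ℂ × R i i) := fun n =>
    (ctmulₗ _ _ (D.x n)).comp ((LinearMap.inr ℂ ℂ (R i i)).comp (𝓒.mul i i i (D.y n)))
  have hT : ∀ n r, T n r = ctmul (D.x n) ((0 : ℂ), 𝓒.mul i i i (D.y n) r) := fun _ _ => rfl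
  have hlf : IsLocallyFiniteFamily T := by
    intro S hS
    obtain ⟨J, hJ⟩ := D.finite_left i S hS
    refine ⟨J, fun r hr n hn => ?_⟩
    simp only [T, LinearMap.comp_apply, hJ r hr n hn, map_zero]
  refine ⟨m, act, hlf.sum, hm, hact, hlf.isBoundedMap_sum (fun n => ?_)
    (CTensor.isVectorBornology _ _), fun y z x => hm' _ _, fun a y z x => hact' _ _ _,
    fun b a => ?_, fun a => ?_⟩
  · exact (isBoundedMap₂_ctmul.left (D.x n)).comp
      (isBoundedMap_inr.comp ((𝓒.bounded i i i).left (D.y n)))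
  · rw [hlf.map_sum, hlf.sum_apply]
    refine finsum_congr fun n => ?_
    rw [hT, hT, hact', unitalizationMap_apply, zero_smul, zero_add]
    exact congrArg (fun z => ctmul (D.x n) ((0 : ℂ), z)) (𝓒.mul_assoc (D.y n) b a).symm
  · rw [hlf.map_sum]
    refine Eq.trans (finsum_congr fun n => ?_) (D.sum_left i a)
    rw [hT, hm']
    simp

theorem isQuasiUnital (D : 𝓒.DualBasis i i) : (𝓒.alg i).IsQuasiUnital :=
  ⟨hasApproximateIdentity D, hasLeftSection D, hasRightSection D⟩

/-- The two actions are themselves products of the algebroid, with middle object `i` and `j`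
respectively, so this is `DualBasis.inducesIso` twice. -/
theorem isEssential (D : ∀ i j, 𝓒.DualBasis i j) (i j : I) : (𝓒.bimod i j).IsEssential :=
  ⟨(D i i).inducesIso j, (D i j).inducesIso j⟩

theorem tensorIsoAlg (D : 𝓒.DualBasis i j) : TensorIsoAlg (𝓒.bimod i j) (𝓒.bimod j i) :=
  ⟨fun x y => 𝓒.mul i j i x y, D.inducesIso i, fun a x y => 𝓒.mul_assoc a x y,
    fun x y a => (𝓒.mul_assoc x y a).symm⟩

/-- In a bornological algebroid with dual bases all bimodules are Morita equivalence bimodules. -/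
theorem isMoritaEquivalenceBimodule (D : ∀ i j, 𝓒.DualBasis i j) (i j : I) :
    IsMoritaEquivalenceBimodule (𝓒.bimod i j) where
  quasiUnital_left := isQuasiUnital (D i i)
  quasiUnital_right := isQuasiUnital (D j j)
  essential := isEssential D i j
  exists_dual := ⟨R j i, _, _, _, 𝓒.bimod j i,
    ⟨isEssential D j i, (D i j).isProjective_left, (D j i).isProjective_right,
      tensorIsoAlg (D i j), tensorIsoAlg (D j i)⟩⟩

end BornAlgebroid

end Algebroid

end ConvMorita

namespace ConvMorita

open scoped Topology
open Filter

/-! ### Smooth families of functions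

A family of functions is bounded with all its derivatives, locally uniformly, if and only if it is
the family of components of a smooth map into a space of bounded families. -/

/-- The Banach space of bounded families. -/
abbrev LInf (ι V : Type*) [NormedAddCommGroup V] : Type _ := lp (fun _ : ι => V) ⊤

namespace LInf

variable {ι κ V W : Type*} [NormedAddCommGroup V] [NormedSpace ℝ V] [NormedAddCommGroup W]
  [NormedSpace ℝ W]

/-- The family with prescribed components. -/
def mk (f : ι → V) (C : ℝ) (hC : ∀ i, ‖f i‖ ≤ C) : LInf ι V :=
  ⟨f, memℓp_infty ⟨C, by rintro _ ⟨i, rfl⟩; exact hC i⟩⟩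

@[simp] theorem mk_apply (f : ι → V) (C : ℝ) (hC : ∀ i, ‖f i‖ ≤ C) (i : ι) : mk f C hC i = f i :=
  rfl

theorem norm_apply_le (φ : LInf ι V) (i : ι) : ‖φ i‖ ≤ ‖φ‖ :=
  lp.norm_apply_le_norm (by simp) φ i

theorem norm_le {φ : LInf ι V} {C : ℝ} (hC : 0 ≤ C) (h : ∀ i, ‖φ i‖ ≤ C) : ‖φ‖ ≤ C :=
  lp.norm_le_of_forall_le hC h

/-- Evaluation at an index. -/
def eval (i : ι) : LInf ι V →L[ℝ] V :=
  LinearMap.mkContinuous ⟨⟨fun φ => φ i, fun _ _ => rfl⟩, fun _ _ => rfl⟩ 1 fun φ => by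
    rw [one_mul]
    exact norm_apply_le φ i

@[simp] theorem eval_apply (i : ι) (φ : LInf ι V) : eval i φ = φ i := rfl

theorem norm_eval_le (i : ι) : ‖(eval i : LInf ι V →L[ℝ] V)‖ ≤ 1 :=
  LinearMap.mkContinuous_norm_le _ zero_le_one _

/-- Reindexing. -/
def reindex (g : κ → ι) : LInf ι V →L[ℝ] LInf κ V :=
  LinearMap.mkContinuous ⟨⟨fun φ => mk (fun k => φ (g k)) ‖φ‖ fun k => norm_apply_le φ (g k),
    fun _ _ => rfl⟩, fun _ _ => rfl⟩ 1 fun φ => by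
    rw [one_mul]
    exact norm_le (norm_nonneg _) fun k => norm_apply_le φ (g k)

@[simp] theorem reindex_apply (g : κ → ι) (φ : LInf ι V) (k : κ) : reindex g φ k = φ (g k) := rfl

/-- A bounded family of linear maps is a linear map into bounded families. -/
def flip (ι V W : Type*) [NormedAddCommGroup V] [NormedSpace ℝ V] [NormedAddCommGroup W]
    [NormedSpace ℝ W] : LInf ι (V →L[ℝ] W) →L[ℝ] V →L[ℝ] LInf ι W :=
  LinearMap.mkContinuous₂ (LinearMap.mk₂ ℝ
    (fun (φ : LInf ι (V →L[ℝ] W)) (v : V) => mk (fun i => φ i v) (‖φ‖ * ‖v‖) fun i =>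
      (φ i).le_of_opNorm_le (norm_apply_le φ i) v)
    (fun _ _ _ => rfl) (fun _ _ _ => rfl)
    (fun φ v w => lp.ext (funext fun i => map_add (φ i) v w))
    (fun c φ v => lp.ext (funext fun i => map_smul (φ i) c v))) 1 fun φ v => by
    rw [one_mul]
    exact norm_le (by positivity) fun i => (φ i).le_of_opNorm_le (norm_apply_le φ i) v

@[simp] theorem flip_apply (φ : LInf ι (V →L[ℝ] W)) (v : V) (i : ι) : flip ι V W φ v i = φ i v :=
  rfl

open Classical in
/-- The map into bounded families whose components are prescribed, where they are bounded. -/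
def ofFamily {E : Type*} (f : ι → E → V) (x : E) : LInf ι V :=
  if h : Memℓp (fun i => f i x) ⊤ then ⟨_, h⟩ else 0

theorem ofFamily_apply {E : Type*} {f : ι → E → V} {x : E} {C : ℝ} (h : ∀ i, ‖f i x‖ ≤ C) (i : ι) :
    ofFamily f x i = f i x := by
  rw [ofFamily, dif_pos (memℓp_infty ⟨C, by rintro _ ⟨i, rfl⟩; exact h i⟩)]

end LInf

section Euclidean

variable {ι : Type*} {E : Type*} [NormedAddCommGroup E] [NormedSpace ℝ E]

/-- A family of functions on `U` which is bounded with all its derivatives, locally uniformly. -/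
structure LocallyBoundedDerivs {V : Type*} [NormedAddCommGroup V] [NormedSpace ℝ V]
    (f : ι → E → V) (U : Set E) : Prop where
  smooth : ∀ i, ContDiffOn ℝ ∞ (f i) U
  bounded : ∀ (k : ℕ), ∀ x ∈ U, ∃ C, ∀ᶠ y in 𝓝 x, ∀ i, ‖iteratedFDeriv ℝ k (f i) y‖ ≤ C

namespace LocallyBoundedDerivs

variable {V : Type*} [NormedAddCommGroup V] [NormedSpace ℝ V] {f : ι → E → V} {U : Set E}

theorem fderiv (h : LocallyBoundedDerivs f U) (hU : IsOpen U) :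
    LocallyBoundedDerivs (fun i => fderiv ℝ (f i)) U where
  smooth i := ((contDiffOn_infty_iff_fderiv_of_isOpen hU).1 (h.smooth i)).2
  bounded k x hx := by
    obtain ⟨C, hC⟩ := h.bounded (k + 1) x hx
    refine ⟨C, hC.mono fun y hy i => ?_⟩
    rw [norm_iteratedFDeriv_fderiv]
    exact hy i

theorem bounded_zero (h : LocallyBoundedDerivs f U) {x : E} (hx : x ∈ U) :
    ∃ C, ∀ᶠ y in 𝓝 x, ∀ i, ‖f i y‖ ≤ C := by
  simpa using h.bounded 0 x hx

theorem ofFamily_eventually (h : LocallyBoundedDerivs f U) {x : E} (hx : x ∈ U) :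
    ∀ᶠ y in 𝓝 x, ∀ i, LInf.ofFamily f y i = f i y := by
  obtain ⟨C, hC⟩ := h.bounded_zero hx
  exact hC.mono fun y hy i => LInf.ofFamily_apply hy i

/-- A bound on the second derivatives that is uniform in the index makes the first order remainders
small uniformly in the index, which is differentiability in the supremum norm. -/
theorem hasFDerivAt (h : LocallyBoundedDerivs f U) (hU : IsOpen U) {x : E} (hx : x ∈ U) :
    HasFDerivAt (LInf.ofFamily f)
      (LInf.flip ι E V (LInf.ofFamily (fun i => _root_.fderiv ℝ (f i)) x)) x := by
  have h1 := h.ofFamily_eventually hx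
  have h2 := ((h.fderiv hU).ofFamily_eventually hx).self_of_nhds
  obtain ⟨C, hC⟩ := (h.fderiv hU).bounded 1 x hx
  rw [hasFDerivAt_iff_isLittleO, Asymptotics.isLittleO_iff]
  intro ε hε
  obtain ⟨δ, hδ, hball⟩ := Metric.eventually_nhds_iff_ball.1
    ((h1.and hC).and (hU.mem_nhds hx))
  have hdiff : ∀ i, ∀ z ∈ U, DifferentiableAt ℝ (_root_.fderiv ℝ (f i)) z := fun i z hz =>
    (((h.fderiv hU).smooth i).contDiffAt (hU.mem_nhds hz)).differentiableAt (by simp)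
  have hdiff' : ∀ i, ∀ z ∈ U, DifferentiableAt ℝ (f i) z := fun i z hz =>
    ((h.smooth i).contDiffAt (hU.mem_nhds hz)).differentiableAt (by simp)
  -- Within distance `ρ` the first derivatives vary by at most `|C| ρ ≤ ε`; the summand `1` covers
  -- `C = 0`.
  set ρ := min δ (ε / (|C| + 1)) with hρ
  have hρ0 : 0 < ρ := lt_min hδ (by positivity)
  filter_upwards [Metric.ball_mem_nhds x hρ0] with y hy
  have hsub : Metric.ball x ρ ⊆ Metric.ball x δ := Metric.ball_subset_ball (min_le_left _ _)
  have hx' : x ∈ Metric.ball x ρ := Metric.mem_ball_self hρ0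
  refine LInf.norm_le (by positivity) fun i => ?_
  have hlip : ∀ z ∈ Metric.ball x ρ,
      ‖_root_.fderiv ℝ (f i) z - _root_.fderiv ℝ (f i) x‖ ≤ ε := by
    intro z hz
    have := (convex_ball x ρ).norm_image_sub_le_of_norm_fderiv_le (𝕜 := ℝ) (C := |C|)
      (f := _root_.fderiv ℝ (f i))
      (fun w hw => hdiff i w (hball w (hsub hw)).2)
      (fun w hw => by
        have := (hball w (hsub hw)).1.2 i
        rw [norm_iteratedFDeriv_one] at this
        exact this.trans (le_abs_self C)) hx' hz
    refine this.trans ?_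
    have hz' : ‖z - x‖ ≤ ε / (|C| + 1) := by
      rw [← dist_eq_norm]
      exact (Metric.mem_ball.1 hz).le.trans (min_le_right _ _)
    calc |C| * ‖z - x‖ ≤ (|C| + 1) * (ε / (|C| + 1)) := by gcongr; linarith
      _ = ε := by field_simp
  have := (convex_ball x ρ).norm_image_sub_le_of_norm_hasFDerivWithin_le' (𝕜 := ℝ) (C := ε)
    (f := f i) (φ := _root_.fderiv ℝ (f i) x)
    (fun w hw => (hdiff' i w (hball w (hsub hw)).2).hasFDerivAt.hasFDerivWithinAt) hlip hx' hy
  simp only [lp.coeFn_sub, Pi.sub_apply, LInf.flip_apply, h2]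
  rw [(hball y (hsub hy)).1.1, h1.self_of_nhds]
  exact this

/-- The value space is generalized in the induction because the family of derivatives takes values
in `E →L[ℝ] V`. Taking `V` in the universe of `E` keeps it in the same universe. -/
theorem contDiffOn_nat {E : Type u} [NormedAddCommGroup E] [NormedSpace ℝ E] {U : Set E}
    (hU : IsOpen U) (n : ℕ) : ∀ (V : Type u) [NormedAddCommGroup V] [NormedSpace ℝ V]
    (f : ι → E → V), LocallyBoundedDerivs f U → ContDiffOn ℝ n (LInf.ofFamily f) U := by
  induction n with
  | zero =>
    intro V _ _ f h
    rw [Nat.cast_zero, contDiffOn_zero]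
    exact fun x hx => (h.hasFDerivAt hU hx).continuousAt.continuousWithinAt
  | succ n ih =>
    intro V _ _ f h
    rw [Nat.cast_succ, contDiffOn_succ_iff_fderiv_of_isOpen hU]
    refine ⟨fun x hx => (h.hasFDerivAt hU hx).differentiableAt.differentiableWithinAt,
      by simp, ?_⟩
    exact ((LInf.flip ι E V).contDiff.comp_contDiffOn (ih _ _ (h.fderiv hU))).congr
      fun x hx => (h.hasFDerivAt hU hx).fderiv

/-- One derivative is taken by hand: it moves the values from `ℂ` to `E →L[ℝ] ℂ`, which lies in the
universe where the induction applies. -/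
theorem contDiffOn {E : Type u} [NormedAddCommGroup E] [NormedSpace ℝ E] {U : Set E}
    {f : ι → E → ℂ} (h : LocallyBoundedDerivs f U) (hU : IsOpen U) :
    ContDiffOn ℝ ∞ (LInf.ofFamily f) U := by
  rw [contDiffOn_infty_iff_fderiv_of_isOpen hU]
  refine ⟨fun x hx => (h.hasFDerivAt hU hx).differentiableAt.differentiableWithinAt, ?_⟩
  exact ((LInf.flip ι E ℂ).contDiff.comp_contDiffOn
    (contDiffOn_infty.2 fun n => contDiffOn_nat hU n _ _ (h.fderiv hU))).congr
      fun x hx => (h.hasFDerivAt hU hx).fderiv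

end LocallyBoundedDerivs

end Euclidean

/-! ### Smooth families on manifolds and their permanence properties -/

section Manifold

variable {ι κ : Type*} (E : Type*) [NormedAddCommGroup E] [NormedSpace ℝ E]
  {M : Type*} [TopologicalSpace M] [ChartedSpace E M]

/-- Near `x`, the functions `f i` are the components of a smooth map into bounded families. -/
def SmoothFamilyAt (f : ι → M → ℂ) (x : M) : Prop :=
  ∃ Φ : M → LInf ι ℂ, ContMDiffAt 𝓘(ℝ, E) 𝓘(ℝ, LInf ι ℂ) ∞ Φ x ∧ ∀ᶠ y in 𝓝 x, ∀ i, Φ y i = f i y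

namespace SmoothFamilyAt

variable {E} {f g : ι → M → ℂ} {x : M}

theorem congr (h : SmoothFamilyAt E f x) (hg : ∀ᶠ y in 𝓝 x, ∀ i, g i y = f i y) :
    SmoothFamilyAt E g x := by
  obtain ⟨Φ, hΦ, h⟩ := h
  refine ⟨Φ, hΦ, ?_⟩
  filter_upwards [h, hg] with y h1 h2 i
  rw [h1, h2]

theorem clm (h : SmoothFamilyAt E f x) (L : LInf ι ℂ →L[ℝ] LInf κ ℂ) (g : κ → M → ℂ)
    (hg : ∀ᶠ y in 𝓝 x, ∀ φ : LInf ι ℂ, (∀ i, φ i = f i y) → ∀ k, L φ k = g k y) :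
    SmoothFamilyAt E g x := by
  obtain ⟨Φ, hΦ, h⟩ := h
  refine ⟨fun y => L (Φ y), L.contMDiff.contMDiffAt.comp x hΦ, ?_⟩
  filter_upwards [h, hg] with y h1 h2 k
  exact h2 _ h1 k

theorem reindex (h : SmoothFamilyAt E f x) (σ : κ → ι) :
    SmoothFamilyAt E (fun k => f (σ k)) x :=
  h.clm (LInf.reindex σ) _ (Eventually.of_forall fun y φ hφ k => by simp [hφ])

theorem contMDiffAt (h : SmoothFamilyAt E f x) (i : ι) :
    ContMDiffAt 𝓘(ℝ, E) 𝓘(ℝ, ℂ) ∞ (f i) x := by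
  obtain ⟨Φ, hΦ, h⟩ := h
  refine ContMDiffAt.congr_of_eventuallyEq
    ((LInf.eval (V := ℂ) i).contMDiff.contMDiffAt.comp x hΦ) ?_
  filter_upwards [h] with y hy
  exact (hy i).symm

theorem exists_bound (h : SmoothFamilyAt E f x) : ∃ C, 0 ≤ C ∧ ∀ i, ‖f i x‖ ≤ C := by
  obtain ⟨Φ, -, h⟩ := h
  refine ⟨‖Φ x‖, norm_nonneg _, fun i => ?_⟩
  rw [← h.self_of_nhds i]
  exact LInf.norm_apply_le _ _

theorem const {f : M → ℂ} (hf : ContMDiffAt 𝓘(ℝ, E) 𝓘(ℝ, ℂ) ∞ f x) :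
    SmoothFamilyAt E (fun _ : ι => f) x := by
  let L : ℂ →L[ℝ] LInf ι ℂ := LinearMap.mkContinuous
    ⟨⟨fun c => LInf.mk (fun _ => c) ‖c‖ fun _ => le_rfl, fun _ _ => rfl⟩, fun _ _ => rfl⟩ 1
    fun c => by
      rw [one_mul]
      exact LInf.norm_le (norm_nonneg _) fun _ => le_rfl
  exact ⟨fun y => L (f y), L.contMDiff.contMDiffAt.comp x hf, Eventually.of_forall fun y i => rfl⟩

theorem bounded_const {c : ι → ℂ} {C : ℝ} (hc : ∀ i, ‖c i‖ ≤ C) (x : M) :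
    SmoothFamilyAt E (fun i (_ : M) => c i) x :=
  ⟨fun _ => LInf.mk c C hc, contMDiffAt_const, Eventually.of_forall fun _ _ => rfl⟩

theorem add (hf : SmoothFamilyAt E f x) (hg : SmoothFamilyAt E g x) :
    SmoothFamilyAt E (fun i y => f i y + g i y) x := by
  obtain ⟨Φ, hΦ, hf⟩ := hf
  obtain ⟨Ψ, hΨ, hg⟩ := hg
  refine ⟨fun y => Φ y + Ψ y, ContMDiffAt.add hΦ hΨ, ?_⟩
  filter_upwards [hf, hg] with y h1 h2 i
  rw [lp.coeFn_add, Pi.add_apply, h1, h2]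

/-- Bounded families form a normed algebra, whose multiplication is smooth. -/
theorem mul (hf : SmoothFamilyAt E f x) (hg : SmoothFamilyAt E g x) :
    SmoothFamilyAt E (fun i y => f i y * g i y) x := by
  obtain ⟨Φ, hΦ, hf⟩ := hf
  obtain ⟨Ψ, hΨ, hg⟩ := hg
  refine ⟨fun y => Φ y * Ψ y, ?_, ?_⟩
  · exact (contDiff_mul (𝕜 := ℝ) (𝔸 := LInf ι ℂ)).contMDiff.contMDiffAt.comp x
      (hΦ.prodMk_space hΨ)
  · filter_upwards [hf, hg] with y h1 h2 i
    rw [lp.infty_coeFn_mul, Pi.mul_apply, h1, h2]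

theorem sum {α : Type*} {F : α → ι → M → ℂ} (s : Finset α) (h : ∀ a ∈ s, SmoothFamilyAt E (F a) x) :
    SmoothFamilyAt E (fun i y => ∑ a ∈ s, F a i y) x := by
  classical
  induction s using Finset.induction_on with
  | empty => simpa using SmoothFamilyAt.const (ι := ι) (contMDiffAt_const (c := (0 : ℂ)))
  | insert a s ha ih =>
    simp only [Finset.sum_insert ha]
    exact (h a (by simp)).add (ih fun b hb => h b (by simp [hb]))

theorem comp {E' : Type*} [NormedAddCommGroup E'] [NormedSpace ℝ E'] {N : Type*}
    [TopologicalSpace N] [ChartedSpace E' N] {φ : N → M} {y : N} (h : SmoothFamilyAt E f (φ y))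
    (hφ : ContMDiffAt 𝓘(ℝ, E') 𝓘(ℝ, E) ∞ φ y) :
    SmoothFamilyAt E' (fun i z => f i (φ z)) y := by
  obtain ⟨Φ, hΦ, h⟩ := h
  exact ⟨fun z => Φ (φ z), hΦ.comp y hφ, hφ.continuousAt.eventually h⟩

/-- Uniformly bounded `ℓ¹`-combinations of a smooth family form a smooth family. -/
theorem tsum (h : SmoothFamilyAt E f x) (c : κ → ι → ℂ) {C : ℝ}
    (hc : ∀ k, Summable fun i => ‖c k i‖) (hC : ∀ k, ∑' i, ‖c k i‖ ≤ C) :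
    SmoothFamilyAt E (fun k y => ∑' i, c k i * f i y) x := by
  have hle : ∀ (φ : LInf ι ℂ) k i, ‖c k i * φ i‖ ≤ ‖c k i‖ * ‖φ‖ := fun φ k i => by
    rw [norm_mul]
    exact mul_le_mul_of_nonneg_left (LInf.norm_apply_le φ i) (norm_nonneg _)
  have hs : ∀ (φ : LInf ι ℂ) k, Summable fun i => ‖c k i * φ i‖ := fun φ k =>
    Summable.of_nonneg_of_le (fun _ => norm_nonneg _) (hle φ k) ((hc k).mul_right _)
  have hb : ∀ (φ : LInf ι ℂ) k, ‖∑' i, c k i * φ i‖ ≤ |C| * ‖φ‖ := fun φ k => by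
    refine (norm_tsum_le_tsum_norm (hs φ k)).trans ?_
    refine ((hs φ k).tsum_le_tsum (hle φ k) ((hc k).mul_right _)).trans ?_
    rw [tsum_mul_right]
    exact mul_le_mul_of_nonneg_right ((hC k).trans (le_abs_self C)) (norm_nonneg _)
  -- A matrix with rows in a ball of `ℓ¹` is a bounded operator between `ℓ^∞` spaces, so it
  -- preserves smoothness.
  let L : LInf ι ℂ →L[ℝ] LInf κ ℂ := LinearMap.mkContinuous
    ⟨⟨fun φ => LInf.mk (fun k => ∑' i, c k i * φ i) (|C| * ‖φ‖) (hb φ),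
      fun φ ψ => lp.ext (funext fun k => by
        change ∑' i, c k i * (φ i + ψ i) = ∑' i, c k i * φ i + ∑' i, c k i * ψ i
        rw [← (hs φ k).of_norm.tsum_add (hs ψ k).of_norm]
        exact tsum_congr fun i => mul_add _ _ _)⟩,
      fun a φ => lp.ext (funext fun k => by
        change ∑' i, c k i * (a • φ i) = a • ∑' i, c k i * φ i
        rw [← tsum_const_smul'']
        exact tsum_congr fun i => mul_smul_comm _ _ _)⟩ |C| fun φ =>
      LInf.norm_le (by positivity) (hb φ)
  exact h.clm L _ (Eventually.of_forall fun y φ hφ k => tsum_congr fun i => by rw [hφ])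

end SmoothFamilyAt

end Manifold

end ConvMorita

namespace ConvMorita

open scoped Topology
open Filter

/-! ### The precompact bornology on `C_c^∞(M)` -/

section PrecompactBornology

/-- Derivatives at a point take values in this finite-dimensional space, so bounded sets of
derivatives are totally bounded there. -/
theorem properSpace_continuousMultilinearMap (E : Type*) [NormedAddCommGroup E] [NormedSpace ℝ E]
    [FiniteDimensional ℝ E] (k : ℕ) : ProperSpace (E [×k]→L[ℝ] ℂ) := by
  have : FiniteDimensional ℝ (E [×k]→L[ℝ] ℂ) :=
    FiniteDimensional.of_injective
      (ContinuousMultilinearMap.toMultilinearMapLinear (R' := ℝ) (A := ℝ)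
        (M₁ := fun _ : Fin k => E) (M₂ := ℂ))
      ContinuousMultilinearMap.toMultilinearMap_injective
  exact FiniteDimensional.proper ℝ _

variable {ι : Type*} {E : Type*} [NormedAddCommGroup E] [NormedSpace ℝ E]
  {M : Type*} [TopologicalSpace M] [ChartedSpace E M]

namespace Cc

variable {f g : Cc E M}

@[ext] theorem ext (h : ∀ x, f x = g x) : f = g := Subtype.ext (funext h)

theorem add_apply (f g : Cc E M) (x : M) : (f + g) x = f x + g x := rfl
theorem smul_apply (c : ℂ) (f : Cc E M) (x : M) : (c • f) x = c * f x := rfl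

theorem contMDiff (f : Cc E M) : ContMDiff 𝓘(ℝ, E) 𝓘(ℝ, ℂ) ∞ f := f.2.1

theorem contDiffAt_comp_symm [IsManifold 𝓘(ℝ, E) ∞ M] (f : Cc E M)
    {e : OpenPartialHomeomorph M E} (he : e ∈ IsManifold.maximalAtlas 𝓘(ℝ, E) ∞ M) {y : E}
    (hy : y ∈ e.target) : ContDiffAt ℝ ∞ (fun z => f (e.symm z)) y :=
  (f.contMDiff.contMDiffAt.comp y ((contMDiffOn_symm_of_mem_maximalAtlas he).contMDiffAt
    (e.open_target.mem_nhds hy))).contDiffAt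

theorem isBounded_iff_isPrecompactIn {S : Set (Cc E M)} :
    Bornology.IsBounded S ↔ ∃ K : Set M, IsCompact K ∧ IsPrecompactIn K S :=
  Bornology.isBounded_ofBounded_iff _

/-- Precompactness yields local bounds on all derivatives: on a compact ball in a chart each member
of `S` is within `1`, up to order `k`, of one of finitely many functions.
`LocallyBoundedDerivs.contDiffOn` turns these bounds into a smooth map to bounded families. -/
theorem smoothFamilyAt_of_isPrecompactIn {E : Type*} [NormedAddCommGroup E] [NormedSpace ℝ E]
    [FiniteDimensional ℝ E] {M : Type*} [TopologicalSpace M] [ChartedSpace E M]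
    [IsManifold 𝓘(ℝ, E) ∞ M] {K : Set M} {S : Set (Cc E M)} (hS : IsPrecompactIn K S) (x : M) :
    SmoothFamilyAt E (fun (f : S) y => f.1 y) x := by
  set e := chartAt E x with he
  have he' : e ∈ IsManifold.maximalAtlas 𝓘(ℝ, E) ∞ M := IsManifold.chart_mem_maximalAtlas x
  have hx : x ∈ e.source := mem_chart_source E x
  have hb : LocallyBoundedDerivs (fun (f : S) z => f.1 (e.symm z)) e.target := by
    refine ⟨fun f z hz => (f.1.contDiffAt_comp_symm he' hz).contDiffWithinAt, fun k y hy => ?_⟩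
    have := FiniteDimensional.proper ℝ E
    obtain ⟨r, hr, hrt⟩ := Metric.nhds_basis_closedBall.mem_iff.1 (e.open_target.mem_nhds hy)
    obtain ⟨T, hT, -, hcov⟩ := hS.2 {(e, Metric.closedBall y r)} (finite_singleton _)
      (by rintro q rfl; exact ⟨he', isCompact_closedBall y r, hrt⟩) k 1 one_pos
    have hbT : ∀ᶠ z in 𝓝 y, ∀ g ∈ T, ‖iteratedFDeriv ℝ k (fun w => g (e.symm w)) z‖ <
        ‖iteratedFDeriv ℝ k (fun w => g (e.symm w)) y‖ + 1 := by
      rw [eventually_all_finite hT]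
      intro g _
      have hc := ((g.contDiffAt_comp_symm he' hy).continuousAt_iteratedFDeriv (k := k)
        (by exact_mod_cast le_top)).norm
      exact hc.eventually (gt_mem_nhds (lt_add_one _))
    obtain ⟨C, hC⟩ := (hT.image fun g => ‖iteratedFDeriv ℝ k (fun w => g (e.symm w)) y‖).bddAbove
    refine ⟨1 + (C + 1), ?_⟩
    filter_upwards [hbT, Metric.closedBall_mem_nhds y hr] with z hz hzr f
    obtain ⟨g, hg, hfg⟩ := hcov f.1 f.2
    have h1 := hfg _ rfl k le_rfl z hzr
    have hzt := hrt hzr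
    have h2 : iteratedFDeriv ℝ k (fun w => (f.1 - g) (e.symm w)) z =
        iteratedFDeriv ℝ k (fun w => f.1 (e.symm w)) z -
        iteratedFDeriv ℝ k (fun w => g (e.symm w)) z :=
      iteratedFDeriv_sub_apply ((f.1.contDiffAt_comp_symm he' hzt).of_le (by exact_mod_cast le_top))
        ((g.contDiffAt_comp_symm he' hzt).of_le (by exact_mod_cast le_top))
    dsimp only at h1
    rw [h2] at h1
    have h3 := hC ⟨g, hg, rfl⟩
    dsimp only at h3
    calc ‖iteratedFDeriv ℝ k (fun w => f.1 (e.symm w)) z‖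
        = ‖(iteratedFDeriv ℝ k (fun w => f.1 (e.symm w)) z -
          iteratedFDeriv ℝ k (fun w => g (e.symm w)) z) +
          iteratedFDeriv ℝ k (fun w => g (e.symm w)) z‖ := by rw [sub_add_cancel]
      _ ≤ 1 + (C + 1) := (norm_add_le _ _).trans
          (add_le_add h1 ((hz g hg).le.trans (by linarith)))
  refine ⟨fun y => LInf.ofFamily (fun (f : S) z => f.1 (e.symm z)) (e y), ?_, ?_⟩
  · have h1 : ContMDiffAt 𝓘(ℝ, E) 𝓘(ℝ, LInf S ℂ) ∞
        (LInf.ofFamily (fun (f : S) z => f.1 (e.symm z))) (e x) :=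
      ((hb.contDiffOn e.open_target).contDiffAt
        (e.open_target.mem_nhds (e.map_source hx))).contMDiffAt
    exact h1.comp x (contMDiffAt_of_mem_maximalAtlas he' hx)
  · have h1 := (e.continuousAt hx).eventually (hb.ofFamily_eventually (e.map_source hx))
    filter_upwards [h1, e.open_source.mem_nhds hx] with y hy hys f
    rw [hy, e.left_inv hys]

/-- A family with smooth dependence into bounded families has, on a compact subset of a chart, a
finite subfamily approximating it up to order `n`. -/
theorem isPrecompactIn_range [FiniteDimensional ℝ E] [IsManifold 𝓘(ℝ, E) ∞ M] {K : Set M}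
    {f : ι → Cc E M} (hK : ∀ i, tsupport (f i) ⊆ K)
    (hf : ∀ x, SmoothFamilyAt E (fun i y => f i y) x) : IsPrecompactIn K (range f) := by
  refine ⟨by rintro _ ⟨i, rfl⟩; exact hK i, fun F hF hF' n ε hε => ?_⟩
  have hproper := properSpace_continuousMultilinearMap E
  -- the map into bounded families in a chart
  let Ψ : OpenPartialHomeomorph M E → E → LInf ι ℂ := fun e =>
    LInf.ofFamily fun i z => f i (e.symm z)
  have hΨ : ∀ q ∈ F, ∀ y ∈ q.1.target, ContDiffAt ℝ ∞ (Ψ q.1) y ∧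
      ∀ᶠ z in 𝓝 y, ∀ i, Ψ q.1 z i = f i (q.1.symm z) := by
    intro q hq y hy
    obtain ⟨Φ, hΦ, h⟩ := (hf (q.1.symm y)).comp
      ((contMDiffOn_symm_of_mem_maximalAtlas (hF' q hq).1).contMDiffAt
        (q.1.open_target.mem_nhds hy))
    have heq : ∀ᶠ z in 𝓝 y, ∀ i, Ψ q.1 z i = f i (q.1.symm z) := by
      filter_upwards [h] with z hz
      refine fun i => LInf.ofFamily_apply (C := ‖Φ z‖) (fun i => ?_) i
      rw [← hz]
      exact LInf.norm_apply_le _ _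
    refine ⟨hΦ.contDiffAt.congr_of_eventuallyEq ?_, heq⟩
    filter_upwards [h, heq] with z h1 h2
    exact lp.ext (funext fun i => by rw [h1, h2])
  -- The derivatives of all components come from the derivative of one map `Ψ`. Its continuity will
  -- thus control all indices at once.
  have hcomp : ∀ q ∈ F, ∀ y ∈ q.1.target, ∀ (k : ℕ) i,
      iteratedFDeriv ℝ k (fun z => f i (q.1.symm z)) y =
        (LInf.eval i).compContinuousMultilinearMap (iteratedFDeriv ℝ k (Ψ q.1) y) := by
    intro q hq y hy k i
    obtain ⟨h1, h2⟩ := hΨ q hq y hy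
    rw [← (LInf.eval (V := ℂ) i).iteratedFDeriv_comp_left h1 (by exact_mod_cast le_top)]
    refine (Filter.EventuallyEq.iteratedFDeriv ℝ ?_ k).self_of_nhds
    filter_upwards [h2] with z hz
    exact (hz i).symm
  have hnorm : ∀ (k : ℕ) (i : ι) (a : E [×k]→L[ℝ] LInf ι ℂ),
      ‖(LInf.eval (V := ℂ) i).compContinuousMultilinearMap a‖ ≤ ‖a‖ := fun k i a => by
    refine ((LInf.eval (V := ℂ) i).norm_compContinuousMultilinearMap_le a).trans ?_
    exact mul_le_of_le_one_left (norm_nonneg _) (LInf.norm_eval_le i)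
  -- finitely many sample points
  have hsample : ∀ q ∈ F, ∀ k : ℕ, ∃ t ⊆ q.2, t.Finite ∧ ∀ y ∈ q.2, ∃ y' ∈ t,
      ‖iteratedFDeriv ℝ k (Ψ q.1) y - iteratedFDeriv ℝ k (Ψ q.1) y'‖ < ε / 3 := by
    intro q hq k
    have hc : ContinuousOn (iteratedFDeriv ℝ k (Ψ q.1)) q.2 := fun y hy =>
      ((hΨ q hq y ((hF' q hq).2.2 hy)).1.continuousAt_iteratedFDeriv
        (by exact_mod_cast le_top)).continuousWithinAt
    obtain ⟨t, ht, htf, htc⟩ := ((hF' q hq).2.1.image_of_continuousOn hc).finite_cover_balls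
      (show 0 < ε / 3 by positivity)
    obtain ⟨t', ht', htf', htc'⟩ := exists_subset_image_finite_and (p := fun t =>
      iteratedFDeriv ℝ k (Ψ q.1) '' q.2 ⊆ ⋃ x ∈ t, Metric.ball x (ε / 3)) |>.1 ⟨t, ht, htf, htc⟩
    refine ⟨t', ht', htf', fun y hy => ?_⟩
    obtain ⟨_, ⟨y', hy', rfl⟩, hyy⟩ := mem_iUnion₂.1 (htc' ⟨y, hy, rfl⟩)
    exact ⟨y', hy', by rwa [← dist_eq_norm]⟩
  choose! t ht htf htc using hsample
  let J : Set ((OpenPartialHomeomorph M E × Set E) × ℕ × E) :=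
    ⋃ q ∈ F, ⋃ k ∈ Iic n, (fun y => (q, k, y)) '' t q k
  have hJ : J.Finite := hF.biUnion fun q hq => (finite_Iic n).biUnion fun k _ =>
    (htf q hq k).image _
  have := hJ.fintype
  -- The derivatives of `f i` at the finitely many sample points. The range of `ev` is bounded in a
  -- finite product of proper spaces, hence totally bounded, and a finite net of it selects the
  -- approximating functions.
  let ev : ι → (j : J) → (E [×(j.1.2.1)]→L[ℝ] ℂ) := fun i j =>
    iteratedFDeriv ℝ j.1.2.1 (fun z => f i (j.1.1.1.symm z)) j.1.2.2
  have hJF : ∀ j : J, j.1.1 ∈ F ∧ j.1.2.2 ∈ j.1.1.1.target := by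
    rintro ⟨j, hj⟩
    simp only [J, mem_iUnion, mem_image] at hj
    obtain ⟨q, hq, k, hk, y, hy, rfl⟩ := hj
    exact ⟨hq, (hF' q hq).2.2 (ht q hq k hy)⟩
  have hbdd : Bornology.IsBounded (range ev) := by
    refine (Metric.isBounded_iff_subset_closedBall 0).2
      ⟨∑ j : J, ‖iteratedFDeriv ℝ j.1.2.1 (Ψ j.1.1.1) j.1.2.2‖, ?_⟩
    rintro _ ⟨i, rfl⟩
    rw [mem_closedBall_zero_iff, pi_norm_le_iff_of_nonneg (by positivity)]
    intro j
    change ‖iteratedFDeriv ℝ j.1.2.1 (fun z => f i (j.1.1.1.symm z)) j.1.2.2‖ ≤ _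
    rw [hcomp j.1.1 (hJF j).1 _ (hJF j).2]
    refine (hnorm _ _ _).trans ?_
    exact Finset.single_le_sum (f := fun j : J => ‖iteratedFDeriv ℝ j.1.2.1 (Ψ j.1.1.1) j.1.2.2‖)
      (fun j _ => norm_nonneg _) (Finset.mem_univ j)
  have htb : TotallyBounded (range ev) :=
    (hbdd.isCompact_closure.totallyBounded).subset subset_closure
  obtain ⟨T, hT, hTf, hTc⟩ := Metric.finite_approx_of_totallyBounded htb (ε / 3) (by positivity)
  obtain ⟨I, -, hIf, rfl⟩ := exists_subset_image_finite_and.1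
    ⟨T, image_univ (f := ev) ▸ hT, hTf, rfl⟩
  refine ⟨f '' I, hIf.image _, by rintro _ ⟨i, -, rfl⟩; exact hK i, ?_⟩
  rintro _ ⟨i, rfl⟩
  obtain ⟨_, ⟨i', hi', rfl⟩, hii⟩ := mem_iUnion₂.1 (hTc ⟨i, rfl⟩)
  refine ⟨f i', ⟨i', hi', rfl⟩, fun q hq k hk y hy => ?_⟩
  have hyt := (hF' q hq).2.2 hy
  have h2 : iteratedFDeriv ℝ k (fun w => (f i - f i') (q.1.symm w)) y =
      iteratedFDeriv ℝ k (fun w => f i (q.1.symm w)) y -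
      iteratedFDeriv ℝ k (fun w => f i' (q.1.symm w)) y :=
    iteratedFDeriv_sub_apply
      (((f i).contDiffAt_comp_symm (hF' q hq).1 hyt).of_le (by exact_mod_cast le_top))
      (((f i').contDiffAt_comp_symm (hF' q hq).1 hyt).of_le (by exact_mod_cast le_top))
  obtain ⟨y', hy', hyy⟩ := htc q hq k y hy
  have hyt' := (hF' q hq).2.2 (ht q hq k hy')
  have hj : (q, k, y') ∈ J := by
    simp only [J, mem_iUnion, mem_image]
    exact ⟨q, hq, k, hk, y', hy', rfl⟩
  have h3 : ‖iteratedFDeriv ℝ k (fun z => f i (q.1.symm z)) y' -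
      iteratedFDeriv ℝ k (fun z => f i' (q.1.symm z)) y'‖ < ε / 3 := by
    have := (dist_le_pi_dist (ev i) (ev i') ⟨_, hj⟩).trans_lt hii
    rwa [dist_eq_norm] at this
  -- Moving from `y` to its sample point costs less than `ε / 3` uniformly in `i`, since evaluation
  -- at an index has norm at most one. With `h3` at the sample point the three errors add up to `ε`.
  have h4 : ∀ i, ‖iteratedFDeriv ℝ k (fun z => f i (q.1.symm z)) y -
      iteratedFDeriv ℝ k (fun z => f i (q.1.symm z)) y'‖ < ε / 3 := by
    intro i
    rw [hcomp q hq y hyt, hcomp q hq y' hyt',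
      show ∀ a b : E [×k]→L[ℝ] LInf ι ℂ, (LInf.eval (V := ℂ) i).compContinuousMultilinearMap a -
        (LInf.eval (V := ℂ) i).compContinuousMultilinearMap b =
        (LInf.eval (V := ℂ) i).compContinuousMultilinearMap (a - b) from fun a b => by
          ext v; simp]
    exact (hnorm _ _ _).trans_lt hyy
  rw [h2]
  have h5 := h4 i'
  rw [norm_sub_rev] at h5
  refine le_of_lt ?_
  calc _ = ‖(iteratedFDeriv ℝ k (fun z => f i (q.1.symm z)) y -
          iteratedFDeriv ℝ k (fun z => f i (q.1.symm z)) y') +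
        (iteratedFDeriv ℝ k (fun z => f i (q.1.symm z)) y' -
          iteratedFDeriv ℝ k (fun z => f i' (q.1.symm z)) y') +
        (iteratedFDeriv ℝ k (fun z => f i' (q.1.symm z)) y' -
          iteratedFDeriv ℝ k (fun z => f i' (q.1.symm z)) y)‖ := by congr 1; abel
    _ < ε / 3 + ε / 3 + ε / 3 :=
        (norm_add₃_le).trans_lt (add_lt_add (add_lt_add (h4 i) h3) h5)
    _ = ε := by ring

theorem isBounded_range [FiniteDimensional ℝ E] [IsManifold 𝓘(ℝ, E) ∞ M] [T2Space M]
    {f : ι → Cc E M} {K : Set M} (hK : IsCompact K) (hK' : ∀ i, ∀ x ∉ K, f i x = 0)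
    (hf : ∀ x, SmoothFamilyAt E (fun i y => f i y) x) : Bornology.IsBounded (range f) := by
  refine isBounded_iff_isPrecompactIn.2 ⟨K, hK, isPrecompactIn_range (fun i => ?_) hf⟩
  refine closure_minimal (fun x hx => ?_) hK.isClosed
  by_contra h
  exact hx (hK' i x h)

end Cc

/-! ### Completeness of the precompact bornology -/

section Complete

variable {E : Type*} [NormedAddCommGroup E] [NormedSpace ℝ E] [FiniteDimensional ℝ E]
  {M : Type u} [TopologicalSpace M] [ChartedSpace E M] [IsManifold 𝓘(ℝ, E) ∞ M]

namespace Cc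

/-- Together with `isBounded_of_smoothFamily` this is the working description of bounded sets:
common compact support and smooth dependence. Boundedness of the operations below is checked through
it. -/
theorem smoothFamily_of_isBounded {S : Set (Cc E M)} (hS : Bornology.IsBounded S) :
    ∃ K : Set M, IsCompact K ∧ (∀ f ∈ S, ∀ x ∉ K, f x = 0) ∧
      ∀ x, SmoothFamilyAt E (fun (f : S) y => f.1 y) x := by
  obtain ⟨K, hK, hKS⟩ := isBounded_iff_isPrecompactIn.1 hS
  exact ⟨K, hK, fun f hf x hx => image_eq_zero_of_notMem_tsupport fun h => hx (hKS.1 f hf h),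
    smoothFamilyAt_of_isPrecompactIn hKS⟩

variable [T2Space M]

theorem isBounded_of_smoothFamily {κ : Type*} {S : Set (Cc E M)} (f : κ → Cc E M)
    (hS : ∀ g ∈ S, ∃ k, f k = g) {K : Set M} (hK : IsCompact K) (hK' : ∀ i, ∀ x ∉ K, f i x = 0)
    (hf : ∀ x, SmoothFamilyAt E (fun i y => f i y) x) : Bornology.IsBounded S :=
  (isBounded_range hK hK' hf).subset hS

variable (E M) in
theorem isVectorBornology : IsVectorBornology (Cc E M) := by
  refine ⟨fun S hS => ?_, fun c S hS => ?_, fun S T hS hT => ?_⟩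
  · obtain ⟨K, hK, hK', h⟩ := smoothFamily_of_isBounded hS
    refine isBounded_of_smoothFamily
      (f := fun p : {a : ℂ // ‖a‖ ≤ 1} × S => p.1.1 • p.2.1) ?_ hK (fun p x hx => ?_) fun x => ?_
    · rintro _ ⟨a, ha, v, hv, rfl⟩
      exact ⟨(⟨a, ha⟩, ⟨v, hv⟩), rfl⟩
    · rw [smul_apply, hK' _ p.2.2 x hx, mul_zero]
    · exact (SmoothFamilyAt.bounded_const (fun p : {a : ℂ // ‖a‖ ≤ 1} × S => p.1.2) x).mul
        ((h x).reindex fun p : {a : ℂ // ‖a‖ ≤ 1} × S => p.2)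
  · obtain ⟨K, hK, hK', h⟩ := smoothFamily_of_isBounded hS
    refine isBounded_of_smoothFamily (f := fun p : S => c • p.1) ?_ hK (fun p x hx => ?_) fun x => ?_
    · rintro _ ⟨v, hv, rfl⟩
      exact ⟨⟨v, hv⟩, rfl⟩
    · rw [smul_apply, hK' _ p.2 x hx, mul_zero]
    · exact (SmoothFamilyAt.bounded_const (fun p : S => le_refl ‖c‖) x).mul (h x)
  · obtain ⟨K, hK, hK', h⟩ := smoothFamily_of_isBounded hS
    obtain ⟨L, hL, hL', h'⟩ := smoothFamily_of_isBounded hT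
    refine isBounded_of_smoothFamily (f := fun p : S × T => p.1.1 + p.2.1) ?_ (hK.union hL)
      (fun p x hx => ?_) fun x => ?_
    · rintro _ ⟨v, hv, w, hw, rfl⟩
      exact ⟨(⟨v, hv⟩, ⟨w, hw⟩), rfl⟩
    · rw [add_apply, hK' _ p.1.2 x fun h => hx (Or.inl h), hL' _ p.2.2 x fun h => hx (Or.inr h),
        add_zero]
    · exact ((h x).reindex fun p : S × T => p.1).add ((h' x).reindex fun p : S × T => p.2)

variable (E M) in
-- Values at a point are bounded on `S`, so `f = ε s` with `s ∈ S` for every `ε` forces `f x = 0`.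
theorem isSeparated : IsSeparatedBVS (Cc E M) := by
  intro S hS f hf
  obtain ⟨K, -, -, h⟩ := smoothFamily_of_isBounded hS
  ext x
  obtain ⟨C, hC0, hC⟩ := (h x).exists_bound
  refine norm_le_zero_iff.1 (le_of_forall_pos_le_add fun δ hδ => ?_)
  obtain ⟨s, hs, rfl⟩ := hf (δ / (C + 1)) (by positivity)
  rw [smul_apply, norm_mul, Complex.norm_real, Real.norm_of_nonneg (by positivity), zero_add]
  refine (mul_le_mul_of_nonneg_left ((hC ⟨s, hs⟩).trans (lt_add_one C).le)
    (by positivity)).trans_eq ?_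
  field_simp

end Cc

/-- Sums of uniformly bounded `ℓ¹`-combinations. -/
theorem smoothFamily_tsum {Y : Type*} [Bornology Y] {f : Y → Cc E M}
    (hf : IsBoundedMap f) {B : Set Y} (hB : Bornology.IsBounded B) (R : ℝ) :
    ∃ K : Set M, IsCompact K ∧
      (∀ c : FreeBVS Y, Function.support (FreeBVS.coeff c) ⊆ B →
        (∀ x ∉ K, ∑' y, FreeBVS.coeff c y * f y x = 0) ∧
        ∀ x, Summable fun y => FreeBVS.coeff c y * f y x) ∧
      ∀ x, SmoothFamilyAt E (fun (c : {c : FreeBVS Y // Function.support (FreeBVS.coeff c) ⊆ B ∧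
        ∑' y, ‖FreeBVS.coeff c y‖ ≤ R}) z => ∑' y, FreeBVS.coeff c.1 y * f y z) x := by
  obtain ⟨K, hK, hK', h⟩ := Cc.smoothFamily_of_isBounded (hf B hB)
  have h' : ∀ x, SmoothFamilyAt E (fun (y : B) z => f y z) x := fun x =>
    (h x).reindex fun y : B => ⟨f y, ⟨y, y.2, rfl⟩⟩
  refine ⟨K, hK, fun c hc => ⟨fun x hx => ?_, fun x => ?_⟩, fun x => ?_⟩
  · rw [← tsum_zero (α := ℂ) (β := Y)]
    refine tsum_congr fun y => ?_
    by_cases hy : FreeBVS.coeff c y = 0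
    · rw [hy, zero_mul]
    · rw [hK' _ ⟨y, hc hy, rfl⟩ x hx, mul_zero]
  · obtain ⟨C, -, hC⟩ := (h' x).exists_bound
    refine Summable.of_norm_bounded ((FreeBVS.summable_norm c).mul_right C) fun y => ?_
    rw [norm_mul]
    by_cases hy : FreeBVS.coeff c y = 0
    · rw [hy, norm_zero, zero_mul, zero_mul]
    · exact mul_le_mul_of_nonneg_left (hC ⟨y, hc hy⟩) (norm_nonneg _)
  · refine ((h' x).tsum (κ := {c : FreeBVS Y // Function.support (FreeBVS.coeff c) ⊆ B ∧
      ∑' y, ‖FreeBVS.coeff c y‖ ≤ R}) (C := R) (fun c y => FreeBVS.coeff c.1 y)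
      (fun c => (FreeBVS.summable_norm c.1).subtype B) fun c => ?_).congr
      (Eventually.of_forall fun z c => ?_)
    · rw [tsum_subtype_eq_of_support_subset (f := fun y => ‖FreeBVS.coeff c.1 y‖)]
      · exact c.2.2
      · intro y hy
        exact c.2.1 fun h0 => hy (by simp [h0])
    · rw [tsum_subtype_eq_of_support_subset (f := fun y => FreeBVS.coeff c.1 y * f y z)]
      intro y hy
      exact c.2.1 fun h0 => hy (by simp [h0])

variable [T2Space M]

namespace Cc

variable (E M) in
-- The extension is the pointwise sum `c ↦ ∑ c(y) f(y)`. Smoothness of each sum and boundedness of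
-- the map are both instances of `smoothFamily_tsum`.
theorem hasFreeExtension : HasFreeExtension.{u} (Cc E M) := by
  intro Y _ f hf
  have hsum : ∀ (c : FreeBVS Y) x, Summable fun y => FreeBVS.coeff c y * f y x := fun c x => by
    obtain ⟨K, -, h, -⟩ := smoothFamily_tsum hf (FreeBVS.isBounded_support c) 0
    exact (h c subset_rfl).2 x
  have hmem : ∀ c : FreeBVS Y, (fun x => ∑' y, FreeBVS.coeff c y * f y x) ∈ ccSubmodule E M := by
    intro c
    obtain ⟨K, hK, h, h'⟩ := smoothFamily_tsum hf (FreeBVS.isBounded_support c)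
      (∑' y, ‖FreeBVS.coeff c y‖)
    exact ⟨fun x => (h' x).contMDiffAt ⟨c, subset_rfl, le_rfl⟩,
      HasCompactSupport.intro hK (h c subset_rfl).1⟩
  let g : FreeBVS Y →ₗ[ℂ] Cc E M :=
    { toFun := fun c => ⟨_, hmem c⟩
      map_add' := fun c d => by
        ext x
        change ∑' y, FreeBVS.coeff (c + d) y * f y x =
          ∑' y, FreeBVS.coeff c y * f y x + ∑' y, FreeBVS.coeff d y * f y x
        rw [← (hsum c x).tsum_add (hsum d x)]
        exact tsum_congr fun y => add_mul _ _ _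
      map_smul' := fun a c => by
        ext x
        change ∑' y, FreeBVS.coeff (a • c) y * f y x = a * ∑' y, FreeBVS.coeff c y * f y x
        rw [← tsum_mul_left]
        exact tsum_congr fun y => mul_assoc _ _ _ }
  refine ⟨g, fun S hS => ?_, fun y => ?_⟩
  · obtain ⟨B, R, hB, hSB⟩ := FreeBVS.isBounded_iff.1 hS
    obtain ⟨K, hK, h, h'⟩ := smoothFamily_tsum hf hB R
    refine isBounded_of_smoothFamily (fun c : {c : FreeBVS Y // Function.support
      (FreeBVS.coeff c) ⊆ B ∧ ∑' y, ‖FreeBVS.coeff c y‖ ≤ R} => g c.1) ?_ hK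
      (fun c x hx => (h c.1 c.2.1).1 x hx) h'
    rintro _ ⟨c, hc, rfl⟩
    exact ⟨⟨c, hSB c hc⟩, rfl⟩
  · ext x
    change ∑' z, FreeBVS.coeff (FreeBVS.of y) z * f z x = f y x
    rw [tsum_eq_single y]
    · simp [FreeBVS.coeff_of]
    · intro z hz
      simp [FreeBVS.coeff_of, hz]

variable (E M) in
theorem isCompleteBVS : IsCompleteBVS (Cc E M) :=
  isCompleteBVS_of_hasFreeExtension (isVectorBornology E M) (isSeparated E M)
    (hasFreeExtension E M)

end Cc

end Complete

end PrecompactBornology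

end ConvMorita

namespace ConvMorita

open scoped Topology
open Filter

/-! ### Groupoids divided into pieces, and convolution -/

section Pieces

variable {I : Type*} (Q : I → I → Type u) (Z : I → Type u)

/-- A groupoid whose objects are the disjoint union of the `Z i`, and whose arrows from `Z j` to
`Z i` form `Q i j`. The product of `q` and `r` is meaningful if `s q = t r`. -/
structure GroupoidPieces where
  s : ∀ {i j}, Q i j → Z j
  t : ∀ {i j}, Q i j → Z i
  mul : ∀ {i j k}, Q i j → Q j k → Q i k
  inv : ∀ {i j}, Q i j → Q j i
  s_mul : ∀ {i j k} (q : Q i j) (r : Q j k), s q = t r → s (mul q r) = s r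
  t_mul : ∀ {i j k} (q : Q i j) (r : Q j k), s q = t r → t (mul q r) = t q
  s_inv : ∀ {i j} (q : Q i j), s (inv q) = t q
  t_inv : ∀ {i j} (q : Q i j), t (inv q) = s q
  inv_inv : ∀ {i j} (q : Q i j), inv (inv q) = q
  mul_assoc : ∀ {i j k l} (q : Q i j) (r : Q j k) (p : Q k l), s q = t r → s r = t p →
    mul (mul q r) p = mul q (mul r p)
  inv_mul_cancel_left : ∀ {i j k} (q : Q i j) (r : Q j k), s q = t r → mul (inv q) (mul q r) = r
  mul_inv_cancel_right : ∀ {i j k} (q : Q i j) (r : Q j k), s q = t r → mul (mul q r) (inv r) = q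

namespace GroupoidPieces

variable {Q Z} (𝓠 : GroupoidPieces Q Z) {i j k l : I}

theorem mul_inv_cancel_left (q : Q i j) (r : Q i k) (h : 𝓠.t q = 𝓠.t r) :
    𝓠.mul q (𝓠.mul (𝓠.inv q) r) = r := by
  have := 𝓠.inv_mul_cancel_left (𝓠.inv q) r (by rw [𝓠.s_inv, h])
  rwa [𝓠.inv_inv] at this

theorem t_div (q : Q i j) (r : Q i k) (h : 𝓠.t q = 𝓠.t r) : 𝓠.t (𝓠.mul (𝓠.inv q) r) = 𝓠.s q := by
  rw [𝓠.t_mul _ _ (by rw [𝓠.s_inv, h]), 𝓠.t_inv]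

/-- Units are not part of the structure, so this is derived from associativity and the cancellation
laws alone. -/
theorem mul_inv_rev (q : Q i j) (r : Q j k) (h : 𝓠.s q = 𝓠.t r) :
    𝓠.inv (𝓠.mul q r) = 𝓠.mul (𝓠.inv r) (𝓠.inv q) := by
  have h1 : 𝓠.s (𝓠.inv r) = 𝓠.t (𝓠.inv q) := by rw [𝓠.s_inv, 𝓠.t_inv, h]
  have h2 : 𝓠.s (𝓠.mul q r) = 𝓠.t (𝓠.mul (𝓠.inv r) (𝓠.inv q)) := by
    rw [𝓠.s_mul _ _ h, 𝓠.t_mul _ _ h1, 𝓠.t_inv]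
  have h3 : 𝓠.s (𝓠.inv (𝓠.mul q r)) = 𝓠.t q := by rw [𝓠.s_inv, 𝓠.t_mul _ _ h]
  rw [← 𝓠.inv_mul_cancel_left (𝓠.mul q r) _ h2,
    𝓠.mul_assoc q r _ h (by rw [𝓠.t_mul _ _ h1, 𝓠.t_inv]),
    𝓠.mul_inv_cancel_left r _ (by rw [𝓠.t_inv, h]), ← 𝓠.mul_assoc _ _ _ h3 (𝓠.t_inv q).symm,
    𝓠.mul_inv_cancel_right _ _ h3]

/-- Convolution: `(a * b)(γ) = ∑_{t q = t γ} a(q) b(q⁻¹ γ)`. -/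
def conv (a : Q i j → ℂ) (b : Q j k → ℂ) (γ : Q i k) : ℂ :=
  ∑ᶠ q ∈ {q | 𝓠.t q = 𝓠.t γ}, a q * b (𝓠.mul (𝓠.inv q) γ)

/-- The involution `f ↦ (q ↦ f(q⁻¹))`. -/
def star (a : Q i j → ℂ) (q : Q j i) : ℂ := a (𝓠.inv q)

/-- The function has finite support on the fibres of `t`. -/
def FiniteOnFibers (a : Q i j → ℂ) : Prop := ∀ z, {q | 𝓠.t q = z ∧ a q ≠ 0}.Finite

variable {𝓠}

theorem star_star (a : Q i j → ℂ) : 𝓠.star (𝓠.star a) = a :=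
  funext fun q => congrArg a (𝓠.inv_inv q)

theorem FiniteOnFibers.finite_inter {a : Q i j → ℂ} (ha : 𝓠.FiniteOnFibers a) (z : Z i)
    (f : Q i j → ℂ) : ({q | 𝓠.t q = z} ∩ Function.support fun q => a q * f q).Finite :=
  (ha z).subset fun _ hq => ⟨hq.1, left_ne_zero_of_mul hq.2⟩

theorem conv_add_left {a a' : Q i j → ℂ} (ha : 𝓠.FiniteOnFibers a) (ha' : 𝓠.FiniteOnFibers a')
    (b : Q j k → ℂ) : 𝓠.conv (a + a') b = 𝓠.conv a b + 𝓠.conv a' b := by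
  funext γ
  simp only [conv, Pi.add_apply, add_mul]
  exact finsum_mem_add_distrib' (ha.finite_inter _ _) (ha'.finite_inter _ _)

theorem conv_add_right {a : Q i j → ℂ} (ha : 𝓠.FiniteOnFibers a) (b b' : Q j k → ℂ) :
    𝓠.conv a (b + b') = 𝓠.conv a b + 𝓠.conv a b' := by
  funext γ
  simp only [conv, Pi.add_apply, mul_add]
  exact finsum_mem_add_distrib' (ha.finite_inter _ _) (ha.finite_inter _ _)

theorem conv_smul_left (c : ℂ) (a : Q i j → ℂ) (b : Q j k → ℂ) :
    𝓠.conv (c • a) b = c • 𝓠.conv a b := by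
  funext γ
  simp only [conv, Pi.smul_apply, smul_eq_mul, _root_.mul_assoc]
  rw [← smul_eq_mul, smul_finsum]
  refine finsum_congr fun q => ?_
  rw [smul_finsum]
  rfl

theorem conv_smul_right (c : ℂ) (a : Q i j → ℂ) (b : Q j k → ℂ) :
    𝓠.conv a (c • b) = c • 𝓠.conv a b := by
  rw [← conv_smul_left]
  funext γ
  simp only [conv, Pi.smul_apply, smul_eq_mul]
  exact finsum_congr fun q => finsum_congr fun _ => by ring

variable (𝓠) in
-- Left translation by `q⁻¹`, with inverse left translation by `q`: the change of variables used for
-- associativity and for the involution.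
theorem bijOn_div (q : Q i j) :
    BijOn (fun r : Q i k => 𝓠.mul (𝓠.inv q) r) {r | 𝓠.t r = 𝓠.t q} {r | 𝓠.t r = 𝓠.s q} := by
  refine ⟨fun r hr => 𝓠.t_div q r hr.symm, fun r hr r' hr' h => ?_, fun r hr => ?_⟩
  · rw [← 𝓠.mul_inv_cancel_left q r hr.symm, ← 𝓠.mul_inv_cancel_left q r' hr'.symm]
    exact congrArg (𝓠.mul q) h
  · exact ⟨𝓠.mul q r, 𝓠.t_mul q r hr.symm, 𝓠.inv_mul_cancel_left q r hr.symm⟩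

/-- Two sums are interchanged and `r` is replaced by `q⁻¹ r`. Finiteness of `a` and `b` on fibres
suffices for the interchange; `c` may be arbitrary. -/
theorem conv_assoc {a : Q i j → ℂ} {b : Q j k → ℂ} (ha : 𝓠.FiniteOnFibers a)
    (hb : 𝓠.FiniteOnFibers b) (c : Q k l → ℂ) :
    𝓠.conv (𝓠.conv a b) c = 𝓠.conv a (𝓠.conv b c) := by
  classical
  funext γ
  set S := (ha (𝓠.t γ)).toFinset with hS
  have hmem : ∀ q, q ∈ S ↔ 𝓠.t q = 𝓠.t γ ∧ a q ≠ 0 := fun q => by simp [hS]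
  have hsum : ∀ f : Q i j → ℂ, ∑ᶠ q ∈ {q | 𝓠.t q = 𝓠.t γ}, a q * f q = ∑ q ∈ S, a q * f q := by
    intro f
    refine finsum_mem_eq_sum_of_inter_support_eq _ ?_
    ext q
    simp only [mem_inter_iff, mem_ofPred_eq, Function.mem_support, Finset.mem_coe, hmem]
    constructor
    · rintro ⟨h1, h2⟩
      exact ⟨⟨h1, left_ne_zero_of_mul h2⟩, h2⟩
    · rintro ⟨⟨h1, -⟩, h2⟩
      exact ⟨h1, h2⟩
  -- For fixed `q`, the contributing `r` are the translates `q r'` of the finitely many `r'` in the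
  -- fibre over `s q` with `b r' ≠ 0`.
  have hfin : ∀ q ∈ S, (Function.support ({r : Q i k | 𝓠.t r = 𝓠.t γ}.indicator fun r =>
      a q * (b (𝓠.mul (𝓠.inv q) r) * c (𝓠.mul (𝓠.inv r) γ)))).Finite := by
    intro q hq
    refine ((hb (𝓠.s q)).image fun r => 𝓠.mul q r).subset fun r hr => ?_
    have hr1 : 𝓠.t r = 𝓠.t γ := by
      by_contra h
      exact hr (indicator_of_notMem (s := {r : Q i k | 𝓠.t r = 𝓠.t γ}) h _)
    have hqr : 𝓠.t q = 𝓠.t r := ((hmem q).1 hq).1.trans hr1.symm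
    rw [Function.mem_support, indicator_of_mem (by exact hr1)] at hr
    exact ⟨_, ⟨𝓠.t_div q r hqr, left_ne_zero_of_mul (right_ne_zero_of_mul hr)⟩,
      𝓠.mul_inv_cancel_left q r hqr⟩
  trans ∑ q ∈ S, ∑ᶠ r, {r : Q i k | 𝓠.t r = 𝓠.t γ}.indicator (fun r =>
      a q * (b (𝓠.mul (𝓠.inv q) r) * c (𝓠.mul (𝓠.inv r) γ))) r
  · rw [← finsum_sum_comm S _ hfin, conv, finsum_mem_def]
    refine finsum_congr fun r => ?_
    by_cases hr : r ∈ {r : Q i k | 𝓠.t r = 𝓠.t γ}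
    · simp only [indicator_of_mem hr]
      rw [conv, show 𝓠.t r = 𝓠.t γ from hr, hsum, Finset.sum_mul]
      exact Finset.sum_congr rfl fun q _ => _root_.mul_assoc _ _ _
    · simp only [indicator_of_notMem hr, Finset.sum_const_zero]
  · rw [conv, hsum]
    refine Finset.sum_congr rfl fun q hq => ?_
    have hq' := ((hmem q).1 hq).1
    rw [← finsum_mem_def, conv, 𝓠.t_div q γ hq', ← smul_eq_mul, smul_finsum]
    -- The substitution `r ↦ q⁻¹ r`, under which `r⁻¹ γ` becomes `(q⁻¹ r)⁻¹ (q⁻¹ γ)`.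
    have := finsum_mem_eq_of_bijOn (s := {r : Q i k | 𝓠.t r = 𝓠.t q})
      (t := {r : Q j k | 𝓠.t r = 𝓠.s q}) (f := fun r : Q i k =>
        a q * (b (𝓠.mul (𝓠.inv q) r) * c (𝓠.mul (𝓠.inv r) γ)))
      (g := fun r : Q j k => a q * (b r * c (𝓠.mul (𝓠.inv r) (𝓠.mul (𝓠.inv q) γ)))) _
      (𝓠.bijOn_div q) (by
        intro r hr
        have hqr : 𝓠.t q = 𝓠.t r := Eq.symm hr
        have hrγ : 𝓠.t r = 𝓠.t γ := hqr.symm.trans hq'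
        rw [𝓠.mul_inv_rev _ _ (by rw [𝓠.s_inv, hqr]), 𝓠.inv_inv,
          𝓠.mul_assoc _ _ _ (by rw [𝓠.s_inv, hqr]) (by rw [𝓠.t_div _ _ hq']),
          𝓠.mul_inv_cancel_left _ _ hq'])
    rw [hq'] at this
    rw [this]
    exact finsum_congr fun r => by rw [smul_finsum]; rfl

theorem star_conv (a : Q i j → ℂ) (b : Q j k → ℂ) :
    𝓠.star (𝓠.conv a b) = 𝓠.conv (𝓠.star b) (𝓠.star a) := by
  funext γ
  symm
  rw [star, conv, conv]
  refine finsum_mem_eq_of_bijOn (fun q => 𝓠.mul (𝓠.inv γ) q) ?_ fun q hq => ?_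
  · rw [𝓠.t_inv]
    exact 𝓠.bijOn_div γ
  · have hq' : 𝓠.t γ = 𝓠.t q := Eq.symm hq
    rw [star, star, 𝓠.mul_inv_rev _ _ (by rw [𝓠.s_inv, hq']),
      𝓠.mul_inv_rev _ _ (by rw [𝓠.s_inv, hq']), 𝓠.inv_inv, 𝓠.inv_inv,
      𝓠.mul_inv_cancel_right _ _ (by rw [𝓠.s_inv, hq']), mul_comm]

/-- In the double sum over `q` and `q'` the factor `x(q) y(q'⁻¹)` is nonzero only if `q'⁻¹ = q`,
because `s` separates the supports. The argument of `r` then collapses to `q q⁻¹ γ = γ`, leaving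
multiplication by a function on the base. -/
theorem conv_conv_star {x y : Q i j → ℂ}
    (hxy : ∀ q q', x q ≠ 0 → y q' ≠ 0 → 𝓠.s q = 𝓠.s q' → q = q') (r : Q i k → ℂ) (γ : Q i k) :
    𝓠.conv x (𝓠.conv (𝓠.star y) r) γ =
      (∑ᶠ q ∈ {q | 𝓠.t q = 𝓠.t γ}, x q * y q) * r γ := by
  rw [conv, mul_comm, ← smul_eq_mul, smul_finsum]
  refine finsum_congr fun q => ?_
  rw [smul_finsum]
  refine finsum_congr fun hq => ?_
  have hq' : 𝓠.t q = 𝓠.t γ := hq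
  rcases eq_or_ne (x q) 0 with h0 | h0
  · simp [h0]
  · rw [conv, finsum_mem_inter_support_eq' _ _ {𝓠.inv q}, finsum_mem_singleton, 𝓠.inv_inv,
      𝓠.mul_inv_cancel_left q γ hq', star, 𝓠.inv_inv]
    · simp only [smul_eq_mul]
      ring
    · intro q' h'
      rw [mem_ofPred_eq, 𝓠.t_div q γ hq', mem_singleton_iff]
      constructor
      · intro ht
        have := hxy q (𝓠.inv q') h0 (left_ne_zero_of_mul h') (by rw [𝓠.s_inv, ht])
        rw [this, 𝓠.inv_inv]
      · rintro rfl
        exact 𝓠.t_inv q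

/-- The involution reduces this to the left-hand version with `x` and `y` exchanged. The target of
`γ⁻¹` is the source of `γ`, so the same function on the base appears. -/
theorem conv_conv_star_right {x y : Q i j → ℂ}
    (hxy : ∀ q q', x q ≠ 0 → y q' ≠ 0 → 𝓠.s q = 𝓠.s q' → q = q') (r : Q k i → ℂ) (γ : Q k i) :
    𝓠.conv (𝓠.conv r x) (𝓠.star y) γ =
      (∑ᶠ q ∈ {q | 𝓠.t q = 𝓠.s γ}, x q * y q) * r γ := by
  have h : 𝓠.conv (𝓠.conv r x) (𝓠.star y) =
      𝓠.star (𝓠.conv y (𝓠.conv (𝓠.star x) (𝓠.star r))) := by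
    rw [star_conv, star_conv, star_star, star_star]
  rw [h, star, conv_conv_star fun q q' h1 h2 h3 => (hxy q' q h2 h1 h3.symm).symm, 𝓠.t_inv, star,
    𝓠.inv_inv]
  simp only [mul_comm]

end GroupoidPieces

/-- Bornological spaces of functions on the pieces of a groupoid which are closed under
convolution. -/
structure ConvolutionSpaces (𝓠 : GroupoidPieces Q Z) [∀ i, TopologicalSpace (Z i)]
    (R : I → I → Type u) [∀ i j, AddCommGroup (R i j)] [∀ i j, Module ℂ (R i j)]
    [∀ i j, Bornology (R i j)] where
  complete : ∀ i j, IsCompleteBVS (R i j)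
  freeExtension : ∀ i j, HasFreeExtension.{u} (R i j)
  eval : ∀ i j, R i j →ₗ[ℂ] (Q i j → ℂ)
  eval_injective : ∀ i j, Function.Injective (eval i j)
  finiteOnFibers : ∀ i j r, 𝓠.FiniteOnFibers (eval i j r)
  exists_conv : ∀ i j k a b, ∃ c, eval i k c = 𝓠.conv (eval i j a) (eval j k b)
  bounded_conv : ∀ i j k S T, Bornology.IsBounded S → Bornology.IsBounded T →
    Bornology.IsBounded {c | ∃ a ∈ S, ∃ b ∈ T, eval i k c = 𝓠.conv (eval i j a) (eval j k b)}
  compact_t : ∀ i j (S : Set (R i j)), Bornology.IsBounded S →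
    ∃ C : Set (Z i), IsCompact C ∧ ∀ r ∈ S, ∀ q, eval i j r q ≠ 0 → 𝓠.t q ∈ C
  compact_s : ∀ i j (S : Set (R i j)), Bornology.IsBounded S →
    ∃ C : Set (Z j), IsCompact C ∧ ∀ r ∈ S, ∀ q, eval i j r q ≠ 0 → 𝓠.s q ∈ C

/-- Locally finite families of functions with supports on which `s` is injective, whose products
sum up to `1` on the fibres of `t`. -/
structure LocalSections {𝓠 : GroupoidPieces Q Z} [∀ i, TopologicalSpace (Z i)]
    {R : I → I → Type u} [∀ i j, AddCommGroup (R i j)] [∀ i j, Module ℂ (R i j)]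
    [∀ i j, Bornology (R i j)] (𝓢 : ConvolutionSpaces Q Z 𝓠 R) (i j : I) where
  ι : Type u
  x : ι → R i j
  y : ι → R j i
  injective : ∀ n q q', 𝓢.eval i j (x n) q ≠ 0 → 𝓢.eval j i (y n) (𝓠.inv q') ≠ 0 →
    𝓠.s q = 𝓠.s q' → q = q'
  finite : ∀ C : Set (Z i), IsCompact C → ∃ J : Finset ι, ∀ n ∉ J, ∀ q, 𝓠.t q ∈ C →
    𝓢.eval i j (x n) q = 0 ∧ 𝓢.eval j i (y n) (𝓠.inv q) = 0
  sum : ∀ z, ∑ᶠ n, ∑ᶠ q ∈ {q | 𝓠.t q = z}, 𝓢.eval i j (x n) q * 𝓢.eval j i (y n) (𝓠.inv q) = 1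

namespace ConvolutionSpaces

variable {Q Z} {𝓠 : GroupoidPieces Q Z} [∀ i, TopologicalSpace (Z i)]
    {R : I → I → Type u} [∀ i j, AddCommGroup (R i j)] [∀ i j, Module ℂ (R i j)]
    [∀ i j, Bornology (R i j)] (𝓢 : ConvolutionSpaces Q Z 𝓠 R) {i j k : I}

/-- The convolution of two elements. -/
def convElem (a : R i j) (b : R j k) : R i k := (𝓢.exists_conv i j k a b).choose

theorem eval_convElem (a : R i j) (b : R j k) :
    𝓢.eval i k (𝓢.convElem a b) = 𝓠.conv (𝓢.eval i j a) (𝓢.eval j k b) :=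
  (𝓢.exists_conv i j k a b).choose_spec

/-- The convolution product. -/
def mul (i j k : I) : R i j →ₗ[ℂ] R j k →ₗ[ℂ] R i k :=
  LinearMap.mk₂ ℂ 𝓢.convElem
    (fun a a' b => 𝓢.eval_injective i k (by
      rw [map_add, eval_convElem, eval_convElem, eval_convElem, map_add,
        GroupoidPieces.conv_add_left (𝓢.finiteOnFibers i j a) (𝓢.finiteOnFibers i j a')]))
    (fun c a b => 𝓢.eval_injective i k (by
      rw [map_smul, eval_convElem, eval_convElem, map_smul, GroupoidPieces.conv_smul_left]))
    (fun a b b' => 𝓢.eval_injective i k (by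
      rw [map_add, eval_convElem, eval_convElem, eval_convElem, map_add,
        GroupoidPieces.conv_add_right (𝓢.finiteOnFibers i j a)]))
    (fun c a b => 𝓢.eval_injective i k (by
      rw [map_smul, eval_convElem, eval_convElem, map_smul, GroupoidPieces.conv_smul_right]))

theorem eval_mul (a : R i j) (b : R j k) :
    𝓢.eval i k (𝓢.mul i j k a b) = 𝓠.conv (𝓢.eval i j a) (𝓢.eval j k b) :=
  𝓢.eval_convElem a b

/-- The bornological algebroid given by convolution. -/
def algebroid : BornAlgebroid R where
  complete := 𝓢.complete
  freeExtension := 𝓢.freeExtension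
  mul := 𝓢.mul
  mul_assoc {i j k l} a b c := 𝓢.eval_injective i l (by
    simp only [eval_mul]
    exact GroupoidPieces.conv_assoc (𝓢.finiteOnFibers i j a) (𝓢.finiteOnFibers j k b) _)
  bounded i j k S T hS hT := (𝓢.bounded_conv i j k S T hS hT).subset (by
    rintro _ ⟨a, ha, b, hb, rfl⟩
    exact ⟨a, ha, b, hb, 𝓢.eval_mul a b⟩)

variable {𝓢}

theorem eval_mul_mul_left (D : LocalSections Q Z 𝓢 i j) (n : D.ι) (r : R i k) (γ : Q i k) :
    𝓢.eval i k (𝓢.mul i j k (D.x n) (𝓢.mul j i k (D.y n) r)) γ =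
      (∑ᶠ q ∈ {q | 𝓠.t q = 𝓠.t γ}, 𝓢.eval i j (D.x n) q * 𝓢.eval j i (D.y n) (𝓠.inv q)) *
        𝓢.eval i k r γ := by
  rw [eval_mul, eval_mul]
  have := GroupoidPieces.conv_conv_star (𝓠 := 𝓠) (x := 𝓢.eval i j (D.x n))
    (y := 𝓠.star (𝓢.eval j i (D.y n))) (D.injective n) (𝓢.eval i k r) γ
  rwa [GroupoidPieces.star_star] at this

theorem eval_mul_mul_right (D : LocalSections Q Z 𝓢 i j) (n : D.ι) (r : R k i) (γ : Q k i) :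
    𝓢.eval k i (𝓢.mul k j i (𝓢.mul k i j r (D.x n)) (D.y n)) γ =
      (∑ᶠ q ∈ {q | 𝓠.t q = 𝓠.s γ}, 𝓢.eval i j (D.x n) q * 𝓢.eval j i (D.y n) (𝓠.inv q)) *
        𝓢.eval k i r γ := by
  rw [eval_mul, eval_mul]
  have := GroupoidPieces.conv_conv_star_right (𝓠 := 𝓠) (x := 𝓢.eval i j (D.x n))
    (y := 𝓠.star (𝓢.eval j i (D.y n))) (D.injective n) (𝓢.eval k i r) γ
  rwa [GroupoidPieces.star_star] at this

/-- A nonzero term `y n (q) r(q⁻¹ γ)` has `s q = t (q⁻¹ γ)` in a compact set determined by `S`, and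
only finitely many `y n` are nonzero at such `q`. -/
theorem finite_left (D : LocalSections Q Z 𝓢 i j) (k : I) (S : Set (R i k))
    (hS : Bornology.IsBounded S) :
    ∃ J : Finset D.ι, ∀ r ∈ S, ∀ n ∉ J, 𝓢.mul j i k (D.y n) r = 0 := by
  obtain ⟨C, hC, hCS⟩ := 𝓢.compact_t i k S hS
  obtain ⟨J, hJ⟩ := D.finite C hC
  refine ⟨J, fun r hr n hn => 𝓢.eval_injective j k ?_⟩
  rw [eval_mul, map_zero]
  funext γ
  refine finsum_mem_eq_zero_of_forall_eq_zero fun q hq => ?_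
  have hq' : 𝓠.t q = 𝓠.t γ := hq
  by_contra h
  have h1 := hCS r hr _ (right_ne_zero_of_mul h)
  have h2 := (hJ n hn (𝓠.inv q) (by rwa [𝓠.t_inv, ← 𝓠.t_div q γ hq'])).2
  rw [𝓠.inv_inv] at h2
  exact left_ne_zero_of_mul h h2

/-- A nonzero term `r(q) x n (q⁻¹ γ)` has `t (q⁻¹ γ) = s q` in a compact set determined by `S`. -/
theorem finite_right (D : LocalSections Q Z 𝓢 i j) (k : I) (S : Set (R k i))
    (hS : Bornology.IsBounded S) :
    ∃ J : Finset D.ι, ∀ r ∈ S, ∀ n ∉ J, 𝓢.mul k i j r (D.x n) = 0 := by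
  obtain ⟨C, hC, hCS⟩ := 𝓢.compact_s k i S hS
  obtain ⟨J, hJ⟩ := D.finite C hC
  refine ⟨J, fun r hr n hn => 𝓢.eval_injective k j ?_⟩
  rw [eval_mul, map_zero]
  funext γ
  refine finsum_mem_eq_zero_of_forall_eq_zero fun q hq => ?_
  have hq' : 𝓠.t q = 𝓠.t γ := hq
  by_contra h
  have h1 := hCS r hr _ (left_ne_zero_of_mul h)
  exact right_ne_zero_of_mul h (hJ n hn _ (by rwa [𝓠.t_div q γ hq'])).1

/-- Local sections yield a dual basis. -/
def dualBasis (D : LocalSections Q Z 𝓢 i j) : 𝓢.algebroid.DualBasis i j where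
  ι := D.ι
  x := D.x
  y := D.y
  finite_left := finite_left D
  finite_right := finite_right D
  sum_left k r := by
    have hfin : (Function.support fun n =>
        𝓢.mul i j k (D.x n) (𝓢.mul j i k (D.y n) r)).Finite := by
      obtain ⟨J, hJ⟩ := finite_left D k {r} Bornology.isBounded_singleton
      refine J.finite_toSet.subset fun n hn => ?_
      by_contra h
      exact hn (by simp only [hJ r rfl n h, map_zero])
    refine 𝓢.eval_injective i k (funext fun γ => ?_)
    have h1 := ((LinearMap.proj (R := ℂ) (φ := fun _ : Q i k => ℂ) γ).comp
      (𝓢.eval i k)).toAddMonoidHom.map_finsum hfin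
    refine h1.trans ((finsum_congr fun n => eval_mul_mul_left D n r γ).trans ?_)
    -- Each `x n * (y n * r)` is `r` times a function of `t γ`, and these functions sum to `1`.
    rw [← one_mul (𝓢.eval i k r γ)]
    conv_rhs => rw [← D.sum (𝓠.t γ)]
    rw [finsum_mul']
    · simp only [one_mul]
    · obtain ⟨J, hJ⟩ := D.finite {𝓠.t γ} isCompact_singleton
      refine J.finite_toSet.subset fun n hn => ?_
      by_contra h
      exact hn (finsum_mem_eq_zero_of_forall_eq_zero fun q hq => by rw [(hJ n h q hq).1, zero_mul])
  sum_right k r := by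
    have hfin : (Function.support fun n =>
        𝓢.mul k j i (𝓢.mul k i j r (D.x n)) (D.y n)).Finite := by
      obtain ⟨J, hJ⟩ := finite_right D k {r} Bornology.isBounded_singleton
      refine J.finite_toSet.subset fun n hn => ?_
      by_contra h
      exact hn (by simp only [hJ r rfl n h, map_zero, LinearMap.zero_apply])
    refine 𝓢.eval_injective k i (funext fun γ => ?_)
    have h1 := ((LinearMap.proj (R := ℂ) (φ := fun _ : Q k i => ℂ) γ).comp
      (𝓢.eval k i)).toAddMonoidHom.map_finsum hfin
    refine h1.trans ((finsum_congr fun n => eval_mul_mul_right D n r γ).trans ?_)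
    rw [← one_mul (𝓢.eval k i r γ)]
    conv_rhs => rw [← D.sum (𝓠.s γ)]
    rw [finsum_mul']
    · simp only [one_mul]
    · obtain ⟨J, hJ⟩ := D.finite {𝓠.s γ} isCompact_singleton
      refine J.finite_toSet.subset fun n hn => ?_
      by_contra h
      exact hn (finsum_mem_eq_zero_of_forall_eq_zero fun q hq => by rw [(hJ n h q hq).1, zero_mul])

end ConvolutionSpaces

end Pieces

end ConvMorita

namespace ConvMorita

open scoped Topology
open Filter

/-! ### Étale maps -/

section Etale

variable (A : Type*) [NormedAddCommGroup A] [NormedSpace ℝ A]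
  (B : Type*) [NormedAddCommGroup B] [NormedSpace ℝ B]
  {Q : Type*} [TopologicalSpace Q] [ChartedSpace A Q]
  {Z : Type*} [TopologicalSpace Z] [ChartedSpace B Z]

/-- A smooth map which locally has smooth inverses. The model spaces need not be the same. -/
structure IsEtale (f : Q → Z) : Prop where
  contMDiff : ContMDiff 𝓘(ℝ, A) 𝓘(ℝ, B) ∞ f
  exists_section : ∀ q, ∃ (U : Set Q) (σ : Z → Q), IsOpen U ∧ q ∈ U ∧ IsOpen (f '' U) ∧
    ContMDiffOn 𝓘(ℝ, B) 𝓘(ℝ, A) ∞ σ (f '' U) ∧ ∀ x ∈ U, σ (f x) = x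

variable {A B} {f : Q → Z}

namespace IsEtale

theorem exists_section_subset (hf : IsEtale A B f) {q : Q} {V : Set Q} (hV : V ∈ 𝓝 q) :
    ∃ (U : Set Q) (σ : Z → Q), U ⊆ V ∧ IsOpen U ∧ q ∈ U ∧ IsOpen (f '' U) ∧
      ContMDiffOn 𝓘(ℝ, B) 𝓘(ℝ, A) ∞ σ (f '' U) ∧ ∀ x ∈ U, σ (f x) = x := by
  obtain ⟨U, σ, hU, hq, hfU, hσ, h⟩ := hf.exists_section q
  obtain ⟨W, hWV, hW, hqW⟩ := mem_nhds_iff.1 hV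
  have hsub : f '' (U ∩ W) ⊆ f '' U := image_mono inter_subset_left
  refine ⟨U ∩ W, σ, inter_subset_right.trans hWV, hU.inter hW, ⟨hq, hqW⟩, ?_, hσ.mono hsub,
    fun x hx => h x hx.1⟩
  -- The section describes the shrunken image as a preimage, which keeps it open.
  have : f '' (U ∩ W) = f '' U ∩ σ ⁻¹' W := by
    ext z
    constructor
    · rintro ⟨x, hx, rfl⟩
      exact ⟨⟨x, hx.1, rfl⟩, by rw [mem_preimage, h x hx.1]; exact hx.2⟩
    · rintro ⟨⟨x, hx, rfl⟩, hz⟩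
      rw [mem_preimage, h x hx] at hz
      exact ⟨x, ⟨hx, hz⟩, rfl⟩
  rw [this]
  exact hσ.continuousOn.isOpen_inter_preimage hfU hW

theorem exists_injOn (hf : IsEtale A B f) (q : Q) : ∃ U ∈ 𝓝 q, InjOn f U := by
  obtain ⟨U, σ, hU, hq, -, -, h⟩ := hf.exists_section q
  exact ⟨U, hU.mem_nhds hq, fun x hx y hy hxy => by rw [← h x hx, ← h y hy, hxy]⟩

/-- The part of a fibre in `K` is compact and is covered by finitely many sets on which `f` is
injective, each containing at most one of its points. -/
theorem finite_fiber [T1Space Z] (hf : IsEtale A B f) {K : Set Q} (hK : IsCompact K) (z : Z) :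
    {q | q ∈ K ∧ f q = z}.Finite := by
  have hc : IsCompact (K ∩ f ⁻¹' {z}) := hK.inter_right
    (isClosed_singleton.preimage hf.contMDiff.continuous)
  choose U hU hinj using hf.exists_injOn
  obtain ⟨F, -, hF⟩ := hc.elim_nhds_subcover U fun q _ => hU q
  refine (F.finite_toSet.biUnion (t := fun q => U q ∩ f ⁻¹' {z}) fun q _ => ?_).subset
    fun q hq => ?_
  · refine Set.Subsingleton.finite fun x hx y hy => hinj q hx.1 hy.1 ?_
    exact (show f x = z from hx.2).trans (show f y = z from hy.2).symm
  · obtain ⟨i, hi, hq'⟩ := mem_iUnion₂.1 (hF (show q ∈ K ∩ f ⁻¹' {z} from hq))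
    exact mem_iUnion₂.2 ⟨i, hi, hq', hq.2⟩

end IsEtale

theorem isEtale_of_isLocalDiffeomorph {E : Type*} [NormedAddCommGroup E] [NormedSpace ℝ E]
    {Q : Type*} [TopologicalSpace Q] [ChartedSpace E Q] {Z : Type*} [TopologicalSpace Z]
    [ChartedSpace E Z] {f : Q → Z} (hf : IsLocalDiffeomorph 𝓘(ℝ, E) 𝓘(ℝ, E) ∞ f) :
    IsEtale E E f where
  contMDiff := hf.contMDiff
  exists_section q := by
    obtain ⟨Φ, hq, hΦ⟩ := hf q
    have himg : f '' Φ.source = Φ.target := by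
      rw [hΦ.image_eq]
      exact Φ.toPartialEquiv.image_source_eq_target
    refine ⟨Φ.source, Φ.invFun, Φ.open_source, hq, ?_, ?_, fun x hx => ?_⟩
    · rw [himg]
      exact Φ.open_target
    · rw [himg]
      exact Φ.contMDiffOn_invFun
    · rw [hΦ hx]
      exact Φ.left_inv hx

/-- A locally injective submersion is étale. -/
theorem isEtale_of_isSubmersion (hf : Manifold.IsSubmersion 𝓘(ℝ, A) 𝓘(ℝ, B) ∞ f)
    (hinj : ∀ q, ∃ U ∈ 𝓝 q, InjOn f U) : IsEtale A B f where
  contMDiff := hf.contMDiff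
  exists_section q := by
    have h := hf.isSubmersionAt q
    set φ := h.domChart with hφ
    set ψ := h.codChart with hψ
    have hw : ∀ y ∈ φ.target, ψ (f (φ.symm y)) = (h.equiv y).1 := fun y hy => by
      have hy' : y ∈ (h.domChart.extend 𝓘(ℝ, A)).target := by
        rw [OpenPartialHomeomorph.extend_target]
        simpa using hy
      simpa using h.writtenInCharts hy'
    have hsrc : ∀ x ∈ φ.source, f x ∈ ψ.source := fun x hx => h.source_subset_preimage_source hx
    -- A nonzero vector `c` in the complement would give a curve along which `f` is constant,
    -- contradicting local injectivity.
    have hC : Subsingleton h.complement := by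
      by_contra hC
      rw [not_subsingleton_iff_nontrivial] at hC
      obtain ⟨c, hc⟩ := exists_ne (0 : h.complement)
      obtain ⟨U, hU, hUinj⟩ := hinj q
      let γ : ℝ → A := fun τ => h.equiv.symm (h.equiv (φ q) + (0, τ • c))
      have hγ : Continuous γ := by fun_prop
      have hγ0 : γ 0 = φ q := by simp [γ]
      have hq := h.mem_domChart_source
      have h1 : ∀ᶠ τ in 𝓝 (0 : ℝ), γ τ ∈ φ.target :=
        hγ.continuousAt.eventually (by
          rw [hγ0]; exact φ.open_target.mem_nhds (φ.map_source hq))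
      have h2 : ∀ᶠ τ in 𝓝 (0 : ℝ), φ.symm (γ τ) ∈ U := by
        have : ContinuousAt (fun τ => φ.symm (γ τ)) 0 := by
          refine ContinuousAt.comp (g := φ.symm) ?_ hγ.continuousAt
          rw [hγ0]
          exact φ.continuousAt_symm (φ.map_source hq)
        refine this.eventually (?_ : ∀ᶠ y in 𝓝 (φ.symm (γ 0)), y ∈ U)
        rw [hγ0, φ.left_inv hq]
        exact hU
      obtain ⟨τ, ⟨h1, h2⟩, hτ⟩ := ((h1.and h2).filter_mono nhdsWithin_le_nhds |>.and
        self_mem_nhdsWithin : ∀ᶠ τ in 𝓝[≠] (0 : ℝ), _).exists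
      have hfeq : f (φ.symm (γ τ)) = f q := by
        refine ψ.injOn (hsrc _ (φ.map_target h1)) (hsrc _ hq) ?_
        rw [hw _ h1]
        have := hw _ (φ.map_source hq)
        rw [φ.left_inv hq] at this
        rw [this]
        simp [γ]
      have := hUinj h2 (mem_of_mem_nhds hU) hfeq
      have h3 : γ τ = φ q := by rw [← this, φ.right_inv h1]
      have h4 : h.equiv (φ q) + (0, τ • c) = h.equiv (φ q) := by
        simpa only [γ, h.equiv.apply_symm_apply] using congrArg h.equiv h3
      have h5 : τ • c = 0 := congrArg Prod.snd (add_eq_left.1 h4)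
      exact (smul_eq_zero.1 h5).elim hτ hc
    -- As the complement is trivial, filling it with `0` inverts the chart expression of `f`.
    let e : B → A := fun w => h.equiv.symm (w, 0)
    have he : ContDiff ℝ ∞ e := h.equiv.symm.contDiff.comp (contDiff_id.prodMk contDiff_const)
    have hσ : ∀ x ∈ φ.source, e (ψ (f x)) = φ x := fun x hx => by
      have := hw _ (φ.map_source hx)
      rw [φ.left_inv hx] at this
      rw [this]
      simp only [e]
      rw [h.equiv.symm_apply_eq]
      exact Prod.ext rfl (Subsingleton.elim _ _)
    have himg : f '' φ.source = ψ.source ∩ ψ ⁻¹' (e ⁻¹' φ.target) := by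
      ext z
      constructor
      · rintro ⟨x, hx, rfl⟩
        refine ⟨hsrc x hx, ?_⟩
        rw [mem_preimage, mem_preimage, hσ x hx]
        exact φ.map_source hx
      · rintro ⟨hz, hz'⟩
        refine ⟨φ.symm (e (ψ z)), φ.map_target hz', ?_⟩
        refine ψ.injOn (hsrc _ (φ.map_target hz')) hz ?_
        rw [hw _ hz']
        simp [e]
    refine ⟨φ.source, fun z => φ.symm (e (ψ z)), φ.open_source, h.mem_domChart_source, ?_, ?_, ?_⟩
    · rw [himg]
      exact ψ.isOpen_inter_preimage (φ.open_target.preimage he.continuous)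
    · rw [himg]
      refine (contMDiffOn_symm_of_mem_maximalAtlas h.domChart_mem_maximalAtlas).comp
        (t := φ.target) (he.contMDiff.comp_contMDiffOn
          ((contMDiffOn_of_mem_maximalAtlas h.codChart_mem_maximalAtlas).mono inter_subset_left))
        fun z hz => hz.2
    · intro x hx
      simp only []
      rw [hσ x hx, φ.left_inv hx]

end Etale

end ConvMorita

namespace ConvMorita

open scoped Topology
open Filter

/-! ### Sums over the fibres of étale maps -/

section Fibers

variable {A₁ A₂ A₃ B : Type*} [NormedAddCommGroup A₁] [NormedSpace ℝ A₁]
  [NormedAddCommGroup A₂] [NormedSpace ℝ A₂] [NormedAddCommGroup A₃] [NormedSpace ℝ A₃]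
  [NormedAddCommGroup B] [NormedSpace ℝ B]
  {Q₁ Q₂ Q₃ Z : Type*} [TopologicalSpace Q₁] [ChartedSpace A₁ Q₁]
  [TopologicalSpace Q₂] [ChartedSpace A₂ Q₂] [TopologicalSpace Q₃] [ChartedSpace A₃ Q₃]
  [TopologicalSpace Z] [ChartedSpace B Z] [T2Space Q₁] [T2Space Z]

/-- For `γ` near `γ₀`, the points of `K` over `τ γ` are among the values of local sections of `t`,
one for each of the finitely many points of `K` over `τ γ₀`. The sum is then a finite sum of
products of composites with smooth maps. -/
theorem IsEtale.smoothFamilyAt_finsum {ι : Type*} {t : Q₁ → Z} (ht : IsEtale A₁ B t) {τ : Q₃ → Z}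
    (hτ : ContMDiff 𝓘(ℝ, A₃) 𝓘(ℝ, B) ∞ τ) {D : Q₁ → Q₃ → Q₂}
    (hD : ContMDiffOn (𝓘(ℝ, A₁).prod 𝓘(ℝ, A₃)) 𝓘(ℝ, A₂) ∞ (fun x : Q₁ × Q₃ => D x.1 x.2)
      {x | t x.1 = τ x.2}) {a : ι → Q₁ → ℂ} {b : ι → Q₂ → ℂ} {K : Set Q₁} (hK : IsCompact K)
    (haK : ∀ i, ∀ q ∉ K, a i q = 0) (ha : ∀ q, SmoothFamilyAt A₁ a q)
    (hb : ∀ q, SmoothFamilyAt A₂ b q) (γ₀ : Q₃) :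
    SmoothFamilyAt A₃ (fun i γ => ∑ᶠ q ∈ {q | t q = τ γ}, a i q * b i (D q γ)) γ₀ := by
  classical
  have hfin := ht.finite_fiber hK (τ γ₀)
  -- The sections take values in disjoint sets, so no point of a nearby fibre is counted twice.
  obtain ⟨V, hV, hVd⟩ := hfin.t2_separation
  choose U σ hUV hU hqU hfU hσ hσs using
    fun q => ht.exists_section_subset ((hV q).2.mem_nhds (hV q).1)
  set F := hfin.toFinset with hF
  have hmem : ∀ q, q ∈ F ↔ q ∈ K ∧ t q = τ γ₀ := fun q => by simp [hF]
  have hsec : ∀ q, ∀ z ∈ t '' U q, σ q z ∈ U q ∧ t (σ q z) = z := by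
    rintro q _ ⟨x, hx, rfl⟩
    rw [hσs q x hx]
    exact ⟨hx, rfl⟩
  have hN : ∀ q ∈ F, ∀ᶠ γ in 𝓝 γ₀, τ γ ∈ t '' U q := fun q hq =>
    hτ.continuous.continuousAt.eventually
      ((hfU q).mem_nhds ⟨q, hqU q, ((hmem q).1 hq).2⟩)
  -- No further points of `K` appear nearby: the part of `K` outside the sets `U p` is compact, and
  -- its closed image misses `τ γ₀`.
  have hout : ∀ᶠ γ in 𝓝 γ₀, ∀ q ∈ K, t q = τ γ → ∃ p ∈ F, q ∈ U p := by
    have hc : IsCompact (K \ ⋃ p ∈ F, U p) := hK.diff (isOpen_biUnion fun p _ => hU p)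
    have hc' := (hc.image ht.contMDiff.continuous).isClosed.isOpen_compl
    have h0 : τ γ₀ ∈ (t '' (K \ ⋃ p ∈ F, U p))ᶜ := by
      rintro ⟨q, ⟨hq, hq'⟩, h⟩
      exact hq' (mem_iUnion₂.2 ⟨q, (hmem q).2 ⟨hq, h⟩, hqU q⟩)
    filter_upwards [hτ.continuous.continuousAt.eventually (hc'.mem_nhds h0)] with γ hγ q hq hqγ
    by_contra h
    exact hγ ⟨q, ⟨hq, fun hq' => h (by simpa using hq')⟩, hqγ⟩
  refine SmoothFamilyAt.congr
    (f := fun i γ => ∑ p ∈ F, a i (σ p (τ γ)) * b i (D (σ p (τ γ)) γ))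
    (SmoothFamilyAt.sum F fun p hp => ?_) ?_
  · have hpt := ((hmem p).1 hp).2
    have hs : ContMDiffAt 𝓘(ℝ, A₃) 𝓘(ℝ, A₁) ∞ (fun γ => σ p (τ γ)) γ₀ :=
      ((hσ p).contMDiffAt ((hfU p).mem_nhds ⟨p, hqU p, hpt⟩)).comp γ₀ hτ.contMDiffAt
    have hs0 : t (σ p (τ γ₀)) = τ γ₀ := (hsec p _ ⟨p, hqU p, hpt⟩).2
    have hd : ContMDiffAt 𝓘(ℝ, A₃) 𝓘(ℝ, A₂) ∞ (fun γ => D (σ p (τ γ)) γ) γ₀ := by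
      -- `D` is smooth only on the fibre product, so the composition is taken within the set where
      -- the section lands in it; that set is a neighbourhood of `γ₀`.
      have h1 : ContMDiffWithinAt 𝓘(ℝ, A₃) (𝓘(ℝ, A₁).prod 𝓘(ℝ, A₃)) ∞
          (fun γ => (σ p (τ γ), γ)) {γ | τ γ ∈ t '' U p} γ₀ :=
        (hs.prodMk contMDiffAt_id).contMDiffWithinAt
      have h2 := ContMDiffWithinAt.comp (f := fun γ => (σ p (τ γ), γ)) γ₀
        (hD (σ p (τ γ₀), γ₀) hs0) h1 fun γ hγ => (hsec p _ hγ).2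
      exact h2.contMDiffAt (hN p hp)
    exact ((ha _).comp hs).mul ((hb _).comp hd)
  · filter_upwards [hout, (F.eventually_all).2 hN] with γ h1 h2 i
    have hbij : BijOn (fun p => σ p (τ γ)) (F : Set Q₁) ((fun p => σ p (τ γ)) '' F) := by
      refine ⟨mapsTo_image _ _, fun p hp p' hp' h => ?_, surjOn_image _ _⟩
      by_contra hne
      refine (hVd (by simpa [hF] using hp) (by simpa [hF] using hp') hne).le_bot
        ⟨hUV p (hsec p _ (h2 p hp)).1, ?_⟩
      have := hUV p' (hsec p' _ (h2 p' hp')).1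
      rwa [show σ p (τ γ) = σ p' (τ γ) from h]
    rw [← finsum_mem_coe_finset, finsum_mem_eq_of_bijOn (g := fun q => a i q * b i (D q γ)) _ hbij
      fun p _ => rfl]
    refine finsum_mem_inter_support_eq' _ _ _ fun q hq => ?_
    have hqK : q ∈ K := by
      by_contra h
      exact hq (by simp only [haK i q h, zero_mul])
    constructor
    · intro hqγ
      obtain ⟨p, hp, hqp⟩ := h1 q hqK hqγ
      exact ⟨p, hp, by
        simp only []
        rw [← show t q = τ γ from hqγ, hσs p q hqp]⟩
    · rintro ⟨p, hp, rfl⟩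
      exact (hsec p _ (h2 p hp)).2

/-- A nonzero term exhibits `γ` as the product of `q ∈ K` and `D q γ ∈ L`. The composable pairs in
`K × L` form a closed, hence compact, subset. -/
theorem isCompact_and_finsum_eq_zero {t : Q₁ → Z} {τ : Q₃ → Z} {D : Q₁ → Q₃ → Q₂}
    {W : Type*} [TopologicalSpace W] [T2Space W] {s : Q₁ → W} {t' : Q₂ → W} (hs : Continuous s)
    (ht' : Continuous t') {m : Q₁ × Q₂ → Q₃} (hm : ContinuousOn m {x | s x.1 = t' x.2})
    (hmD : ∀ q γ, t q = τ γ → s q = t' (D q γ) ∧ m (q, D q γ) = γ)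
    {K : Set Q₁} {L : Set Q₂} (hK : IsCompact K) (hL : IsCompact L) :
    IsCompact (m '' (K ×ˢ L ∩ {x | s x.1 = t' x.2})) ∧
    ∀ (a : Q₁ → ℂ) (b : Q₂ → ℂ), (∀ q ∉ K, a q = 0) → (∀ q ∉ L, b q = 0) →
      ∀ γ ∉ m '' (K ×ˢ L ∩ {x | s x.1 = t' x.2}),
        ∑ᶠ q ∈ {q | t q = τ γ}, a q * b (D q γ) = 0 := by
  refine ⟨((hK.prod hL).inter_right (isClosed_eq (hs.comp continuous_fst)
    (ht'.comp continuous_snd))).image_of_continuousOn (hm.mono inter_subset_right), ?_⟩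
  intro a b ha hb γ hγ
  refine finsum_mem_eq_zero_of_forall_eq_zero fun q hq => ?_
  by_contra h
  have h1 : q ∈ K := by
    by_contra h'
    exact h (by rw [ha q h', zero_mul])
  have h2 : D q γ ∈ L := by
    by_contra h'
    exact h (by rw [hb _ h', mul_zero])
  obtain ⟨h3, h4⟩ := hmD q γ hq
  exact hγ ⟨(q, D q γ), ⟨⟨h1, h2⟩, h3⟩, h4⟩

end Fibers

/-! ### Existence and boundedness of convolution -/

section Convolution

variable {A₁ A₂ A₃ B : Type*} [NormedAddCommGroup A₁] [NormedSpace ℝ A₁]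
  [NormedAddCommGroup A₂] [NormedSpace ℝ A₂] [NormedAddCommGroup A₃] [NormedSpace ℝ A₃]
  [FiniteDimensional ℝ A₁] [FiniteDimensional ℝ A₂]
  [FiniteDimensional ℝ A₃] [NormedAddCommGroup B] [NormedSpace ℝ B]
  {Q₁ Q₂ Q₃ : Type u} {Z : Type*} [TopologicalSpace Q₁] [ChartedSpace A₁ Q₁]
  [TopologicalSpace Q₂] [ChartedSpace A₂ Q₂] [TopologicalSpace Q₃] [ChartedSpace A₃ Q₃]
  [IsManifold 𝓘(ℝ, A₁) ∞ Q₁] [IsManifold 𝓘(ℝ, A₂) ∞ Q₂] [IsManifold 𝓘(ℝ, A₃) ∞ Q₃]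
  [TopologicalSpace Z] [ChartedSpace B Z] [T2Space Q₁] [T2Space Q₂] [T2Space Q₃] [T2Space Z]
  {t : Q₁ → Z} {τ : Q₃ → Z} {D : Q₁ → Q₃ → Q₂}
  {W : Type*} [TopologicalSpace W] [T2Space W] {s : Q₁ → W} {t' : Q₂ → W} {m : Q₁ × Q₂ → Q₃}

/-- A common form for the eight products of the linking groupoid, with `m` the product and `D q γ =
q⁻¹ γ`. The family of all convolutions indexed by `S × T` is smooth with a common compact support;
single products are the case of singletons. -/
theorem exists_conv_and_isBounded (ht : IsEtale A₁ B t)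
    (hτ : ContMDiff 𝓘(ℝ, A₃) 𝓘(ℝ, B) ∞ τ)
    (hD : ContMDiffOn (𝓘(ℝ, A₁).prod 𝓘(ℝ, A₃)) 𝓘(ℝ, A₂) ∞ (fun x : Q₁ × Q₃ => D x.1 x.2)
      {x | t x.1 = τ x.2})
    (hs : Continuous s) (ht' : Continuous t') (hm : ContinuousOn m {x | s x.1 = t' x.2})
    (hmD : ∀ q γ, t q = τ γ → s q = t' (D q γ) ∧ m (q, D q γ) = γ) :
    (∀ (a : Cc A₁ Q₁) (b : Cc A₂ Q₂), ∃ c : Cc A₃ Q₃, ∀ γ,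
      c γ = ∑ᶠ q ∈ {q | t q = τ γ}, a q * b (D q γ)) ∧
    ∀ (S : Set (Cc A₁ Q₁)) (T : Set (Cc A₂ Q₂)), Bornology.IsBounded S → Bornology.IsBounded T →
      Bornology.IsBounded {c : Cc A₃ Q₃ | ∃ a ∈ S, ∃ b ∈ T, ∀ γ,
        c γ = ∑ᶠ q ∈ {q | t q = τ γ}, a q * b (D q γ)} := by
  have key : ∀ (S : Set (Cc A₁ Q₁)) (T : Set (Cc A₂ Q₂)), Bornology.IsBounded S →
      Bornology.IsBounded T → ∃ C : Set Q₃, IsCompact C ∧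
      (∀ (x : S × T), ∀ γ ∉ C, ∑ᶠ q ∈ {q | t q = τ γ}, x.1.1 q * x.2.1 (D q γ) = 0) ∧
      ∀ γ₀, SmoothFamilyAt A₃ (fun (x : S × T) γ =>
        ∑ᶠ q ∈ {q | t q = τ γ}, x.1.1 q * x.2.1 (D q γ)) γ₀ := by
    intro S T hS hT
    obtain ⟨K, hK, hSK, hS'⟩ := Cc.smoothFamily_of_isBounded hS
    obtain ⟨L, hL, hTL, hT'⟩ := Cc.smoothFamily_of_isBounded hT
    obtain ⟨hC, hC'⟩ := isCompact_and_finsum_eq_zero hs ht' hm hmD hK hL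
    refine ⟨_, hC, fun x => hC' x.1.1 x.2.1 (hSK _ x.1.2) (hTL _ x.2.2), ?_⟩
    exact ht.smoothFamilyAt_finsum hτ hD (a := fun (x : S × T) => x.1.1)
      (b := fun (x : S × T) => x.2.1) hK (fun x => hSK _ x.1.2)
      (fun q => (hS' q).reindex Prod.fst) fun q => (hT' q).reindex Prod.snd
  have hex : ∀ (S : Set (Cc A₁ Q₁)) (T : Set (Cc A₂ Q₂)), Bornology.IsBounded S →
      Bornology.IsBounded T → ∀ a ∈ S, ∀ b ∈ T, ∃ c : Cc A₃ Q₃, ∀ γ,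
      c γ = ∑ᶠ q ∈ {q | t q = τ γ}, a q * b (D q γ) := by
    intro S T hS hT a ha b hb
    obtain ⟨C, hC, h1, h2⟩ := key S T hS hT
    exact ⟨⟨_, fun γ => (h2 γ).contMDiffAt (⟨a, ha⟩, ⟨b, hb⟩),
      HasCompactSupport.intro hC (h1 (⟨a, ha⟩, ⟨b, hb⟩))⟩, fun γ => rfl⟩
  refine ⟨fun a b => hex {a} {b} Bornology.isBounded_singleton Bornology.isBounded_singleton
    a rfl b rfl, fun S T hS hT => ?_⟩
  obtain ⟨C, hC, h1, h2⟩ := key S T hS hT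
  choose c hc using fun x : S × T => hex S T hS hT _ x.1.2 _ x.2.2
  refine Cc.isBounded_of_smoothFamily c ?_ hC (fun x γ hγ => (hc x γ).trans (h1 x γ hγ))
    fun γ => (h2 γ).congr (Eventually.of_forall fun y x => hc x y)
  rintro g ⟨a, ha, b, hb, hg⟩
  exact ⟨(⟨a, ha⟩, ⟨b, hb⟩), Cc.ext fun γ => (hc _ γ).trans (hg γ).symm⟩

end Convolution

/-! ### Local sections -/

section Sections

variable {A B : Type*} [NormedAddCommGroup A] [NormedSpace ℝ A]
  [NormedAddCommGroup B] [NormedSpace ℝ B] {Q Z : Type*}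
  [TopologicalSpace Q] [ChartedSpace A Q] [TopologicalSpace Z] [ChartedSpace B Z]

/-- Pullback of a function along a smooth map, restricted to an open subset. -/
theorem exists_cc_pullback [T2Space Q] {t : Q → Z} (ht : ContMDiff 𝓘(ℝ, A) 𝓘(ℝ, B) ∞ t)
    {U L : Set Q} (hU : IsOpen U) (hL : IsCompact L) (hLU : L ⊆ U) {g : Z → ℂ}
    (hg : ContMDiff 𝓘(ℝ, B) 𝓘(ℝ, ℂ) ∞ g) (h : ∀ q ∈ U, g (t q) ≠ 0 → q ∈ L) :
    ∃ c : Cc A Q, (∀ q ∈ U, c q = g (t q)) ∧ ∀ q ∉ U, c q = 0 := by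
  classical
  set c : Q → ℂ := fun q => if q ∈ U then g (t q) else 0 with hc
  have h0 : ∀ q ∉ L, c q = 0 := fun q hq => by
    by_cases hqU : q ∈ U
    · rw [hc]
      simp only [if_pos hqU]
      by_contra h'
      exact hq (h q hqU h')
    · simp [hc, hqU]
  refine ⟨⟨c, fun q => ?_, HasCompactSupport.intro hL h0⟩, fun q hq => if_pos hq,
    fun q hq => if_neg hq⟩
  by_cases hq : q ∈ U
  · refine (hg.comp ht).contMDiffAt.congr_of_eventuallyEq ?_
    filter_upwards [hU.mem_nhds hq] with q' hq'
    exact if_pos hq'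
  -- Outside `U` the function vanishes near the point, since its support lies in the closed set `L ⊆
  -- U`.
  · refine (contMDiffAt_const (c := (0 : ℂ))).congr_of_eventuallyEq ?_
    filter_upwards [hL.isClosed.isOpen_compl.mem_nhds fun h' => hq (hLU h')] with q' hq'
    exact h0 q' hq'

variable [FiniteDimensional ℝ A] [FiniteDimensional ℝ B] [T2Space Q] [T2Space Z]
  [SecondCountableTopology Z] [IsManifold 𝓘(ℝ, B) ∞ Z]

/-- Functions supported in small open subsets whose products form a partition of unity. -/
theorem IsEtale.exists_local_sections {t : Q → Z} (ht : IsEtale A B t)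
    (hsurj : Function.Surjective t) {W : Type*} {s : Q → W}
    (hs : ∀ q, ∃ U ∈ 𝓝 q, InjOn s U) : ∃ x y : Z → Cc A Q,
      (∀ n q q', x n q ≠ 0 → y n q' ≠ 0 → s q = s q' → q = q') ∧
      (∀ C : Set Z, IsCompact C → ∃ J : Finset Z, ∀ n ∉ J, ∀ q, t q ∈ C →
        x n q = 0 ∧ y n q = 0) ∧
      ∀ z, ∑ᶠ n, ∑ᶠ q ∈ {q | t q = z}, x n q * y n q = 1 := by
  have : LocallyCompactSpace Q := ChartedSpace.locallyCompactSpace A Q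
  have : LocallyCompactSpace Z := ChartedSpace.locallyCompactSpace B Z
  choose q₀ hq₀ using hsurj
  choose S hS hSinj using fun z => hs (q₀ z)
  choose U σ hUS hU hqU hfU hσ hσs using fun z => ht.exists_section_subset (hS z)
  choose K hKmem hKU hK using fun z => local_compact_nhds ((hU z).mem_nhds (hqU z))
  -- Nested sets `V ⊆ K ⊆ U ⊆ S`: `s` is injective on `S`, sections live on `t(U)`, and compactness
  -- of `K` will give compact supports to functions subordinate to `t(V)`.
  choose V τ hVK hV hqV hfV _ _ using fun z => ht.exists_section_subset (hKmem z)
  obtain ⟨f, hf⟩ := SmoothPartitionOfUnity.exists_isSubordinate 𝓘(ℝ, B) (isClosed_univ (X := Z))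
    (fun z => t '' V z) hfV fun z _ => mem_iUnion.2 ⟨z, q₀ z, hqV z, hq₀ z⟩
  have hVU : ∀ z, V z ⊆ U z := fun z => (hVK z).trans (hKU z)
  have hlf : LocallyFinite fun n => Function.support (f n) := f.locallyFinite
  have hfc : ∀ n, ContMDiff 𝓘(ℝ, B) 𝓘(ℝ, ℂ) ∞ fun z => (f n z : ℂ) := fun n =>
    Complex.ofRealCLM.contMDiff.comp (f n).contMDiff
  -- Products are to add up to one, so `f n` is paired with `f n / Φ`, where `Φ` is the sum of
  -- squares and vanishes nowhere. Both factors then have controlled supports.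
  set Φ : Z → ℂ := fun z => ∑ᶠ n, (f n z : ℂ) * (f n z : ℂ) with hΦ
  have hΦc : ContMDiff 𝓘(ℝ, B) 𝓘(ℝ, ℂ) ∞ Φ := by
    refine contMDiff_finsum (fun n => ?_) (hlf.subset fun n z hz hz' => hz ?_)
    · exact (contDiff_mul (𝕜 := ℝ) (𝔸 := ℂ)).contMDiff.comp ((hfc n).prodMk_space (hfc n))
    · simp [hz']
  have hΦ0 : ∀ z, Φ z ≠ 0 := by
    intro z
    have hfin : {n | f n z ≠ 0}.Finite := hlf.point_finite z
    have h1 : ∑ᶠ n, f n z = 1 := f.sum_eq_one (mem_univ z)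
    obtain ⟨n, hn⟩ : ∃ n, f n z ≠ 0 := by
      by_contra! h
      simp [h] at h1
    have h2 : Φ z = ((∑ n ∈ hfin.toFinset, f n z * f n z : ℝ) : ℂ) := by
      rw [hΦ]
      push_cast
      refine finsum_eq_sum_of_support_subset _ fun n hn => ?_
      have : f n z ≠ 0 := fun h => hn (by simp [h])
      simpa using this
    rw [h2]
    refine Complex.ofReal_ne_zero.2 (ne_of_gt ?_)
    exact Finset.sum_pos' (fun i _ => mul_self_nonneg _)
      ⟨n, by simpa using hn, mul_self_pos.2 hn⟩
  have hΦi : ContMDiff 𝓘(ℝ, B) 𝓘(ℝ, ℂ) ∞ fun z => (Φ z)⁻¹ := fun z =>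
    ((contDiffAt_inv ℝ (hΦ0 z)).contMDiffAt (x := Φ z)).comp z hΦc.contMDiffAt
  set g : Z → Z → ℂ := fun n z => (f n z : ℂ) * (Φ z)⁻¹ with hg
  have hgc : ∀ n, ContMDiff 𝓘(ℝ, B) 𝓘(ℝ, ℂ) ∞ (g n) := fun n =>
    (contDiff_mul (𝕜 := ℝ) (𝔸 := ℂ)).contMDiff.comp ((hfc n).prodMk_space hΦi)
  -- The support of `f n` moved into `U n` by the section: a compact set outside which both
  -- pullbacks vanish.
  set L : Z → Set Q := fun n => σ n '' tsupport (f n) with hL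
  have htsub : ∀ n, tsupport (f n) ⊆ t '' U n := fun n => (hf n).trans (image_mono (hVU n))
  have hLc : ∀ n, IsCompact (L n) := fun n => by
    have : IsCompact (tsupport (f n)) :=
      ((hK n).image ht.contMDiff.continuous).of_isClosed_subset (isClosed_tsupport _)
        ((hf n).trans (image_mono (hVK n)))
    exact this.image_of_continuousOn ((hσ n).continuousOn.mono (htsub n))
  have hLU : ∀ n, L n ⊆ U n := by
    rintro n _ ⟨z, hz, rfl⟩
    obtain ⟨q, hq, rfl⟩ := htsub n hz
    rwa [hσs n q hq]
  have hLmem : ∀ n, ∀ q ∈ U n, f n (t q) ≠ 0 → q ∈ L n := fun n q hq h =>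
    ⟨t q, subset_tsupport _ h, hσs n q hq⟩
  choose x hx hx0 using fun n => exists_cc_pullback ht.contMDiff (hU n) (hLc n) (hLU n) (hgc n)
    fun q hq h => hLmem n q hq fun h' => h (by simp [hg, h'])
  choose y hy hy0 using fun n => exists_cc_pullback ht.contMDiff (hU n) (hLc n) (hLU n) (hfc n)
    fun q hq h => hLmem n q hq fun h' => h (by simp [h'])
  have hxU : ∀ n q, x n q ≠ 0 → q ∈ U n := fun n q h => by
    by_contra h'
    exact h (hx0 n q h')
  have hyU : ∀ n q, y n q ≠ 0 → q ∈ U n := fun n q h => by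
    by_contra h'
    exact h (hy0 n q h')
  refine ⟨x, y, fun n q q' h h' hqq => hSinj n (hUS n (hxU n q h)) (hUS n (hyU n q' h')) hqq,
    fun C hC => ?_, fun z => ?_⟩
  · have hfin := hlf.finite_nonempty_inter_compact hC
    refine ⟨hfin.toFinset, fun n hn q hq => ?_⟩
    have h0 : f n (t q) = 0 := by
      by_contra h
      exact hn (by simpa using ⟨t q, h, hq⟩)
    constructor
    · by_contra h
      exact h (by simp [hx n q (hxU n q h), hg, h0])
    · by_contra h
      exact h (by simp [hy n q (hyU n q h), h0])
  -- A fibre of `t` meets `U n` in at most one point, so the inner sum has at most one nonzero term.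
  · have h1 : ∀ n, ∑ᶠ q ∈ {q | t q = z}, x n q * y n q = ((f n z : ℂ) * f n z) * (Φ z)⁻¹ := by
      intro n
      by_cases h0 : f n z = 0
      · rw [h0, Complex.ofReal_zero, zero_mul, zero_mul]
        refine finsum_mem_eq_zero_of_forall_eq_zero fun q hq => ?_
        by_contra h
        have := hx n q (hxU n q (left_ne_zero_of_mul h))
        simp only [mem_ofPred_eq] at hq
        simp [hg, hq, h0] at this
        exact left_ne_zero_of_mul h this
      · obtain ⟨q, hq, rfl⟩ := htsub n (subset_tsupport _ h0)
        rw [finsum_mem_inter_support_eq' _ _ {q}, finsum_mem_singleton, hx n q hq, hy n q hq, hg]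
        · ring
        · intro q' hq'
          have hq'U := hxU n q' (left_ne_zero_of_mul hq')
          constructor
          · intro h
            rw [mem_singleton_iff, ← hσs n q hq, ← hσs n q' hq'U]
            exact congrArg (σ n) h
          · rintro rfl
            rfl
    rw [finsum_congr h1, ← finsum_mul', ← mul_inv_cancel₀ (hΦ0 z)]
    refine (hlf.point_finite z).subset fun n hn hn' => hn ?_
    simp [hn']

end Sections

end ConvMorita

namespace ConvMorita

open scoped Topology

/-! ### Algebra in groupoids and bibundles -/

section Algebra

variable {E : Type*} [NormedAddCommGroup E] [NormedSpace ℝ E]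
  {G₀ : Type*} [TopologicalSpace G₀] [ChartedSpace E G₀]
  {G₁ : Type*} [TopologicalSpace G₁] [ChartedSpace E G₁]
  {E' : Type*} [NormedAddCommGroup E'] [NormedSpace ℝ E']
  {H₀ : Type*} [TopologicalSpace H₀] [ChartedSpace E' H₀]
  {H₁ : Type*} [TopologicalSpace H₁] [ChartedSpace E' H₁]

namespace EtaleGroupoid

variable (𝓖 : EtaleGroupoid E G₀ G₁)

theorem inv_mul_cancel_left (g g' : G₁) (h : 𝓖.s g = 𝓖.t g') :
    𝓖.mul (𝓖.inv g) (𝓖.mul g g') = g' := by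
  rw [← 𝓖.mul_assoc _ _ _ (𝓖.s_inv g) h, 𝓖.inv_mul, h, 𝓖.unit_mul]

theorem mul_inv_cancel_right (g g' : G₁) (h : 𝓖.s g = 𝓖.t g') :
    𝓖.mul (𝓖.mul g g') (𝓖.inv g') = g := by
  rw [𝓖.mul_assoc _ _ _ h (𝓖.t_inv g').symm, 𝓖.mul_inv, ← h, 𝓖.mul_unit]

theorem inv_inv (g : G₁) : 𝓖.inv (𝓖.inv g) = g := by
  have h := 𝓖.inv_mul_cancel_left (𝓖.inv g) g (𝓖.s_inv g)
  rwa [𝓖.inv_mul, ← 𝓖.t_inv g, ← 𝓖.s_inv (𝓖.inv g), 𝓖.mul_unit] at h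

theorem mul_inv_rev (g g' : G₁) (h : 𝓖.s g = 𝓖.t g') :
    𝓖.inv (𝓖.mul g g') = 𝓖.mul (𝓖.inv g') (𝓖.inv g) := by
  have h1 : 𝓖.s (𝓖.inv (𝓖.mul g g')) = 𝓖.t g := by rw [𝓖.s_inv, 𝓖.t_mul g g' h]
  have h2 := 𝓖.mul_inv_cancel_right (𝓖.inv (𝓖.mul g g')) g h1
  have h3 : 𝓖.mul (𝓖.inv (𝓖.mul g g')) g = 𝓖.inv g' := by
    have := 𝓖.inv_mul_cancel_left (𝓖.mul g g') (𝓖.inv g') (by rw [𝓖.s_mul g g' h, 𝓖.t_inv])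
    rwa [𝓖.mul_inv_cancel_right g g' h] at this
  rw [← h2, h3]

theorem surjective_t : Function.Surjective 𝓖.t := fun z => ⟨𝓖.unit z, 𝓖.t_unit z⟩

end EtaleGroupoid

namespace MoritaBibundle

variable {𝓖 : EtaleGroupoid E G₀ G₁} {𝓗 : EtaleGroupoid E' H₀ H₁}
  {F : Type*} [NormedAddCommGroup F] [NormedSpace ℝ F]
  {P : Type*} [TopologicalSpace P] [ChartedSpace F P] (𝓟 : MoritaBibundle 𝓖 𝓗 F P)

/-- The arrow `g` with `g p = p'`. -/
def divL (p' p : P) : G₁ := 𝓟.principal_left.choose (p', p)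

/-- The arrow `h` with `p h = p'`. -/
def divR (p p' : P) : H₁ := 𝓟.principal_right.choose (p, p')

theorem contMDiffOn_divL : ContMDiffOn (𝓘(ℝ, F).prod 𝓘(ℝ, F)) 𝓘(ℝ, E) ∞
    (fun x : P × P => 𝓟.divL x.1 x.2) {x | 𝓟.π x.1 = 𝓟.π x.2} :=
  𝓟.principal_left.choose_spec.1

theorem contMDiffOn_divR : ContMDiffOn (𝓘(ℝ, F).prod 𝓘(ℝ, F)) 𝓘(ℝ, E') ∞
    (fun x : P × P => 𝓟.divR x.1 x.2) {x | 𝓟.ε x.1 = 𝓟.ε x.2} :=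
  𝓟.principal_right.choose_spec.1

variable {p p' p'' : P} {g g' : G₁} {h h' : H₁}

theorem s_divL (hp : 𝓟.π p' = 𝓟.π p) : 𝓖.s (𝓟.divL p' p) = 𝓟.ε p :=
  (𝓟.principal_left.choose_spec.2.1 p' p hp).1

theorem actL_divL (hp : 𝓟.π p' = 𝓟.π p) : 𝓟.actL (𝓟.divL p' p) p = p' :=
  (𝓟.principal_left.choose_spec.2.1 p' p hp).2

theorem t_divL (hp : 𝓟.π p' = 𝓟.π p) : 𝓖.t (𝓟.divL p' p) = 𝓟.ε p' := by
  rw [← 𝓟.ε_actL _ _ (𝓟.s_divL hp), 𝓟.actL_divL hp]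

/-- Freeness of the action. Identities for `divL` follow by checking that the other side carries one
point to the other. -/
theorem divL_eq (hg : 𝓖.s g = 𝓟.ε p) (h : 𝓟.actL g p = p') : 𝓟.divL p' p = g := by
  rw [← h]
  exact 𝓟.principal_left.choose_spec.2.2 g p hg

theorem t_divR (hp : 𝓟.ε p = 𝓟.ε p') : 𝓗.t (𝓟.divR p p') = 𝓟.π p :=
  (𝓟.principal_right.choose_spec.2.1 p p' hp).1.symm

theorem actR_divR (hp : 𝓟.ε p = 𝓟.ε p') : 𝓟.actR p (𝓟.divR p p') = p' :=
  (𝓟.principal_right.choose_spec.2.1 p p' hp).2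

theorem s_divR (hp : 𝓟.ε p = 𝓟.ε p') : 𝓗.s (𝓟.divR p p') = 𝓟.π p' := by
  rw [← 𝓟.π_actR _ _ (𝓟.t_divR hp).symm, 𝓟.actR_divR hp]

theorem divR_eq (hh : 𝓟.π p = 𝓗.t h) (he : 𝓟.actR p h = p') : 𝓟.divR p p' = h := by
  rw [← he]
  exact 𝓟.principal_right.choose_spec.2.2 p h hh

theorem actL_inv_actL (hg : 𝓖.s g = 𝓟.ε p) : 𝓟.actL (𝓖.inv g) (𝓟.actL g p) = p := by
  rw [← 𝓟.actL_mul _ _ _ (𝓖.s_inv g) hg, 𝓖.inv_mul, hg, 𝓟.actL_unit]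

theorem actL_actL_inv (hg : 𝓖.t g = 𝓟.ε p) : 𝓟.actL g (𝓟.actL (𝓖.inv g) p) = p := by
  have := 𝓟.actL_inv_actL (g := 𝓖.inv g) (p := p) (by rw [𝓖.s_inv, hg])
  rwa [𝓖.inv_inv] at this

theorem ε_actL_inv (hg : 𝓖.t g = 𝓟.ε p) : 𝓟.ε (𝓟.actL (𝓖.inv g) p) = 𝓖.s g := by
  rw [𝓟.ε_actL _ _ (by rw [𝓖.s_inv, hg]), 𝓖.t_inv]

theorem π_actL_inv (hg : 𝓖.t g = 𝓟.ε p) : 𝓟.π (𝓟.actL (𝓖.inv g) p) = 𝓟.π p :=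
  𝓟.π_actL _ _ (by rw [𝓖.s_inv, hg])

theorem actR_actR_inv (hh : 𝓟.π p = 𝓗.t h) : 𝓟.actR (𝓟.actR p h) (𝓗.inv h) = p := by
  rw [← 𝓟.actR_mul _ _ _ hh (𝓗.t_inv h).symm, 𝓗.mul_inv, ← hh, 𝓟.actR_unit]

theorem actR_inv_actR (hh : 𝓟.π p = 𝓗.s h) : 𝓟.actR (𝓟.actR p (𝓗.inv h)) h = p := by
  have := 𝓟.actR_actR_inv (h := 𝓗.inv h) (p := p) (by rw [𝓗.t_inv, hh])
  rwa [𝓗.inv_inv] at this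

theorem π_actR_inv (hh : 𝓟.π p = 𝓗.s h) : 𝓟.π (𝓟.actR p (𝓗.inv h)) = 𝓗.t h := by
  rw [𝓟.π_actR _ _ (by rw [𝓗.t_inv, hh]), 𝓗.s_inv]

theorem ε_actR_inv (hh : 𝓟.π p = 𝓗.s h) : 𝓟.ε (𝓟.actR p (𝓗.inv h)) = 𝓟.ε p :=
  𝓟.ε_actR _ _ (by rw [𝓗.t_inv, hh])

theorem divL_actL_left (hg : 𝓖.s g = 𝓟.ε p) (hp : 𝓟.π p = 𝓟.π p') :
    𝓟.divL (𝓟.actL g p) p' = 𝓖.mul g (𝓟.divL p p') := by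
  have h1 : 𝓖.s g = 𝓖.t (𝓟.divL p p') := by rw [𝓟.t_divL hp, hg]
  refine 𝓟.divL_eq (by rw [𝓖.s_mul _ _ h1, 𝓟.s_divL hp]) ?_
  rw [𝓟.actL_mul _ _ _ h1 (𝓟.s_divL hp), 𝓟.actL_divL hp]

theorem divL_actL_inv_right (hg : 𝓖.t g = 𝓟.ε p') (hp : 𝓟.π p = 𝓟.π p') :
    𝓟.divL p (𝓟.actL (𝓖.inv g) p') = 𝓖.mul (𝓟.divL p p') g := by
  have h1 : 𝓖.s (𝓟.divL p p') = 𝓖.t g := by rw [𝓟.s_divL hp, hg]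
  have h2 : 𝓖.s g = 𝓟.ε (𝓟.actL (𝓖.inv g) p') := (𝓟.ε_actL_inv hg).symm
  refine 𝓟.divL_eq (by rw [𝓖.s_mul _ _ h1, h2]) ?_
  rw [𝓟.actL_mul _ _ _ h1 h2, 𝓟.actL_actL_inv hg, 𝓟.actL_divL hp]

theorem divL_actR (hh : 𝓟.π p = 𝓗.t h) (hp : 𝓗.s h = 𝓟.π p') :
    𝓟.divL (𝓟.actR p h) p' = 𝓟.divL p (𝓟.actR p' (𝓗.inv h)) := by
  have h0 : 𝓟.π p = 𝓟.π (𝓟.actR p' (𝓗.inv h)) := by rw [𝓟.π_actR_inv hp.symm, hh]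
  have h1 : 𝓖.s (𝓟.divL p (𝓟.actR p' (𝓗.inv h))) = 𝓟.ε (𝓟.actR p' (𝓗.inv h)) := 𝓟.s_divL h0
  refine 𝓟.divL_eq (by rw [h1, 𝓟.ε_actR_inv hp.symm]) ?_
  have := 𝓟.act_comm _ _ h h1 (𝓟.π_actR_inv hp.symm)
  rw [𝓟.actL_divL h0, 𝓟.actR_inv_actR hp.symm] at this
  exact this.symm

theorem divR_actR_right (hp : 𝓟.ε p = 𝓟.ε p') (hh : 𝓟.π p' = 𝓗.t h) :
    𝓟.divR p (𝓟.actR p' h) = 𝓗.mul (𝓟.divR p p') h := by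
  have h1 : 𝓗.s (𝓟.divR p p') = 𝓗.t h := by rw [𝓟.s_divR hp, hh]
  refine 𝓟.divR_eq (by rw [𝓗.t_mul _ _ h1, 𝓟.t_divR hp]) ?_
  rw [𝓟.actR_mul _ _ _ (𝓟.t_divR hp).symm h1, 𝓟.actR_divR hp]

theorem divR_actR_inv_left (hh : 𝓗.s h = 𝓟.π p) (hp : 𝓟.ε p = 𝓟.ε p') :
    𝓟.divR (𝓟.actR p (𝓗.inv h)) p' = 𝓗.mul h (𝓟.divR p p') := by
  have h1 : 𝓗.s h = 𝓗.t (𝓟.divR p p') := by rw [𝓟.t_divR hp, hh]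
  have h2 := 𝓟.π_actR_inv hh.symm
  refine 𝓟.divR_eq (by rw [𝓗.t_mul _ _ h1, h2]) ?_
  rw [𝓟.actR_mul _ _ _ h2 h1, 𝓟.actR_inv_actR hh.symm, 𝓟.actR_divR hp]

theorem divR_actL_inv (hg : 𝓟.ε p = 𝓖.t g) (hp : 𝓖.s g = 𝓟.ε p') :
    𝓟.divR (𝓟.actL (𝓖.inv g) p) p' = 𝓟.divR p (𝓟.actL g p') := by
  have h0 : 𝓟.ε p = 𝓟.ε (𝓟.actL g p') := by rw [𝓟.ε_actL _ _ hp, hg]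
  have h1 := 𝓟.t_divR h0
  refine 𝓟.divR_eq (by rw [h1, 𝓟.π_actL_inv hg.symm]) ?_
  rw [𝓟.act_comm _ _ _ (by rw [𝓖.s_inv, hg]) h1.symm, 𝓟.actR_divR h0, 𝓟.actL_inv_actL hp]

/-- Both sides arise by applying the two division arrows to `p'`, and the actions commute. This is
associativity for triples taken from `P`. -/
theorem actL_divL_eq_actR_divR (hp : 𝓟.π p = 𝓟.π p') (hp' : 𝓟.ε p' = 𝓟.ε p'') :
    𝓟.actL (𝓟.divL p p') p'' = 𝓟.actR p (𝓟.divR p' p'') := by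
  have := 𝓟.act_comm _ _ _ (𝓟.s_divL hp) (𝓟.t_divR hp').symm
  rwa [𝓟.actL_divL hp, 𝓟.actR_divR hp', eq_comm] at this

theorem inv_divL (hp : 𝓟.π p = 𝓟.π p') : 𝓖.inv (𝓟.divL p p') = 𝓟.divL p' p := by
  symm
  refine 𝓟.divL_eq (by rw [𝓖.s_inv, 𝓟.t_divL hp]) ?_
  have := 𝓟.actL_inv_actL (𝓟.s_divL hp)
  rwa [𝓟.actL_divL hp] at this

theorem inv_divR (hp : 𝓟.ε p = 𝓟.ε p') : 𝓗.inv (𝓟.divR p p') = 𝓟.divR p' p := by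
  symm
  refine 𝓟.divR_eq (by rw [𝓗.t_inv, 𝓟.s_divR hp]) ?_
  have := 𝓟.actR_actR_inv (𝓟.t_divR hp).symm
  rwa [𝓟.actR_divR hp] at this

end MoritaBibundle

end Algebra

/-! ### The linking groupoid -/

section Linking

/-- The pieces of the arrows of the linking groupoid, or the spaces of functions on them. -/
abbrev LinkArrows (G P H : Type u) : Bool → Bool → Type u
  | true, true => G
  | true, false => P
  | false, true => P
  | false, false => H

/-- The pieces of the objects of the linking groupoid. -/
abbrev LinkObjects (G₀ H₀ : Type u) : Bool → Type u
  | true => G₀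
  | false => H₀

instance {A X B : Type u} [AddCommGroup A] [AddCommGroup X] [AddCommGroup B] :
    ∀ i j, AddCommGroup (LinkArrows A X B i j)
  | true, true => inferInstanceAs (AddCommGroup A)
  | true, false => inferInstanceAs (AddCommGroup X)
  | false, true => inferInstanceAs (AddCommGroup X)
  | false, false => inferInstanceAs (AddCommGroup B)

instance {A X B : Type u} [AddCommGroup A] [AddCommGroup X] [AddCommGroup B] [Module ℂ A]
    [Module ℂ X] [Module ℂ B] : ∀ i j, Module ℂ (LinkArrows A X B i j)
  | true, true => inferInstanceAs (Module ℂ A)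
  | true, false => inferInstanceAs (Module ℂ X)
  | false, true => inferInstanceAs (Module ℂ X)
  | false, false => inferInstanceAs (Module ℂ B)

instance {A X B : Type u} [Bornology A] [Bornology X] [Bornology B] :
    ∀ i j, Bornology (LinkArrows A X B i j)
  | true, true => inferInstanceAs (Bornology A)
  | true, false => inferInstanceAs (Bornology X)
  | false, true => inferInstanceAs (Bornology X)
  | false, false => inferInstanceAs (Bornology B)

instance {Z₁ Z₂ : Type u} [TopologicalSpace Z₁] [TopologicalSpace Z₂] :
    ∀ i, TopologicalSpace (LinkObjects Z₁ Z₂ i)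
  | true => inferInstanceAs (TopologicalSpace Z₁)
  | false => inferInstanceAs (TopologicalSpace Z₂)

variable {E : Type*} [NormedAddCommGroup E] [NormedSpace ℝ E]
  {G₀ : Type u} [TopologicalSpace G₀] [ChartedSpace E G₀]
  {G₁ : Type u} [TopologicalSpace G₁] [ChartedSpace E G₁]
  {E' : Type*} [NormedAddCommGroup E'] [NormedSpace ℝ E']
  {H₀ : Type u} [TopologicalSpace H₀] [ChartedSpace E' H₀]
  {H₁ : Type u} [TopologicalSpace H₁] [ChartedSpace E' H₁]
  {𝓖 : EtaleGroupoid E G₀ G₁} {𝓗 : EtaleGroupoid E' H₀ H₁}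
  {F : Type*} [NormedAddCommGroup F] [NormedSpace ℝ F]
  {P : Type u} [TopologicalSpace P] [ChartedSpace F P] (𝓟 : MoritaBibundle 𝓖 𝓗 F P)

namespace MoritaBibundle

/-- The linking groupoid of a Morita equivalence bibundle. -/
def linking : GroupoidPieces (LinkArrows G₁ P H₁) (LinkObjects G₀ H₀) where
  s {i j} := match i, j with
    | true, true => 𝓖.s
    | true, false => 𝓟.π
    | false, true => 𝓟.ε
    | false, false => 𝓗.s
  t {i j} := match i, j with
    | true, true => 𝓖.t
    | true, false => 𝓟.ε
    | false, true => 𝓟.π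
    | false, false => 𝓗.t
  -- The piece `false true` is the opposite copy of `P`, with `p · g = g⁻¹ p` and `h · p = p h⁻¹`.
  -- The two copies multiply by the division maps and are exchanged by inversion.
  mul {i j k} := match i, j, k with
    | true, true, true => 𝓖.mul
    | true, true, false => 𝓟.actL
    | true, false, true => 𝓟.divL
    | true, false, false => 𝓟.actR
    | false, true, true => fun p g => 𝓟.actL (𝓖.inv g) p
    | false, true, false => 𝓟.divR
    | false, false, true => fun h p => 𝓟.actR p (𝓗.inv h)
    | false, false, false => 𝓗.mul
  inv {i j} := match i, j with
    | true, true => 𝓖.inv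
    | true, false => id
    | false, true => id
    | false, false => 𝓗.inv
  s_mul {i j k} := match i, j, k with
    | true, true, true => 𝓖.s_mul
    | true, true, false => 𝓟.π_actL
    | true, false, true => fun _ _ h => 𝓟.s_divL h
    | true, false, false => 𝓟.π_actR
    | false, true, true => fun _ _ h => 𝓟.ε_actL_inv h.symm
    | false, true, false => fun _ _ h => 𝓟.s_divR h
    | false, false, true => fun _ _ h => 𝓟.ε_actR_inv h.symm
    | false, false, false => 𝓗.s_mul
  t_mul {i j k} := match i, j, k with
    | true, true, true => 𝓖.t_mul
    | true, true, false => 𝓟.ε_actL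
    | true, false, true => fun _ _ h => 𝓟.t_divL h
    | true, false, false => 𝓟.ε_actR
    | false, true, true => fun _ _ h => 𝓟.π_actL_inv h.symm
    | false, true, false => fun _ _ h => 𝓟.t_divR h
    | false, false, true => fun _ _ h => 𝓟.π_actR_inv h.symm
    | false, false, false => 𝓗.t_mul
  s_inv {i j} := match i, j with
    | true, true => 𝓖.s_inv
    | true, false => fun _ => rfl
    | false, true => fun _ => rfl
    | false, false => 𝓗.s_inv
  t_inv {i j} := match i, j with
    | true, true => 𝓖.t_inv
    | true, false => fun _ => rfl
    | false, true => fun _ => rfl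
    | false, false => 𝓗.t_inv
  inv_inv {i j} := match i, j with
    | true, true => 𝓖.inv_inv
    | true, false => fun _ => rfl
    | false, true => fun _ => rfl
    | false, false => 𝓗.inv_inv
  mul_assoc {i j k l} := match i, j, k, l with
    | true, true, true, true => 𝓖.mul_assoc
    | true, true, true, false => 𝓟.actL_mul
    | true, true, false, true => fun _ _ _ h h' => 𝓟.divL_actL_left h h'
    | true, true, false, false => 𝓟.act_comm
    | true, false, true, true => fun _ _ _ h h' => (𝓟.divL_actL_inv_right h'.symm h).symm
    | true, false, true, false => fun _ _ _ h h' => 𝓟.actL_divL_eq_actR_divR h h'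
    | true, false, false, true => fun _ _ _ h h' => 𝓟.divL_actR h h'
    | true, false, false, false => fun _ _ _ h h' => (𝓟.actR_mul _ _ _ h h').symm
    | false, true, true, true => fun p g g' (h : 𝓟.ε p = 𝓖.t g) (h' : 𝓖.s g = 𝓖.t g') => by
      change 𝓟.actL (𝓖.inv g') (𝓟.actL (𝓖.inv g) p) = 𝓟.actL (𝓖.inv (𝓖.mul g g')) p
      rw [𝓖.mul_inv_rev _ _ h', 𝓟.actL_mul _ _ _ (by rw [𝓖.s_inv, 𝓖.t_inv, h'])
        (by rw [𝓖.s_inv, h])]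
    | false, true, true, false => fun _ _ _ h h' => 𝓟.divR_actL_inv h h'
    | false, true, false, true => fun p p' p'' (h : 𝓟.ε p = 𝓟.ε p') (h' : 𝓟.π p' = 𝓟.π p'') => by
      change 𝓟.actR p'' (𝓗.inv (𝓟.divR p p')) = 𝓟.actL (𝓖.inv (𝓟.divL p' p'')) p
      rw [𝓟.inv_divR h, 𝓟.inv_divL h', 𝓟.actL_divL_eq_actR_divR h'.symm h.symm]
    | false, true, false, false => fun _ _ _ h h' => (𝓟.divR_actR_right h h').symm
    | false, false, true, true => fun h p g (hp : 𝓗.s h = 𝓟.π p) (hg : 𝓟.ε p = 𝓖.t g) =>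
      (𝓟.act_comm _ _ _ (by rw [𝓖.s_inv, hg]) (by rw [𝓗.t_inv, hp])).symm
    | false, false, true, false => fun _ _ _ h h' => 𝓟.divR_actR_inv_left h h'
    | false, false, false, true => fun h h' p (hh : 𝓗.s h = 𝓗.t h') (hp : 𝓗.s h' = 𝓟.π p) => by
      change 𝓟.actR p (𝓗.inv (𝓗.mul h h')) = 𝓟.actR (𝓟.actR p (𝓗.inv h')) (𝓗.inv h)
      rw [𝓗.mul_inv_rev _ _ hh, 𝓟.actR_mul _ _ _ (by rw [𝓗.t_inv, hp])
        (by rw [𝓗.s_inv, 𝓗.t_inv, hh])]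
    | false, false, false, false => 𝓗.mul_assoc
  inv_mul_cancel_left {i j k} := match i, j, k with
    | true, true, true => 𝓖.inv_mul_cancel_left
    | true, true, false => fun _ _ h => 𝓟.actL_inv_actL h
    | true, false, true => fun p p' (h : 𝓟.π p = 𝓟.π p') => by
      change 𝓟.actL (𝓖.inv (𝓟.divL p p')) p = p'
      rw [𝓟.inv_divL h, 𝓟.actL_divL h.symm]
    | true, false, false => fun _ _ h => 𝓟.divR_eq h rfl
    | false, true, true => fun p g (h : 𝓟.ε p = 𝓖.t g) =>
      𝓟.divL_eq (𝓟.ε_actL_inv h.symm).symm (𝓟.actL_actL_inv h.symm)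
    | false, true, false => fun _ _ h => 𝓟.actR_divR h
    | false, false, true => fun h p (hp : 𝓗.s h = 𝓟.π p) => by
      change 𝓟.actR (𝓟.actR p (𝓗.inv h)) (𝓗.inv (𝓗.inv h)) = p
      rw [𝓗.inv_inv, 𝓟.actR_inv_actR hp.symm]
    | false, false, false => 𝓗.inv_mul_cancel_left
  mul_inv_cancel_right {i j k} := match i, j, k with
    | true, true, true => 𝓖.mul_inv_cancel_right
    | true, true, false => fun _ _ h => 𝓟.divL_eq h rfl
    | true, false, true => fun _ _ h => 𝓟.actL_divL h
    | true, false, false => fun _ _ h => 𝓟.actR_actR_inv h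
    | false, true, true => fun p g (h : 𝓟.ε p = 𝓖.t g) => by
      change 𝓟.actL (𝓖.inv (𝓖.inv g)) (𝓟.actL (𝓖.inv g) p) = p
      rw [𝓖.inv_inv, 𝓟.actL_actL_inv h.symm]
    | false, true, false => fun p p' (h : 𝓟.ε p = 𝓟.ε p') => by
      change 𝓟.actR p' (𝓗.inv (𝓟.divR p p')) = p
      rw [𝓟.inv_divR h, 𝓟.actR_divR h.symm]
    | false, false, true => fun h p (hp : 𝓗.s h = 𝓟.π p) =>
      𝓟.divR_eq (𝓟.π_actR_inv hp.symm) (𝓟.actR_inv_actR hp.symm)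
    | false, false, false => 𝓗.mul_inv_cancel_right

end MoritaBibundle

end Linking

end ConvMorita

namespace ConvMorita

open scoped Topology

/-! ### Convolution on the linking groupoid -/

section Linking

variable {E : Type*} [NormedAddCommGroup E] [NormedSpace ℝ E]
  {G₀ : Type u} [TopologicalSpace G₀] [ChartedSpace E G₀]
  {G₁ : Type u} [TopologicalSpace G₁] [ChartedSpace E G₁]
  {E' : Type*} [NormedAddCommGroup E'] [NormedSpace ℝ E']
  {H₀ : Type u} [TopologicalSpace H₀] [ChartedSpace E' H₀]
  {H₁ : Type u} [TopologicalSpace H₁] [ChartedSpace E' H₁]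
  {𝓖 : EtaleGroupoid E G₀ G₁} {𝓗 : EtaleGroupoid E' H₀ H₁}
  {F : Type*} [NormedAddCommGroup F] [NormedSpace ℝ F]
  {P : Type u} [TopologicalSpace P] [ChartedSpace F P] (𝓟 : MoritaBibundle 𝓖 𝓗 F P)

theorem EtaleGroupoid.isEtale_s (𝓖 : EtaleGroupoid E G₀ G₁) : IsEtale E E 𝓖.s :=
  isEtale_of_isLocalDiffeomorph 𝓖.etale_s

theorem EtaleGroupoid.isEtale_t (𝓖 : EtaleGroupoid E G₀ G₁) : IsEtale E E 𝓖.t :=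
  isEtale_of_isLocalDiffeomorph 𝓖.etale_t

namespace MoritaBibundle

/-- Local injectivity: if `π x = π y` with `x` and `y` near `p`, the arrow `d` with `d y = x` is
close to a unit. It has the same source as the unit at `ε y`, so it equals that unit because `s` is
locally injective, and `x = y`. -/
theorem isEtale_π : IsEtale F E' 𝓟.π := by
  refine isEtale_of_isSubmersion 𝓟.submersion_π fun p => ?_
  have hε : Continuous 𝓟.ε := 𝓟.submersion_ε.contMDiff.continuous
  obtain ⟨W, hW, hinj⟩ := 𝓖.isEtale_s.exists_injOn (𝓖.unit (𝓟.ε p))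
  have hd : 𝓟.divL p p = 𝓖.unit (𝓟.ε p) := 𝓟.divL_eq (𝓖.s_unit _) (𝓟.actL_unit p)
  have h1 : ∀ᶠ x in 𝓝 (p, p), 𝓟.π x.1 = 𝓟.π x.2 → 𝓟.divL x.1 x.2 ∈ W := by
    have := (𝓟.contMDiffOn_divL.continuousOn (p, p) rfl).eventually
      (p := fun g => g ∈ W) (by
        change ∀ᶠ y in 𝓝 (𝓟.divL p p), y ∈ W
        rw [hd]
        exact hW)
    exact eventually_nhdsWithin_iff.1 this
  have h2 : ∀ᶠ x in 𝓝 p, 𝓖.unit (𝓟.ε x) ∈ W :=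
    (𝓖.etale_unit.contMDiff.continuous.comp hε).continuousAt.eventually hW
  rw [nhds_prod_eq, Filter.eventually_prod_self_iff'] at h1
  obtain ⟨U, hU, h1⟩ := h1
  refine ⟨U ∩ {x | 𝓖.unit (𝓟.ε x) ∈ W}, Filter.inter_mem hU h2, fun x hx y hy hxy => ?_⟩
  have := hinj (h1 x hx.1 y hy.1 hxy) hy.2 (by rw [𝓟.s_divL hxy, 𝓖.s_unit])
  rw [← 𝓟.actL_divL hxy, this, 𝓟.actL_unit]

/-- The same argument for the right action, with local injectivity of `t` on `H₁`. -/
theorem isEtale_ε : IsEtale F E 𝓟.ε := by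
  refine isEtale_of_isSubmersion 𝓟.submersion_ε fun p => ?_
  have hπ : Continuous 𝓟.π := 𝓟.submersion_π.contMDiff.continuous
  obtain ⟨W, hW, hinj⟩ := 𝓗.isEtale_t.exists_injOn (𝓗.unit (𝓟.π p))
  have hd : 𝓟.divR p p = 𝓗.unit (𝓟.π p) := 𝓟.divR_eq (𝓗.t_unit _).symm (𝓟.actR_unit p)
  have h1 : ∀ᶠ x in 𝓝 (p, p), 𝓟.ε x.1 = 𝓟.ε x.2 → 𝓟.divR x.1 x.2 ∈ W := by
    have := (𝓟.contMDiffOn_divR.continuousOn (p, p) rfl).eventually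
      (p := fun g => g ∈ W) (by
        change ∀ᶠ y in 𝓝 (𝓟.divR p p), y ∈ W
        rw [hd]
        exact hW)
    exact eventually_nhdsWithin_iff.1 this
  have h2 : ∀ᶠ x in 𝓝 p, 𝓗.unit (𝓟.π x) ∈ W :=
    (𝓗.etale_unit.contMDiff.continuous.comp hπ).continuousAt.eventually hW
  rw [nhds_prod_eq, Filter.eventually_prod_self_iff'] at h1
  obtain ⟨U, hU, h1⟩ := h1
  refine ⟨U ∩ {x | 𝓗.unit (𝓟.π x) ∈ W}, Filter.inter_mem hU h2, fun x hx y hy hxy => ?_⟩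
  have := hinj (h1 x hx.1 y hy.1 hxy) hx.2 (by rw [𝓟.t_divR hxy, 𝓗.t_unit])
  rw [← 𝓟.actR_divR hxy, this, 𝓟.actR_unit]

end MoritaBibundle

variable (E G₁ F P E' H₁) in
/-- The function spaces on the pieces of the linking groupoid. -/
abbrev LinkSpaces : Bool → Bool → Type u := LinkArrows (Cc E G₁) (Cc F P) (Cc E' H₁)

variable (E G₁ F P E' H₁) in
/-- Elements of the function spaces on the linking groupoid as functions. -/
def linkEval : ∀ i j, LinkSpaces E G₁ E' H₁ F P i j →ₗ[ℂ] (LinkArrows G₁ P H₁ i j → ℂ)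
  | true, true => (ccSubmodule E G₁).subtype
  | true, false => (ccSubmodule F P).subtype
  | false, true => (ccSubmodule F P).subtype
  | false, false => (ccSubmodule E' H₁).subtype

/-! ### Supports and involutions on a single piece -/

section Generic

variable {A B : Type*} [NormedAddCommGroup A] [NormedSpace ℝ A] {Q : Type u}
  [TopologicalSpace Q] [ChartedSpace A Q] {Z : Type*} [TopologicalSpace Z]

theorem Cc.finite_fiber [NormedAddCommGroup B] [NormedSpace ℝ B] [ChartedSpace B Z] [T1Space Z]
    {t : Q → Z} (ht : IsEtale A B t) (c : Cc A Q) (z : Z) : {q | t q = z ∧ c q ≠ 0}.Finite :=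
  (ht.finite_fiber c.2.2 z).subset fun _ hq => ⟨subset_tsupport _ hq.2, hq.1⟩

theorem Cc.exists_compact_image [FiniteDimensional ℝ A] [IsManifold 𝓘(ℝ, A) ∞ Q] {t : Q → Z}
    (ht : Continuous t) (S : Set (Cc A Q)) (hS : Bornology.IsBounded S) :
    ∃ C : Set Z, IsCompact C ∧ ∀ c ∈ S, ∀ q, c q ≠ 0 → t q ∈ C := by
  obtain ⟨K, hK, hKS, -⟩ := Cc.smoothFamily_of_isBounded hS
  refine ⟨t '' K, hK.image ht, fun c hc q hq => ⟨q, ?_, rfl⟩⟩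
  by_contra h
  exact hq (hKS c hc q h)

theorem Cc.exists_comp_involution [T2Space Q] {ν : Q → Q} (hν : ContMDiff 𝓘(ℝ, A) 𝓘(ℝ, A) ∞ ν)
    (h : ∀ q, ν (ν q) = q) (c : Cc A Q) : ∃ c' : Cc A Q, ∀ q, c' (ν q) = c q := by
  obtain ⟨c', hc', -⟩ := exists_cc_pullback hν isOpen_univ (c.2.2.image hν.continuous)
    (subset_univ _) c.contMDiff fun q _ hq => ⟨ν q, subset_tsupport _ hq, h q⟩
  exact ⟨c', fun q => by rw [hc' _ (mem_univ _), h]⟩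

end Generic

variable [FiniteDimensional ℝ E] [FiniteDimensional ℝ E'] [FiniteDimensional ℝ F]
  [IsManifold 𝓘(ℝ, E) ∞ G₀] [T2Space G₀] [IsManifold 𝓘(ℝ, E) ∞ G₁] [T2Space G₁]
  [IsManifold 𝓘(ℝ, E') ∞ H₀] [T2Space H₀] [IsManifold 𝓘(ℝ, E') ∞ H₁] [T2Space H₁]
  [IsManifold 𝓘(ℝ, F) ∞ P] [T2Space P]

namespace MoritaBibundle

/-- Only the smoothness of `(q, γ) ↦ q⁻¹ γ` and the continuity of the product differ between the
eight cases; in each they come from the structure maps of the groupoids or of the bibundle. -/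
theorem exists_linking_conv (i j k : Bool) :
    (∀ a b, ∃ c, ∀ γ, linkEval E G₁ E' H₁ F P i k c γ =
      𝓟.linking.conv (linkEval E G₁ E' H₁ F P i j a) (linkEval E G₁ E' H₁ F P j k b) γ) ∧
    ∀ S T, Bornology.IsBounded S → Bornology.IsBounded T →
      Bornology.IsBounded {c | ∃ a ∈ S, ∃ b ∈ T, ∀ γ, linkEval E G₁ E' H₁ F P i k c γ =
        𝓟.linking.conv (linkEval E G₁ E' H₁ F P i j a) (linkEval E G₁ E' H₁ F P j k b) γ} := by
  have hmul : ∀ (q : LinkArrows G₁ P H₁ i j) (γ : LinkArrows G₁ P H₁ i k),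
      𝓟.linking.t q = 𝓟.linking.t γ →
      𝓟.linking.s q = 𝓟.linking.t (𝓟.linking.mul (𝓟.linking.inv q) γ) ∧
        𝓟.linking.mul q (𝓟.linking.mul (𝓟.linking.inv q) γ) = γ := fun q γ h =>
    ⟨(𝓟.linking.t_div q γ h).symm, 𝓟.linking.mul_inv_cancel_left q γ h⟩
  have hG := 𝓖.etale_inv.contMDiff
  have hH := 𝓗.etale_inv.contMDiff
  have hsG := 𝓖.etale_s.contMDiff.continuous
  have hsH := 𝓗.etale_s.contMDiff.continuous
  have htG := 𝓖.etale_t.contMDiff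
  have htH := 𝓗.etale_t.contMDiff
  have hε := 𝓟.isEtale_ε.contMDiff
  have hπ := 𝓟.isEtale_π.contMDiff
  match i, j, k with
  | true, true, true =>
    refine exists_conv_and_isBounded 𝓖.isEtale_t htG ?_ hsG htG.continuous
      𝓖.smooth_mul.continuousOn hmul
    exact 𝓖.smooth_mul.comp ((hG.comp contMDiff_fst).prodMk contMDiff_snd).contMDiffOn
      fun x hx => (𝓖.s_inv x.1).trans hx
  | true, true, false =>
    refine exists_conv_and_isBounded 𝓖.isEtale_t hε ?_ hsG hε.continuous
      𝓟.smooth_actL.continuousOn hmul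
    exact 𝓟.smooth_actL.comp ((hG.comp contMDiff_fst).prodMk contMDiff_snd).contMDiffOn
      fun x hx => (𝓖.s_inv x.1).trans hx
  | true, false, true =>
    refine exists_conv_and_isBounded 𝓟.isEtale_ε htG ?_ hπ.continuous hπ.continuous
      𝓟.contMDiffOn_divL.continuousOn hmul
    exact 𝓟.smooth_actL.comp ((hG.comp contMDiff_snd).prodMk contMDiff_fst).contMDiffOn
      fun x hx => (𝓖.s_inv x.2).trans (Eq.symm hx)
  | true, false, false =>
    exact exists_conv_and_isBounded 𝓟.isEtale_ε hε 𝓟.contMDiffOn_divR hπ.continuous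
      htH.continuous 𝓟.smooth_actR.continuousOn hmul
  | false, true, true =>
    refine exists_conv_and_isBounded 𝓟.isEtale_π hπ 𝓟.contMDiffOn_divL hε.continuous
      htG.continuous (m := fun x => 𝓟.actL (𝓖.inv x.2) x.1) ?_ hmul
    exact (𝓟.smooth_actL.comp ((hG.comp contMDiff_snd).prodMk contMDiff_fst).contMDiffOn
      fun x hx => (𝓖.s_inv x.2).trans (Eq.symm hx)).continuousOn
  | false, true, false =>
    exact exists_conv_and_isBounded 𝓟.isEtale_π htH 𝓟.smooth_actR hε.continuous hε.continuous
      𝓟.contMDiffOn_divR.continuousOn hmul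
  | false, false, true =>
    -- The double inverse has two origins: convolution uses `h⁻¹`, and the opposite action inverts
    -- once more.
    refine exists_conv_and_isBounded 𝓗.isEtale_t hπ (D := fun h p => 𝓟.actR p (𝓗.inv (𝓗.inv h)))
      ?_ hsH hπ.continuous (m := fun x => 𝓟.actR x.2 (𝓗.inv x.1)) ?_ hmul
    · simp only [𝓗.inv_inv]
      exact 𝓟.smooth_actR.comp (contMDiff_snd.prodMk contMDiff_fst).contMDiffOn
        fun x hx => Eq.symm hx
    · exact (𝓟.smooth_actR.comp (contMDiff_snd.prodMk (hH.comp contMDiff_fst)).contMDiffOn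
        fun x hx => (Eq.symm hx).trans (𝓗.t_inv x.1).symm).continuousOn
  | false, false, false =>
    refine exists_conv_and_isBounded 𝓗.isEtale_t htH ?_ hsH htH.continuous
      𝓗.smooth_mul.continuousOn hmul
    exact 𝓗.smooth_mul.comp ((hH.comp contMDiff_fst).prodMk contMDiff_snd).contMDiffOn
      fun x hx => (𝓗.s_inv x.1).trans hx

/-- The spaces of smooth compactly supported functions on the linking groupoid. -/
def convolutionSpaces : ConvolutionSpaces (LinkArrows G₁ P H₁) (LinkObjects G₀ H₀) 𝓟.linking
    (LinkSpaces E G₁ E' H₁ F P) where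
  complete
    | true, true => Cc.isCompleteBVS E G₁
    | true, false => Cc.isCompleteBVS F P
    | false, true => Cc.isCompleteBVS F P
    | false, false => Cc.isCompleteBVS E' H₁
  freeExtension
    | true, true => Cc.hasFreeExtension E G₁
    | true, false => Cc.hasFreeExtension F P
    | false, true => Cc.hasFreeExtension F P
    | false, false => Cc.hasFreeExtension E' H₁
  eval := linkEval E G₁ E' H₁ F P
  eval_injective
    | true, true => Subtype.val_injective
    | true, false => Subtype.val_injective
    | false, true => Subtype.val_injective
    | false, false => Subtype.val_injective
  finiteOnFibers
    | true, true => fun c z => Cc.finite_fiber 𝓖.isEtale_t c z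
    | true, false => fun c z => Cc.finite_fiber 𝓟.isEtale_ε c z
    | false, true => fun c z => Cc.finite_fiber 𝓟.isEtale_π c z
    | false, false => fun c z => Cc.finite_fiber 𝓗.isEtale_t c z
  exists_conv i j k a b :=
    let ⟨c, hc⟩ := (𝓟.exists_linking_conv i j k).1 a b
    ⟨c, funext hc⟩
  bounded_conv i j k S T hS hT :=
    ((𝓟.exists_linking_conv i j k).2 S T hS hT).subset fun _ ⟨a, ha, b, hb, h⟩ =>
      ⟨a, ha, b, hb, congrFun h⟩
  compact_t
    | true, true => Cc.exists_compact_image 𝓖.isEtale_t.contMDiff.continuous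
    | true, false => Cc.exists_compact_image 𝓟.isEtale_ε.contMDiff.continuous
    | false, true => Cc.exists_compact_image 𝓟.isEtale_π.contMDiff.continuous
    | false, false => Cc.exists_compact_image 𝓗.isEtale_t.contMDiff.continuous
  compact_s
    | true, true => Cc.exists_compact_image 𝓖.isEtale_s.contMDiff.continuous
    | true, false => Cc.exists_compact_image 𝓟.isEtale_π.contMDiff.continuous
    | false, true => Cc.exists_compact_image 𝓟.isEtale_ε.contMDiff.continuous
    | false, false => Cc.exists_compact_image 𝓗.isEtale_s.contMDiff.continuous

variable [SecondCountableTopology G₀] [SecondCountableTopology H₀]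

/-- In each piece `t` is a surjective étale map and `s` is locally injective, so
`exists_local_sections` applies. The second family must live on the opposite piece, to which it is
carried by inversion; on `P` this is the identity. -/
theorem nonempty_localSections (i j : Bool) :
    Nonempty (LocalSections (LinkArrows G₁ P H₁) (LinkObjects G₀ H₀) 𝓟.convolutionSpaces i j) := by
  have key : ∀ {x : LinkObjects G₀ H₀ i → LinkSpaces E G₁ E' H₁ F P i j}
      {y : LinkObjects G₀ H₀ i → LinkArrows G₁ P H₁ i j → ℂ},
      (∀ n, ∃ c, ∀ q, linkEval E G₁ E' H₁ F P j i c (𝓟.linking.inv q) = y n q) →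
      ((∀ n q q', linkEval E G₁ E' H₁ F P i j (x n) q ≠ 0 → y n q' ≠ 0 →
          𝓟.linking.s q = 𝓟.linking.s q' → q = q') ∧
        (∀ C : Set (LinkObjects G₀ H₀ i), IsCompact C → ∃ J : Finset (LinkObjects G₀ H₀ i),
          ∀ n ∉ J, ∀ q, 𝓟.linking.t q ∈ C →
            linkEval E G₁ E' H₁ F P i j (x n) q = 0 ∧ y n q = 0) ∧
        ∀ z, ∑ᶠ n, ∑ᶠ q ∈ {q : LinkArrows G₁ P H₁ i j | 𝓟.linking.t q = z},
          linkEval E G₁ E' H₁ F P i j (x n) q * y n q = 1) →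
      Nonempty (LocalSections (LinkArrows G₁ P H₁) (LinkObjects G₀ H₀)
        𝓟.convolutionSpaces i j) := by
    rintro x y hc ⟨h1, h2, h3⟩
    choose c hc using hc
    obtain rfl : (fun n q => linkEval E G₁ E' H₁ F P j i (c n) (𝓟.linking.inv q)) = y :=
      funext fun n => funext (hc n)
    exact ⟨⟨LinkObjects G₀ H₀ i, x, c, h1, h2, h3⟩⟩
  match i, j with
  | true, true =>
    obtain ⟨x, y, h⟩ := 𝓖.isEtale_t.exists_local_sections 𝓖.surjective_t 𝓖.isEtale_s.exists_injOn
    exact key (x := x) (y := fun n => (y n).1)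
      (fun n => Cc.exists_comp_involution 𝓖.etale_inv.contMDiff 𝓖.inv_inv (y n)) h
  | true, false =>
    obtain ⟨x, y, h⟩ :=
      𝓟.isEtale_ε.exists_local_sections 𝓟.surjective_ε 𝓟.isEtale_π.exists_injOn
    exact key (x := x) (y := fun n => (y n).1) (fun n => ⟨y n, fun _ => rfl⟩) h
  | false, true =>
    obtain ⟨x, y, h⟩ :=
      𝓟.isEtale_π.exists_local_sections 𝓟.surjective_π 𝓟.isEtale_ε.exists_injOn
    exact key (x := x) (y := fun n => (y n).1) (fun n => ⟨y n, fun _ => rfl⟩) h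
  | false, false =>
    obtain ⟨x, y, h⟩ := 𝓗.isEtale_t.exists_local_sections 𝓗.surjective_t 𝓗.isEtale_s.exists_injOn
    exact key (x := x) (y := fun n => (y n).1)
      (fun n => Cc.exists_comp_involution 𝓗.etale_inv.contMDiff 𝓗.inv_inv (y n)) h

end MoritaBibundle

end Linking

/-! ### Reindexing block convolutions into the stated formulas -/

section Formulas

variable {E : Type*} [NormedAddCommGroup E] [NormedSpace ℝ E]
  {G₀ : Type u} [TopologicalSpace G₀] [ChartedSpace E G₀]
  {G₁ : Type u} [TopologicalSpace G₁] [ChartedSpace E G₁]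
  {E' : Type*} [NormedAddCommGroup E'] [NormedSpace ℝ E']
  {H₀ : Type u} [TopologicalSpace H₀] [ChartedSpace E' H₀]
  {H₁ : Type u} [TopologicalSpace H₁] [ChartedSpace E' H₁]
  {𝓖 : EtaleGroupoid E G₀ G₁} {𝓗 : EtaleGroupoid E' H₀ H₁}
  {F : Type*} [NormedAddCommGroup F] [NormedSpace ℝ F]
  {P : Type u} [TopologicalSpace P] [ChartedSpace F P] (𝓟 : MoritaBibundle 𝓖 𝓗 F P)

/-- A factorization of `γ` is determined by its first factor. -/
theorem EtaleGroupoid.conv_eq_finsum (𝓖 : EtaleGroupoid E G₀ G₁) (a b : G₁ → ℂ) (γ : G₁) :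
    ∑ᶠ g ∈ {g | 𝓖.t g = 𝓖.t γ}, a g * b (𝓖.mul (𝓖.inv g) γ) = 𝓖.conv a b γ := by
  refine finsum_mem_eq_of_bijOn (fun g => (g, 𝓖.mul (𝓖.inv g) γ)) ⟨?_, ?_, ?_⟩ fun _ _ => rfl
  · intro g hg
    have hg' : 𝓖.s (𝓖.inv g) = 𝓖.t γ := (𝓖.s_inv g).trans hg
    refine ⟨by rw [𝓖.t_mul _ _ hg', 𝓖.t_inv], ?_⟩
    have := 𝓖.inv_mul_cancel_left (𝓖.inv g) γ hg'
    rwa [𝓖.inv_inv] at this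
  · exact fun g _ g' _ h => congrArg Prod.fst h
  · rintro ⟨g, g'⟩ ⟨h, rfl⟩
    exact ⟨g, (𝓖.t_mul g g' h).symm, Prod.ext rfl (𝓖.inv_mul_cancel_left g g' h)⟩

namespace MoritaBibundle

/-- The points of the `ε`-fibre through `p` are the `p h`, and the arrow from `p h` back to `p` is
`h⁻¹`. -/
theorem rightAct_eq_finsum (ξ : P → ℂ) (b : H₁ → ℂ) (p : P) :
    ∑ᶠ q ∈ {q | 𝓟.ε q = 𝓟.ε p}, ξ q * b (𝓟.divR q p) = 𝓟.rightAct ξ b p := by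
  symm
  refine finsum_mem_eq_of_bijOn (fun h => 𝓟.actR p h) ⟨?_, ?_, ?_⟩ fun h hh => ?_
  · exact fun h hh => 𝓟.ε_actR p h (Eq.symm hh)
  · intro h hh h' hh' he
    rw [← 𝓟.divR_eq (p := p) (Eq.symm hh) rfl, ← 𝓟.divR_eq (p := p) (Eq.symm hh') rfl]
    exact congrArg (𝓟.divR p) he
  · exact fun q hq => ⟨𝓟.divR p q, 𝓟.t_divR (Eq.symm hq), 𝓟.actR_divR (Eq.symm hq)⟩
  · have hh' : 𝓟.π p = 𝓗.t h := Eq.symm hh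
    rw [𝓟.divR_eq (p := 𝓟.actR p h) (h := 𝓗.inv h) (by rw [𝓟.π_actR _ _ hh', 𝓗.t_inv])
      (𝓟.actR_actR_inv hh')]

/-- The points of the `π`-fibre through `p` are the `g p`, each for exactly one `g`. -/
theorem opRightAct_eq_finsum (ξ : P → ℂ) (a : G₁ → ℂ) (p : P) :
    ∑ᶠ q ∈ {q | 𝓟.π q = 𝓟.π p}, ξ q * a (𝓟.divL q p) = 𝓟.opRightAct ξ a p := by
  symm
  refine finsum_mem_eq_of_bijOn (fun g => 𝓟.actL g p) ⟨?_, ?_, ?_⟩ fun g hg => ?_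
  · exact fun g hg => 𝓟.π_actL g p hg
  · intro g hg g' hg' he
    rw [← 𝓟.divL_eq (p := p) hg rfl, ← 𝓟.divL_eq (p := p) hg' rfl]
    exact congrArg (fun q => 𝓟.divL q p) he
  · exact fun q hq => ⟨𝓟.divL q p, 𝓟.s_divL hq, 𝓟.actL_divL hq⟩
  · rw [𝓟.divL_eq hg rfl]

theorem opLeftAct_eq_finsum (b : H₁ → ℂ) (ξ : P → ℂ) (p : P) :
    ∑ᶠ h ∈ {h | 𝓗.t h = 𝓟.π p}, b h * ξ (𝓟.actR p (𝓗.inv (𝓗.inv h))) = 𝓟.opLeftAct b ξ p := by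
  simp only [𝓗.inv_inv]
  rfl

end MoritaBibundle

end Formulas

end ConvMorita

end

/-! ### Assembly of the theorem -/

theorem theoremT
    {E : Type*} [NormedAddCommGroup E] [NormedSpace ℝ E] [FiniteDimensional ℝ E]
    {G₀ : Type u} [TopologicalSpace G₀] [ChartedSpace E G₀] [IsManifold 𝓘(ℝ, E) ∞ G₀]
    [T2Space G₀] [SecondCountableTopology G₀]
    {G₁ : Type u} [TopologicalSpace G₁] [ChartedSpace E G₁] [IsManifold 𝓘(ℝ, E) ∞ G₁]
    [T2Space G₁] [SecondCountableTopology G₁]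
    {E' : Type*} [NormedAddCommGroup E'] [NormedSpace ℝ E'] [FiniteDimensional ℝ E']
    {H₀ : Type u} [TopologicalSpace H₀] [ChartedSpace E' H₀] [IsManifold 𝓘(ℝ, E') ∞ H₀]
    [T2Space H₀] [SecondCountableTopology H₀]
    {H₁ : Type u} [TopologicalSpace H₁] [ChartedSpace E' H₁] [IsManifold 𝓘(ℝ, E') ∞ H₁]
    [T2Space H₁] [SecondCountableTopology H₁]
    {F : Type*} [NormedAddCommGroup F] [NormedSpace ℝ F] [FiniteDimensional ℝ F]
    {P : Type u} [TopologicalSpace P] [ChartedSpace F P] [IsManifold 𝓘(ℝ, F) ∞ P]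
    [T2Space P] [SecondCountableTopology P]
    (𝓖 : EtaleGroupoid E G₀ G₁) (𝓗 : EtaleGroupoid E' H₀ H₁)
    (h𝓖 : 𝓖.IsProper) (h𝓗 : 𝓗.IsProper) (𝓟 : MoritaBibundle 𝓖 𝓗 F P) :
    -- the convolution algebras, the bimodule `C_c^∞(P)` and the opposite bimodule `C_c^∞(P)`
    ∃ (𝔸 : BornAlg (Cc E G₁)) (𝔹 : BornAlg (Cc E' H₁))
      (𝓧 : Bimod 𝔸 𝔹 (Cc F P)) (𝓨 : Bimod 𝔹 𝔸 (Cc F P)),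
      (∀ a b γ, 𝔸.mul a b γ = 𝓖.conv a b γ) ∧
      (∀ a b γ, 𝔹.mul a b γ = 𝓗.conv a b γ) ∧
      (∀ a ξ p, 𝓧.left.act a ξ p = 𝓟.leftAct a ξ p) ∧
      (∀ ξ b p, 𝓧.right.act ξ b p = 𝓟.rightAct ξ b p) ∧
      (∀ b ξ p, 𝓨.left.act b ξ p = 𝓟.opLeftAct b ξ p) ∧
      (∀ ξ a p, 𝓨.right.act ξ a p = 𝓟.opRightAct ξ a p) ∧
      -- the pairing induces `C_c^∞(P) ⊗_{C_c^∞(G)} C_c^∞(P) ≃ C_c^∞(H)`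
      (∃ β : Cc F P → Cc F P → Cc E' H₁,
        (∀ ξ η h, β ξ η h = 𝓟.pairing ξ η h) ∧ InducesIso 𝓨.right 𝓧.left β) ∧
      -- `C_c^∞(P)` is a Morita equivalence bimodule
      IsMoritaEquivalenceBimodule 𝓧 := by
  have D : ∀ i j, 𝓟.convolutionSpaces.algebroid.DualBasis i j := fun i j =>
    ConvolutionSpaces.dualBasis (𝓟.nonempty_localSections i j).some
  have hmul : ∀ i j k a b γ, linkEval E G₁ E' H₁ F P i k (𝓟.convolutionSpaces.mul i j k a b) γ =
      𝓟.linking.conv (linkEval E G₁ E' H₁ F P i j a) (linkEval E G₁ E' H₁ F P j k b) γ :=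
    fun i j k a b γ => congrFun (𝓟.convolutionSpaces.eval_mul a b) γ
  -- The object `true` stands for the `G`-side and `false` for the `H`-side. The pairing is the
  -- product through `false`, `true`, `false`, so its isomorphism comes from the dual basis for
  -- `false` and `true`.
  refine ⟨𝓟.convolutionSpaces.algebroid.alg true, 𝓟.convolutionSpaces.algebroid.alg false,
    𝓟.convolutionSpaces.algebroid.bimod true false, 𝓟.convolutionSpaces.algebroid.bimod false true,
    fun a b γ => ?_, fun a b γ => ?_, fun a ξ p => ?_, fun ξ b p => ?_, fun b ξ p => ?_,
    fun ξ a p => ?_, ⟨fun ξ η => 𝓟.convolutionSpaces.mul false true false ξ η, fun ξ η h => ?_,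
      (D false true).inducesIso false⟩,
    𝓟.convolutionSpaces.algebroid.isMoritaEquivalenceBimodule D true false⟩
  · exact (hmul true true true a b γ).trans (𝓖.conv_eq_finsum a b γ)
  · exact (hmul false false false a b γ).trans (𝓗.conv_eq_finsum a b γ)
  -- The left action and the pairing are block convolutions by definition, so no reindexing is
  -- required.
  · exact hmul true true false a ξ p
  · exact (hmul true false false ξ b p).trans (𝓟.rightAct_eq_finsum ξ b p)
  · exact (hmul false false true b ξ p).trans (𝓟.opLeftAct_eq_finsum b ξ p)
  · exact (hmul false true true ξ a p).trans (𝓟.opRightAct_eq_finsum ξ a p)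
  · exact hmul false true false ξ η h
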